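/- Let $A:\mathbb R^2\to\mathbb C$ be continuous with $\limsup_{p\to\infty}|A(p)|/p^2<1$, and let $H_0$ be the self-adjoint operator in $L^2(\mathbb R^2)\otimes\mathbb C^2$ that acts in Fourier space as multiplication by $$\widehat H_0(p)=\begin{pmatrix}p^2&A(p)\\ \overline{A(p)}&p^2\end{pmatrix}.$$ Put $\kappa=\inf_{p}\,(p^2-|A(p)|)$ and $S=\{p\in\mathbb R^2: p^2-|A(p)|=\kappa\}$, and let $\#S\in\mathbb N\cup\{\infty\}$ be the number of points of $S$ ($\infty$ if $S$ is infinite). Assume that $|A|$ is of class $C^2$ in a neighbourhood of $S$. Let $m$ be a finite positive Borel measure on $\mathbb R^2$ and $h:\mathbb R^2\to\mathbb R$ a bounded Borel function such that, for some $a\in(0,1)$ and $b>0$, $$\int(1+|h|^2)|f|^2\,dm\le a\int|\nabla f|^2\,dx+b\int|f|^2\,dx\qquad\text{for all Schwartz functions } f,$$ and put $\nu=hm$. Let $J:H^1(\mathbb R^2)\to L^2(\mathbb R^2,m)$ be the continuous extension of $f\mapsto f$, $f$ Schwartz, and $J_2=J\otimes 1$. Let $q(u,v)=q_0(u,v)+\int\langle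 J_2u,J_2v\rangle_{\mathbb C^2}\,d\nu$ on $H^1(\mathbb R^2)\otimes\mathbb C^2$, where $q_0$ is the sesquilinear form of $H_0$. Assume that the form $\int\langle J_2u,J_2v\rangle\,d\nu$ is bounded relative to $q_0$ with relative bound less than $1$ (for $\nu\le 0$ this is equivalent to $q$ being closed and semibounded from below), and let $H=H_0+\nu$ be the self-adjoint operator associated with $q$. If $\nu\le0$ and $\operatorname{supp}\nu$ has positive Lebesgue measure, then $H$ has at least $\#S$ eigenvalues below $\kappa$, counted with multiplicity; if $S$ is infinite, then $H$ has infinitely many distinct eigenvalues below $\kappa$. In particular, for every real $\alpha\neq0$ and every such $\nu$, the operator $H_0+\nu$ has infinitely many distinct eigenvalues below $\kappa$ if $H_0$ is the Rashba Hamiltonian ($A(p)=\alpha(p_y+ip_x)$) or the Dresselhaus Hamiltonian ($A(p)=-\alpha(p_x+ip_y)$); here the relative bound and the $C^2$ condition hold automatically. -/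

import Mathlib

open MeasureTheory Filter Topology
open scoped FourierTransform LineDeriv SchwartzMap ENNReal

noncomputable section

namespace SpinOrbit

/-- The Euclidean plane `ℝ²`. -/
abbrev Plane : Type := EuclideanSpace ℝ (Fin 2)

/-- The scalar space `L²(ℝ²)`. -/
abbrev L2 : Type := Lp (α := Plane) ℂ 2 volume

/-- The Hilbert space `L²(ℝ²) ⊗ ℂ²` of two-dimensional spinors. -/
abbrev Spinor : Type := PiLp 2 (fun _ : Fin 2 => L2)

/-! ### The Sobolev space `H¹(ℝ²)` -/

/-- The Sobolev space `H¹(ℝ²)`, realised as the space of all `(f, g₀, g₁)` with `f ∈ L²` and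
`gᵢ = ∂ᵢ f ∈ L²`; the partial derivative is expressed by `(𝓕 gᵢ)(ξ) = 2πi ξᵢ (𝓕 f)(ξ)`, where
`(𝓕 f)(ξ) = ∫ exp (-2πi ⟨ξ, x⟩) f(x) dx`. The norm inherited from the ambient Hilbert space is
`‖f‖² + ‖∂₀ f‖² + ‖∂₁ f‖²`. -/
def H1 : Submodule ℂ (WithLp 2 (L2 × PiLp 2 (fun _ : Fin 2 => L2))) where
  carrier := {u | ∀ i : Fin 2, ∀ᵐ ξ : Plane,
    (𝓕 (u.snd i) : L2) ξ = (2 * Real.pi * ξ i * Complex.I : ℂ) * (𝓕 u.fst : L2) ξ}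
  zero_mem' := by
    intro i
    have h0 : (𝓕 (0 : L2) : L2) = 0 := (Lp.fourierTransformₗᵢ Plane ℂ).map_zero
    simp only [WithLp.zero_fst, WithLp.zero_snd, PiLp.zero_apply, h0]
    filter_upwards [Lp.coeFn_zero ℂ 2 (volume : Measure Plane)] with ξ hξ
    rw [hξ, Pi.zero_apply, mul_zero]
  add_mem' := by
    intro u v hu hv i
    simp only [WithLp.add_fst, WithLp.add_snd, PiLp.add_apply, FourierTransform.fourier_add]
    filter_upwards [hu i, hv i, Lp.coeFn_add (𝓕 (u.snd i) : L2) (𝓕 (v.snd i)),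
      Lp.coeFn_add (𝓕 u.fst : L2) (𝓕 v.fst)] with ξ h1 h2 h3 h4
    rw [h3, h4, Pi.add_apply, Pi.add_apply, h1, h2, mul_add]
  smul_mem' := by
    intro c u hu i
    simp only [WithLp.smul_fst, WithLp.smul_snd, PiLp.smul_apply, FourierTransform.fourier_smul]
    filter_upwards [hu i, Lp.coeFn_smul c (𝓕 (u.snd i) : L2),
      Lp.coeFn_smul c (𝓕 u.fst : L2)] with ξ h1 h3 h4
    rw [h3, h4, Pi.smul_apply, Pi.smul_apply, h1, smul_eq_mul, smul_eq_mul]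
    ring

/-- The inclusion `H¹(ℝ²) → L²(ℝ²)`. -/
def H1.toL2 : H1 →ₗ[ℂ] L2 where
  toFun u := u.1.fst
  map_add' _ _ := rfl
  map_smul' _ _ := rfl

/-- The `i`-th partial derivative `H¹(ℝ²) → L²(ℝ²)`. -/
def H1.deriv (i : Fin 2) : H1 →ₗ[ℂ] L2 where
  toFun u := u.1.snd i
  map_add' _ _ := rfl
  map_smul' _ _ := rfl

/-- The `i`-th standard basis vector of the plane. -/
abbrev e (i : Fin 2) : Plane := EuclideanSpace.single i 1

/-- The inclusion `𝓢(ℝ²) → H¹(ℝ²)`, `φ ↦ (φ, ∂₀ φ, ∂₁ φ)`. -/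
def schwartzToH1 : 𝓢(Plane, ℂ) →ₗ[ℂ] H1 where
  toFun φ := ⟨WithLp.toLp 2 ((φ.toLp 2 : L2), WithLp.toLp 2 fun i : Fin 2 =>
      ((∂_{e i} φ : 𝓢(Plane, ℂ)).toLp 2 : L2)), by
    intro i
    change ∀ᵐ ξ : Plane, (𝓕 ((∂_{e i} φ : 𝓢(Plane, ℂ)).toLp 2 : L2) : L2) ξ =
      (2 * Real.pi * ξ i * Complex.I : ℂ) * (𝓕 (φ.toLp 2 : L2) : L2) ξ
    rw [SchwartzMap.toLp_fourier_eq, SchwartzMap.toLp_fourier_eq]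
    filter_upwards [(𝓕 φ).coeFn_toLp 2 volume,
      (𝓕 (∂_{e i} φ : 𝓢(Plane, ℂ))).coeFn_toLp 2 volume] with ξ h1 h2
    rw [h1, h2, SchwartzMap.fourier_lineDerivOp_eq]
    have hg : Function.HasTemperateGrowth (fun x : Plane => inner ℝ x (e i)) := by fun_prop
    rw [smul_apply, SchwartzMap.smulLeftCLM_apply_apply hg]
    simp [EuclideanSpace.inner_single_right]
    ring⟩
  map_add' φ ψ := by
    apply Subtype.ext
    simp only [LineDeriv.lineDerivOp_add]
    rfl
  map_smul' c φ := by
    apply Subtype.ext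
    simp only [LineDeriv.lineDerivOp_smul]
    rfl

theorem L2_norm_sq {μ : Measure Plane} (f : Lp (α := Plane) ℂ 2 μ) :
    ‖f‖ ^ 2 = ∫ x, ‖f x‖ ^ 2 ∂μ := by
  have h := congrArg RCLike.re (L2.inner_def (𝕜 := ℂ) f f)
  rw [inner_self_eq_norm_sq, ← integral_re (L2.integrable_inner f f)] at h
  simpa only [inner_self_eq_norm_sq] using h

theorem L2_integrable_sq {μ : Measure Plane} (f : Lp (α := Plane) ℂ 2 μ) :
    Integrable (fun x => ‖f x‖ ^ 2) μ :=
  (memLp_two_iff_integrable_sq_norm (Lp.aestronglyMeasurable f)).mp (Lp.memLp f)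

/-- The weight `1 + |p|²` at `p = 2πξ`. -/
def weight (ξ : Plane) : NNReal := 1 + ⟨(2 * Real.pi * ‖ξ‖) ^ 2, sq_nonneg _⟩

theorem continuous_weight : Continuous weight := by
  unfold weight
  fun_prop

theorem H1.ae_weight (u : H1) : (fun ξ : Plane => (weight ξ : ℝ) * ‖(𝓕 (H1.toL2 u) : L2) ξ‖ ^ 2) =ᵐ[volume]
    fun ξ => ‖(𝓕 (H1.toL2 u) : L2) ξ‖ ^ 2 + ∑ k : Fin 2, ‖(𝓕 (H1.deriv k u) : L2) ξ‖ ^ 2 := by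
  have hu : ∀ᵐ ξ : Plane, ∀ k : Fin 2, (𝓕 (H1.deriv k u) : L2) ξ =
      (2 * Real.pi * ξ k * Complex.I : ℂ) * (𝓕 (H1.toL2 u) : L2) ξ :=
    ae_all_iff.mpr u.2
  filter_upwards [hu] with ξ h1
  have hpi : ‖(Real.pi : ℂ)‖ = Real.pi := by simp [abs_of_pos Real.pi_pos]
  have hw : (weight ξ : ℝ) = 1 + (2 * Real.pi * ‖ξ‖) ^ 2 := rfl
  simp only [h1, hw, norm_mul, hpi, Complex.norm_I, Complex.norm_real, Real.norm_eq_abs,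
      Complex.norm_ofNat, mul_one, Fin.sum_univ_two, mul_pow, EuclideanSpace.norm_sq_eq, sq_abs]
  ring

theorem H1.integrable_weight (u : H1) :
    Integrable fun ξ : Plane => (weight ξ : ℝ) * ‖(𝓕 (H1.toL2 u) : L2) ξ‖ ^ 2 :=
  ((L2_integrable_sq _).add (integrable_finsetSum _ fun _ _ => L2_integrable_sq _)).congr
    (H1.ae_weight u).symm

theorem H1.norm_sq (u : H1) :
    ‖u‖ ^ 2 = ∫ ξ : Plane, (weight ξ : ℝ) * ‖(𝓕 (H1.toL2 u) : L2) ξ‖ ^ 2 := by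
  rw [integral_congr_ae (H1.ae_weight u), integral_add (L2_integrable_sq _)
    (integrable_finsetSum _ fun _ _ => L2_integrable_sq _),
    integral_finsetSum _ fun _ _ => L2_integrable_sq _]
  simp only [← L2_norm_sq, Lp.norm_fourier_eq]
  rw [show ‖u‖ = ‖u.1‖ from rfl, WithLp.prod_norm_sq_eq_of_L2, PiLp.norm_sq_eq_of_L2]
  rfl

/-- Schwartz functions are dense in `H¹`. -/
theorem denseRange_schwartzToH1 : DenseRange schwartzToH1 := by
  set μ : Measure Plane := volume.withDensity fun ξ => (weight ξ : ℝ≥0∞) with hμ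
  have : IsLocallyFiniteMeasure μ :=
    IsLocallyFiniteMeasure.withDensity_coe continuous_weight
  have : μ.HasTemperateGrowth := by
    refine ⟨6, ?_⟩
    rw [hμ, integrable_withDensity_iff_integrable_coe_smul continuous_weight.measurable]
    have h0 : Integrable fun x : Plane => ((1 + (2 * Real.pi) ^ 2) * (1 + ‖x‖) ^ (-(4 : ℝ))) :=
      (integrable_one_add_norm (by simp; norm_num)).const_mul _
    refine h0.mono' ?_ (Eventually.of_forall fun x => ?_)
    · refine Continuous.aestronglyMeasurable ?_
      refine (NNReal.continuous_coe.comp continuous_weight).smul ?_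
      exact (continuous_const.add continuous_norm).rpow_const fun x =>
        Or.inl (show (1 : ℝ) + ‖x‖ ≠ 0 from ne_of_gt (by positivity))
    · have hw : (weight x : ℝ) = 1 + (2 * Real.pi * ‖x‖) ^ 2 := rfl
      have hx : 0 < 1 + ‖x‖ := by positivity
      have h6 : (1 + ‖x‖) ^ (-((6 : ℕ) : ℝ)) * (1 + ‖x‖) ^ 2 = (1 + ‖x‖) ^ (-(4 : ℝ)) := by
        rw [← Real.rpow_natCast (1 + ‖x‖) 2, ← Real.rpow_add hx]
        norm_num
      rw [norm_smul, Real.norm_of_nonneg (by positivity), Real.norm_of_nonneg (by positivity), hw,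
        ← h6, mul_comm, mul_left_comm]
      refine mul_le_mul_of_nonneg_left ?_ (by positivity)
      nlinarith [norm_nonneg x, sq_nonneg (2 * Real.pi), mul_nonneg (sq_nonneg (2 * Real.pi)) (norm_nonneg x)]
  intro u
  refine Metric.mem_closure_iff.mpr fun ε hε => ?_
  have hmeas : AEStronglyMeasurable (𝓕 (H1.toL2 u) : L2) μ :=
    (Lp.aestronglyMeasurable _).mono_ac (withDensity_absolutelyContinuous _ _)
  have hmem : MemLp (𝓕 (H1.toL2 u) : L2) 2 μ := by
    rw [memLp_two_iff_integrable_sq_norm hmeas, hμ,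
      integrable_withDensity_iff_integrable_coe_smul continuous_weight.measurable]
    exact H1.integrable_weight u
  have hd : DenseRange (SchwartzMap.toLpCLM ℝ (E := Plane) ℂ 2 μ) :=
    SchwartzMap.denseRange_toLpCLM ENNReal.ofNat_ne_top
  obtain ⟨ψ, hψ⟩ := hd.exists_dist_lt (hmem.toLp _) hε
  refine ⟨_, ⟨𝓕⁻ ψ, rfl⟩, ?_⟩
  refine lt_of_le_of_lt (le_of_eq ?_) hψ
  rw [dist_eq_norm, dist_eq_norm, ← sq_eq_sq₀ (norm_nonneg _) (norm_nonneg _), H1.norm_sq,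
    L2_norm_sq]
  have h1 : ∀ᵐ ξ ∂μ, (hmem.toLp _ - SchwartzMap.toLpCLM ℝ (E := Plane) ℂ 2 μ ψ : Lp (α := Plane) ℂ 2 μ) ξ =
      (𝓕 (H1.toL2 u) : L2) ξ - ψ ξ := by
    filter_upwards [Lp.coeFn_sub (hmem.toLp _) (SchwartzMap.toLpCLM ℝ (E := Plane) ℂ 2 μ ψ),
      hmem.coeFn_toLp, ψ.coeFn_toLp 2 μ] with ξ h2 h3 h4
    rw [h2, Pi.sub_apply, h3, SchwartzMap.toLpCLM_apply, h4]
  have h5 : ∀ᵐ ξ : Plane, (𝓕 (H1.toL2 (u - schwartzToH1 (𝓕⁻ ψ))) : L2) ξ =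
      (𝓕 (H1.toL2 u) : L2) ξ - ψ ξ := by
    have h6 : (𝓕 (H1.toL2 (schwartzToH1 (𝓕⁻ ψ))) : L2) = ψ.toLp 2 := by
      change (𝓕 ((𝓕⁻ ψ : 𝓢(Plane, ℂ)).toLp 2 : L2) : L2) = _
      rw [SchwartzMap.toLp_fourier_eq, FourierTransform.fourier_fourierInv_eq]
    rw [map_sub, show (𝓕 (H1.toL2 u - H1.toL2 (schwartzToH1 (𝓕⁻ ψ))) : L2) = _ from
      (Lp.fourierTransformₗᵢ Plane ℂ).map_sub _ _]
    filter_upwards [Lp.coeFn_sub (𝓕 (H1.toL2 u) : L2) (𝓕 (H1.toL2 (schwartzToH1 (𝓕⁻ ψ)))),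
      ψ.coeFn_toLp 2 volume] with ξ h7 h8
    rw [← h8, ← h6]
    exact h7
  rw [integral_congr_ae (g := fun ξ => ‖(𝓕 (H1.toL2 u) : L2) ξ - ψ ξ‖ ^ 2)
      (h1.mono fun ξ h => by simp only [h]), hμ,
    integral_withDensity_eq_integral_smul continuous_weight.measurable]
  refine integral_congr_ae (h5.mono fun ξ h => ?_)
  simp only [h]
  rfl

/-- The unique bounded linear map `J : H¹(ℝ²) → L²(ℝ², m)` with `J φ = φ` for Schwartz functions:
the continuous extension of `φ ↦ φ` along the dense inclusion `𝓢(ℝ²) → H¹(ℝ²)`. -/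
def J (m : Measure Plane) [IsFiniteMeasure m] : H1 →L[ℂ] Lp (α := Plane) ℂ 2 m :=
  (SchwartzMap.toLpCLM ℂ (E := Plane) ℂ 2 m).toLinearMap.extendOfNorm schwartzToH1

/-! ### The unperturbed operator -/

/-- The off-diagonal entry `A` of the symbol of an unperturbed spin-orbit Hamiltonian: a continuous
complex function with `limsup_{p → ∞} |A(p)| / p² < 1`. -/
structure Coupling where
  A : Plane → ℂ
  continuous : Continuous A
  limsup_lt : limsup (fun p => ‖A p‖ₑ / ‖p‖ₑ ^ 2) (cocompact Plane) < 1

namespace Coupling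

variable (σ : Coupling)

/-- The matrix `Ĥ₀(p)`. -/
def symbol (p : Plane) : Matrix (Fin 2) (Fin 2) ℂ :=
  !![((‖p‖ ^ 2 : ℝ) : ℂ), σ.A p; star (σ.A p), ((‖p‖ ^ 2 : ℝ) : ℂ)]

/-- The lower dispersion law `λ₋(p) = p² - |A(p)|`. -/
def lambdaMinus (p : Plane) : ℝ := ‖p‖ ^ 2 - ‖σ.A p‖

/-- The bottom `κ = inf {p² - |A(p)| : p ∈ ℝ²}` of the spectrum of `H₀`. -/
def kappa : ℝ := ⨅ p : Plane, σ.lambdaMinus p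

/-- The set `S` of the minimum points of `λ₋`. -/
def S : Set Plane := {p | σ.lambdaMinus p = σ.kappa}

/-- `|A|` is of class `C²` in a neighbourhood of `S`. -/
def IsC2NearS : Prop :=
  ∃ U : Set Plane, IsOpen U ∧ σ.S ⊆ U ∧ ContDiffOn ℝ 2 (fun p => ‖σ.A p‖) U

/-- The sesquilinear form of `H₀` on `H¹(ℝ²) ⊗ ℂ²` (antilinear in the first argument):
`q₀(u, v) = ∫ ⟨û(p), Ĥ₀(p) v̂(p)⟩ dp`. The Fourier transform used here has momentum `p = 2πξ`. -/
def form₀ (u v : Fin 2 → H1) : ℂ :=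
  ∫ ξ : Plane, star (fun i => (𝓕 (H1.toL2 (u i)) : L2) ξ) ⬝ᵥ
    (σ.symbol ((2 * Real.pi) • ξ)).mulVec (fun i => (𝓕 (H1.toL2 (v i)) : L2) ξ)

/-- A quadratic bound for the symbol. -/
theorem norm_A_le : ∃ C : ℝ, 0 ≤ C ∧ ∀ p : Plane, ‖σ.A p‖ ≤ C + ‖p‖ ^ 2 := by
  have hev : ∀ᶠ p in cocompact Plane, ‖σ.A p‖ ≤ ‖p‖ ^ 2 := by
    filter_upwards [eventually_lt_of_limsup_lt σ.limsup_lt] with p hp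
    by_contra! hlt
    have h1 : ‖p‖ₑ ^ 2 ≤ ‖σ.A p‖ₑ := by
      rw [← ofReal_norm, ← ofReal_norm, ← ENNReal.ofReal_pow (norm_nonneg _)]
      exact ENNReal.ofReal_le_ofReal hlt.le
    have h0 : ‖σ.A p‖ₑ ≠ 0 := by
      rw [enorm_ne_zero]
      intro h
      rw [h, norm_zero] at hlt
      exact absurd hlt (not_lt.mpr (by positivity))
    have h2 : (1 : ℝ≥0∞) ≤ ‖σ.A p‖ₑ / ‖p‖ₑ ^ 2 := by
      rw [ENNReal.le_div_iff_mul_le (Or.inr h0) (Or.inr enorm_ne_top), one_mul]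
      exact h1
    exact absurd hp (not_lt.mpr h2)
  obtain ⟨K, hK, hKs⟩ := mem_cocompact.mp hev
  obtain ⟨C, hC⟩ := hK.exists_bound_of_continuousOn σ.continuous.continuousOn
  refine ⟨max C 0, le_max_right _ _, fun p => ?_⟩
  by_cases hp : p ∈ K
  · exact (hC p hp).trans ((le_max_left _ _).trans (le_add_of_nonneg_right (by positivity)))
  · exact (hKs hp).trans (le_add_of_nonneg_left (le_max_right _ _))

theorem continuous_symbol (i j : Fin 2) : Continuous fun p => σ.symbol p i j := by
  have hA := σ.continuous
  fin_cases i <;> fin_cases j <;> simp [symbol] <;> fun_prop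

theorem norm_symbol_le : ∃ C : ℝ, 0 ≤ C ∧ ∀ (p : Plane) (i j : Fin 2),
    ‖σ.symbol p i j‖ ≤ C + ‖p‖ ^ 2 := by
  obtain ⟨C, hC0, hC⟩ := σ.norm_A_le
  refine ⟨C, hC0, fun p i j => ?_⟩
  fin_cases i <;> fin_cases j <;> simp [symbol, hC p, hC0]

/-- The integrand of the form of `H₀` is integrable, entry by entry. -/
theorem integrable_entry (u v : H1) (i j : Fin 2) : Integrable fun ξ : Plane =>
    star ((𝓕 (H1.toL2 u) : L2) ξ) *
      (σ.symbol ((2 * Real.pi) • ξ) i j * (𝓕 (H1.toL2 v) : L2) ξ) := by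
  obtain ⟨C, hC0, hC⟩ := σ.norm_symbol_le
  have hint : ∀ f g : L2, Integrable fun ξ : Plane => ‖f ξ‖ * ‖g ξ‖ := fun f g =>
    (Lp.memLp f).norm.integrable_mul (Lp.memLp g).norm
  have hG : Integrable fun ξ : Plane =>
      C * (‖(𝓕 (H1.toL2 u) : L2) ξ‖ * ‖(𝓕 (H1.toL2 v) : L2) ξ‖) +
        ∑ k : Fin 2, ‖(𝓕 (H1.deriv k u) : L2) ξ‖ * ‖(𝓕 (H1.deriv k v) : L2) ξ‖ :=
    ((hint _ _).const_mul C).add (integrable_finsetSum _ fun k _ => hint _ _)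
  refine hG.mono' ?_ ?_
  · have hs : Continuous fun ξ : Plane => σ.symbol ((2 * Real.pi) • ξ) i j :=
      (σ.continuous_symbol i j).comp (continuous_const_smul _)
    exact (continuous_star.comp_aestronglyMeasurable (Lp.aestronglyMeasurable _)).mul
      (hs.aestronglyMeasurable.mul (Lp.aestronglyMeasurable _))
  · have hu : ∀ᵐ ξ : Plane, ∀ k : Fin 2, (𝓕 (H1.deriv k u) : L2) ξ =
        (2 * Real.pi * ξ k * Complex.I : ℂ) * (𝓕 (H1.toL2 u) : L2) ξ :=
      ae_all_iff.mpr u.2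
    have hv : ∀ᵐ ξ : Plane, ∀ k : Fin 2, (𝓕 (H1.deriv k v) : L2) ξ =
        (2 * Real.pi * ξ k * Complex.I : ℂ) * (𝓕 (H1.toL2 v) : L2) ξ :=
      ae_all_iff.mpr v.2
    filter_upwards [hu, hv] with ξ h1 h2
    simp only [h1, h2, norm_mul, norm_star]
    have hn : ‖(2 * Real.pi) • ξ‖ ^ 2 = ∑ k : Fin 2, (2 * Real.pi * |ξ k|) ^ 2 := by
      rw [EuclideanSpace.norm_sq_eq]
      simp [abs_of_pos Real.pi_pos]
    have h3 := hC ((2 * Real.pi) • ξ) i j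
    rw [hn] at h3
    have hpi : ‖(Real.pi : ℂ)‖ = Real.pi := by simp [abs_of_pos Real.pi_pos]
    simp only [Fin.sum_univ_two, hpi, Complex.norm_I, Complex.norm_real, Real.norm_eq_abs,
      Complex.norm_ofNat, mul_one] at h3 ⊢
    set a := ‖(𝓕 (H1.toL2 u) : L2) ξ‖
    set b := ‖(𝓕 (H1.toL2 v) : L2) ξ‖
    have hab : 0 ≤ a * b := mul_nonneg (norm_nonneg _) (norm_nonneg _)
    nlinarith [mul_le_mul_of_nonneg_left h3 hab]

theorem integrable_form₀ (u v : Fin 2 → H1) : Integrable fun ξ : Plane =>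
    star (fun i => (𝓕 (H1.toL2 (u i)) : L2) ξ) ⬝ᵥ
      (σ.symbol ((2 * Real.pi) • ξ)).mulVec (fun i => (𝓕 (H1.toL2 (v i)) : L2) ξ) := by
  simp only [dotProduct, Matrix.mulVec, Finset.mul_sum, Pi.star_apply]
  exact integrable_finsetSum _ fun i _ => integrable_finsetSum _ fun j _ =>
    σ.integrable_entry (u i) (v j) i j

theorem form₀_add (u v w : Fin 2 → H1) : σ.form₀ u (v + w) = σ.form₀ u v + σ.form₀ u w := by
  rw [form₀, form₀, form₀, ← integral_add (σ.integrable_form₀ u v) (σ.integrable_form₀ u w)]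
  refine integral_congr_ae ?_
  have h : ∀ᵐ ξ : Plane, ∀ i : Fin 2, (𝓕 (H1.toL2 ((v + w) i)) : L2) ξ =
      (𝓕 (H1.toL2 (v i)) : L2) ξ + (𝓕 (H1.toL2 (w i)) : L2) ξ := by
    refine ae_all_iff.mpr fun i => ?_
    rw [Pi.add_apply, map_add, FourierTransform.fourier_add]
    exact Lp.coeFn_add _ _
  filter_upwards [h] with ξ hξ
  rw [← dotProduct_add, ← Matrix.mulVec_add]
  simp only [hξ]
  rfl

theorem form₀_smul (c : ℂ) (u v : Fin 2 → H1) : σ.form₀ u (c • v) = c * σ.form₀ u v := by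
  rw [form₀, form₀, ← integral_const_mul]
  refine integral_congr_ae ?_
  have h : ∀ᵐ ξ : Plane, ∀ i : Fin 2, (𝓕 (H1.toL2 ((c • v) i)) : L2) ξ =
      c * (𝓕 (H1.toL2 (v i)) : L2) ξ := by
    refine ae_all_iff.mpr fun i => ?_
    rw [Pi.smul_apply, map_smul, FourierTransform.fourier_smul]
    exact Lp.coeFn_smul _ _
  filter_upwards [h] with ξ hξ
  rw [← smul_eq_mul c, ← dotProduct_smul, ← Matrix.mulVec_smul]
  simp only [hξ]
  rfl

end Coupling

/-! ### The perturbation -/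

/-- The data of a perturbation `ν = h m`: a finite positive measure `m` and a bounded Borel function
`h` for which `m` and `h² m` satisfy the form bound with constants `a ∈ (0, 1)` and `b > 0`. -/
structure Perturbation where
  m : Measure Plane
  finite : IsFiniteMeasure m
  h : Plane → ℝ
  measurable : Measurable h
  bounded : ∃ C : ℝ, ∀ x, |h x| ≤ C
  form_bound : ∃ a b : ℝ, 0 < a ∧ a < 1 ∧ 0 < b ∧ ∀ f : 𝓢(Plane, ℂ),
    (∫ x, (1 + |h x| ^ 2) * ‖f x‖ ^ 2 ∂m) ≤
      a * (∫ x, ∑ i : Fin 2, ‖(∂_{e i} f : 𝓢(Plane, ℂ)) x‖ ^ 2) + b * (∫ x, ‖f x‖ ^ 2)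

namespace Perturbation

attribute [instance] Perturbation.finite

variable (V : Perturbation)

/-- The signed measure `ν = h m`. -/
def nu : SignedMeasure Plane := V.m.withDensityᵥ V.h

/-- The topological support of `ν`. -/
def supp : Set Plane := V.nu.totalVariation.support

/-- The sesquilinear form `ν(u, v) = ∫ ⟨J₂ u(x), J₂ v(x)⟩ h(x) m(dx)` on `H¹(ℝ²) ⊗ ℂ²`, antilinear
in the first argument. -/
def form (u v : Fin 2 → H1) : ℂ :=
  ∫ x, (V.h x : ℂ) * star (fun i => J V.m (u i) x) ⬝ᵥ (fun i => J V.m (v i) x) ∂V.m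

/-- `J φ = φ` for all Schwartz functions `φ`. -/
theorem J_schwartz (φ : 𝓢(Plane, ℂ)) : J V.m (schwartzToH1 φ) = φ.toLp 2 V.m := by
  refine LinearMap.extendOfNorm_eq denseRange_schwartzToH1 ?_ φ
  obtain ⟨a, b, ha, ha1, hb, hab⟩ := V.form_bound
  obtain ⟨C, hC⟩ := V.bounded
  refine ⟨√(a + b), fun f => ?_⟩
  change ‖(f.toLp 2 V.m : Lp (α := Plane) ℂ 2 V.m)‖ ≤ _
  have hsq : ∀ (μ : Measure Plane) [μ.HasTemperateGrowth] (g : 𝓢(Plane, ℂ)),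
      ‖g.toLp 2 μ‖ ^ 2 = ∫ x, ‖g x‖ ^ 2 ∂μ := fun μ _ g => by
    rw [L2_norm_sq]
    exact integral_congr_ae ((g.coeFn_toLp 2 μ).mono fun x hx => by simp only [hx])
  have hint : ∀ (μ : Measure Plane) [μ.HasTemperateGrowth] (g : 𝓢(Plane, ℂ)),
      Integrable (fun x => ‖g x‖ ^ 2) μ := fun μ _ g =>
    (memLp_two_iff_integrable_sq_norm g.continuous.aestronglyMeasurable).mp (g.memLp 2 μ)
  have hH : ‖schwartzToH1 f‖ ^ 2 =
      (∫ x, ‖f x‖ ^ 2) + ∫ x, ∑ i : Fin 2, ‖(∂_{e i} f : 𝓢(Plane, ℂ)) x‖ ^ 2 := by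
    rw [integral_finsetSum _ fun i _ => hint _ _, 
      show ‖schwartzToH1 f‖ = ‖(schwartzToH1 f).1‖ from rfl,
      WithLp.prod_norm_sq_eq_of_L2, PiLp.norm_sq_eq_of_L2]
    simp only [← hsq]
    rfl
  have hm : (∫ x, ‖f x‖ ^ 2 ∂V.m) ≤ ∫ x, (1 + |V.h x| ^ 2) * ‖f x‖ ^ 2 ∂V.m := by
    refine integral_mono (hint _ _) ?_ fun x => ?_
    · refine (hint V.m f).bdd_mul (c := 1 + C ^ 2) ?_ (Eventually.of_forall fun x => ?_)
      · exact ((V.measurable.abs.pow_const 2).const_add 1).aestronglyMeasurable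
      · rw [Real.norm_of_nonneg (by positivity)]
        gcongr
        exact hC x
    · exact le_mul_of_one_le_left (by positivity) (by simp [sq_nonneg])
  rw [← sq_le_sq₀ (norm_nonneg _) (by positivity), mul_pow, Real.sq_sqrt (by positivity), hH, hsq]
  have h1 : 0 ≤ ∫ x, ‖f x‖ ^ 2 := integral_nonneg fun x => by positivity
  have h2 : 0 ≤ ∫ x, ∑ i : Fin 2, ‖(∂_{e i} f : 𝓢(Plane, ℂ)) x‖ ^ 2 :=
    integral_nonneg fun x => by positivity
  nlinarith [hab f, mul_nonneg ha.le h1, mul_nonneg hb.le h2]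

theorem integrable_form (u v : Fin 2 → H1) : Integrable (fun x => (V.h x : ℂ) *
    star (fun i => J V.m (u i) x) ⬝ᵥ (fun i => J V.m (v i) x)) V.m := by
  obtain ⟨C, hC⟩ := V.bounded
  refine Integrable.bdd_mul (c := C) ?_
    (Complex.measurable_ofReal.comp V.measurable).aestronglyMeasurable
    (Eventually.of_forall fun x => by simpa using hC x)
  simp only [dotProduct, Pi.star_apply]
  exact integrable_finsetSum _ fun i _ =>
    (Lp.memLp (J V.m (u i))).star.integrable_mul (Lp.memLp (J V.m (v i)))

theorem form_add (u v w : Fin 2 → H1) : V.form u (v + w) = V.form u v + V.form u w := by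
  rw [form, form, form, ← integral_add (V.integrable_form u v) (V.integrable_form u w)]
  refine integral_congr_ae ?_
  have h : ∀ᵐ x ∂V.m, ∀ i : Fin 2, J V.m ((v + w) i) x = J V.m (v i) x + J V.m (w i) x := by
    refine ae_all_iff.mpr fun i => ?_
    rw [Pi.add_apply, map_add]
    exact Lp.coeFn_add _ _
  filter_upwards [h] with x hx
  rw [← mul_add, ← dotProduct_add]
  simp only [hx]
  rfl

theorem form_smul (c : ℂ) (u v : Fin 2 → H1) : V.form u (c • v) = c * V.form u v := by
  rw [form, form, ← integral_const_mul]
  refine integral_congr_ae ?_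
  have h : ∀ᵐ x ∂V.m, ∀ i : Fin 2, J V.m ((c • v) i) x = c * J V.m (v i) x := by
    refine ae_all_iff.mpr fun i => ?_
    rw [Pi.smul_apply, map_smul]
    exact Lp.coeFn_smul _ _
  filter_upwards [h] with x hx
  rw [mul_left_comm, ← smul_eq_mul c (_ ⬝ᵥ _), ← dotProduct_smul]
  simp only [hx]
  rfl

end Perturbation

/-! ### The perturbed operator -/

/-- The inclusion `H¹(ℝ²) ⊗ ℂ² → L²(ℝ²) ⊗ ℂ²`. -/
def spinorIncl : (Fin 2 → H1) →ₗ[ℂ] Spinor where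
  toFun u := WithLp.toLp 2 fun i => H1.toL2 (u i)
  map_add' _ _ := rfl
  map_smul' _ _ := rfl

/-- The form `q = q₀ + ν` on `H¹(ℝ²) ⊗ ℂ²`. -/
def form (σ : Coupling) (V : Perturbation) (u v : Fin 2 → H1) : ℂ := σ.form₀ u v + V.form u v

/-- The hypothesis of the KLMN theorem for `q = q₀ + ν`: the form `ν` is bounded relative to `q₀` with
relative bound less than `1`. For `ν ≤ 0` it holds if and only if `q` is semibounded from below and
closed on `H¹(ℝ²) ⊗ ℂ²`. -/
def IsRelativelyBounded (σ : Coupling) (V : Perturbation) : Prop :=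
  ∃ a b : ℝ, a < 1 ∧ ∀ u : Fin 2 → H1,
    ‖V.form u u‖ ≤ a * (σ.form₀ u u).re + b * ‖spinorIncl u‖ ^ 2

/-- The graph of the operator associated with `q`: the pairs `(u, g)` with `u ∈ H¹(ℝ²) ⊗ ℂ²`,
`g ∈ L²(ℝ²) ⊗ ℂ²` and `q(v, u) = ⟨v, g⟩` for all `v ∈ H¹(ℝ²) ⊗ ℂ²`. -/
def hamiltonianGraph (σ : Coupling) (V : Perturbation) : Submodule ℂ (Spinor × Spinor) where
  carrier := {x | ∃ u : Fin 2 → H1, spinorIncl u = x.1 ∧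
    ∀ v : Fin 2 → H1, form σ V v u = inner ℂ (spinorIncl v) x.2}
  zero_mem' := ⟨0, map_zero _, fun v => by
    have h1 := σ.form₀_smul 0 v 0
    have h2 := V.form_smul 0 v 0
    rw [smul_zero, zero_mul] at h1 h2
    rw [form, h1, h2, Prod.snd_zero, inner_zero_right, add_zero]⟩
  add_mem' := by
    rintro x y ⟨u, hu, hu'⟩ ⟨w, hw, hw'⟩
    refine ⟨u + w, by rw [map_add, hu, hw, Prod.fst_add], fun v => ?_⟩
    rw [Prod.snd_add, inner_add_right, ← hu', ← hw', form, form, form, σ.form₀_add, V.form_add]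
    ring
  smul_mem' := by
    rintro c x ⟨u, hu, hu'⟩
    refine ⟨c • u, by rw [map_smul, hu, Prod.smul_fst], fun v => ?_⟩
    rw [Prod.smul_snd, inner_smul_right, ← hu', form, form, σ.form₀_smul, V.form_smul]
    ring

/-- The graph is single-valued, since `H¹` is dense in `L²`. -/
theorem hamiltonianGraph_functional (σ : Coupling) (V : Perturbation) (x : Spinor × Spinor)
    (hx : x ∈ hamiltonianGraph σ V) (h0 : x.1 = 0) : x.2 = 0 := by
  obtain ⟨u, hu, hq⟩ := hx
  have hu0 : ∀ i, H1.toL2 (u i) = 0 := fun i => by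
    have : spinorIncl u i = 0 := by rw [hu, h0]; rfl
    exact this
  have hzero : u = 0 := by
    funext i
    apply Subtype.ext
    have hfst : (u i).1.fst = 0 := hu0 i
    have hsnd : ∀ k, (u i).1.snd k = 0 := by
      intro k
      have hF : (𝓕 ((u i).1.snd k) : L2) = 0 := by
        have hFz : (𝓕 (u i).1.fst : L2) = 0 := by
          rw [hfst]
          exact (Lp.fourierTransformₗᵢ Plane ℂ).map_zero
        apply Lp.ext
        filter_upwards [(u i).2 k, Lp.coeFn_zero ℂ 2 (volume : Measure Plane)] with ξ h1 h2
        rw [h1, hFz, h2, Pi.zero_apply, mul_zero]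
      exact (Lp.fourierTransformₗᵢ Plane ℂ).map_eq_zero_iff.mp hF
    apply (WithLp.equiv 2 _).injective
    refine Prod.ext hfst ?_
    apply PiLp.ext
    exact hsnd
  have hform : ∀ v, inner ℂ (spinorIncl v) x.2 = 0 := fun v => by
    have h1 := σ.form₀_smul 0 v 0
    have h2 := V.form_smul 0 v 0
    rw [smul_zero, zero_mul] at h1 h2
    rw [← hq, hzero, form, h1, h2, add_zero]
  apply PiLp.ext
  intro i
  have hd : DenseRange (SchwartzMap.toLpCLM ℝ (E := Plane) ℂ 2 (volume : Measure Plane)) :=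
    SchwartzMap.denseRange_toLpCLM ENNReal.ofNat_ne_top
  refine hd.eq_zero_of_inner_right ℂ fun φ => ?_
  have h := hform (Pi.single i (schwartzToH1 φ))
  rw [PiLp.inner_apply, Finset.sum_eq_single i] at h
  · change inner ℂ (H1.toL2 ((Pi.single i (schwartzToH1 φ) : Fin 2 → H1) i)) (x.2 i) = 0 at h
    rw [Pi.single_eq_same] at h
    exact h
  · intro j _ hj
    change inner ℂ (H1.toL2 ((Pi.single i (schwartzToH1 φ) : Fin 2 → H1) j)) (x.2 j) = 0
    rw [Pi.single_eq_of_ne hj, map_zero, inner_zero_left]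
  · intro h
    exact absurd (Finset.mem_univ i) h

/-- The operator `H = H₀ + ν` associated with the form `q` (self-adjoint and semibounded from below
when `q` is closed and semibounded). -/
def hamiltonian (σ : Coupling) (V : Perturbation) : Spinor →ₗ.[ℂ] Spinor :=
  (hamiltonianGraph σ V).toLinearPMap

/-- The defining property of `H`. -/
theorem mem_graph_hamiltonian_iff (σ : Coupling) (V : Perturbation) (f g : Spinor) :
    (f, g) ∈ (hamiltonian σ V).graph ↔ ∃ u : Fin 2 → H1, spinorIncl u = f ∧
      ∀ v : Fin 2 → H1, form σ V v u = inner ℂ (spinorIncl v) g := by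
  rw [hamiltonian, Submodule.toLinearPMap_graph_eq _ (hamiltonianGraph_functional σ V)]
  rfl

/-! ### Counting eigenvalues -/

/-- The eigenspace `{f ∈ dom T : T f = E f}`. -/
def eigenspace (T : Spinor →ₗ.[ℂ] Spinor) (E : ℝ) : Submodule ℂ Spinor :=
  T.graph.comap (LinearMap.id.prod ((E : ℂ) • LinearMap.id))

/-- The set of the (real) eigenvalues of `T` below `E₀`. -/
def eigenvaluesBelow (T : Spinor →ₗ.[ℂ] Spinor) (E₀ : ℝ) : Set ℝ :=
  {E | E < E₀ ∧ eigenspace T E ≠ ⊥}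

/-- The number of eigenvalues of `T` below `E₀`, counted with multiplicity: the dimension of the sum
of the eigenspaces, `∞` if it is infinite. -/
def countBelow (T : Spinor →ₗ.[ℂ] Spinor) (E₀ : ℝ) : ℕ∞ :=
  Cardinal.toENat (Module.rank ℂ (⨆ E ∈ Set.Iio E₀, eigenspace T E : Submodule ℂ Spinor))

/-! ### The Rashba and Dresselhaus Hamiltonians -/

/-- A continuous `A` with `|A(p)| = c |p|` is a coupling function. -/
theorem limsup_lt_of_linear {A : Plane → ℂ} (c : ℝ) (hA : ∀ p, ‖A p‖ = c * ‖p‖) :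
    limsup (fun p => ‖A p‖ₑ / ‖p‖ₑ ^ 2) (cocompact Plane) < 1 := by
  refine lt_of_le_of_lt (b := ((2 : ℝ≥0∞)⁻¹)) ?_ (by simp)
  refine limsup_le_of_le (by isBoundedDefault) ?_
  filter_upwards [(tendsto_norm_cocompact_atTop (E := Plane)).eventually_ge_atTop (max (2 * c) 1)]
    with p hp
  have hp1 : 1 ≤ ‖p‖ := (le_max_right _ _).trans hp
  have hp2 : 2 * c ≤ ‖p‖ := (le_max_left _ _).trans hp
  have h2 : ((2 : ℝ≥0∞)⁻¹) = ENNReal.ofReal (2⁻¹) := by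
    rw [ENNReal.ofReal_inv_of_pos two_pos, ENNReal.ofReal_ofNat]
  rw [← ofReal_norm, ← ofReal_norm, ← ENNReal.ofReal_pow (norm_nonneg _),
    ← ENNReal.ofReal_div_of_pos (by positivity), hA, h2]
  refine ENNReal.ofReal_le_ofReal ?_
  rw [div_le_iff₀ (by positivity)]
  nlinarith

/-- The Rashba coupling `A(p) = α (p_y + i p_x)`. -/
def rashba (α : ℝ) : Coupling where
  A p := α * (p 1 + Complex.I * p 0)
  continuous := by fun_prop
  limsup_lt := limsup_lt_of_linear |α| fun p => by
    rw [norm_mul, Complex.norm_real, Real.norm_eq_abs, mul_comm Complex.I, Complex.norm_add_mul_I,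
      EuclideanSpace.norm_eq, Fin.sum_univ_two, Real.norm_eq_abs, Real.norm_eq_abs, sq_abs, sq_abs,
      add_comm]

/-- The Dresselhaus coupling `A(p) = -α (p_x + i p_y)`. -/
def dresselhaus (α : ℝ) : Coupling where
  A p := -α * (p 0 + Complex.I * p 1)
  continuous := by fun_prop
  limsup_lt := limsup_lt_of_linear |α| fun p => by
    rw [norm_mul, norm_neg, Complex.norm_real, Real.norm_eq_abs, mul_comm Complex.I,
      Complex.norm_add_mul_I, EuclideanSpace.norm_eq, Fin.sum_univ_two, Real.norm_eq_abs,
      Real.norm_eq_abs, sq_abs, sq_abs]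

end SpinOrbit

end

/-!
By the variational principle it suffices to find, for distinct `p₁, …, p_N ∈ S`, spinors in the form
domain on whose span `q - κ` is negative definite. The trial spinor at `p` is, in Fourier space, the
eigenvector field of `Ĥ₀` for the lower eigenvalue `λ₋` (a constant vector if `A p = 0`) times an
approximate identity concentrating at `p`. Since `λ₋ - κ` vanishes to second order at `p`, its
energy is controlled by the second moment of the square of that approximate identity, which can be
made arbitrarily small because `∫ |ξ|⁻² dξ` diverges logarithmically in the plane. In position space
the trial spinors tend to plane waves, so the matrix of `q - κ` tends to the Gram matrix of plane
waves with respect to `ν`. That matrix is negative definite: a nontrivial combination of plane waves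
vanishes only on a closed Lebesgue null set, which cannot carry `ν`.

The spectrum below `κ` is discrete: the resolvent `T` of `q + c` satisfies
`⟨T f, f⟩ ≤ ‖f‖² / (κ + c)` up to a compact error, since `H₀ ≥ κ` and `J` is compact on band-limited
functions. If `S` is infinite, the eigenvalues below `κ` are infinitely many, as each of them has
finite multiplicity.
-/

open scoped InnerProductSpace

noncomputable section

namespace SpinOrbit

section Rayleigh

variable {𝕜 E F : Type*} [RCLike 𝕜] [NormedAddCommGroup E] [InnerProductSpace 𝕜 E]
  [NormedAddCommGroup F] [NormedSpace 𝕜 F] {T : E →L[𝕜] E} {μ l : ℝ}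

theorem norm_sq_apply_le_of_isPositive {S : E →L[𝕜] E} (hS : S.IsPositive) (x : E) :
    ‖S x‖ ^ 2 ≤ ‖S‖ * S.reApplyInnerSelf x := by
  -- The Cauchy–Schwarz inequality of the semi-inner product `⟪S x, y⟫`, applied to `x` and `S x`.
  let core : PreInnerProductSpace.Core 𝕜 E :=
    { inner x y := ⟪S x, y⟫_𝕜
      conj_inner_symm x y := by rw [inner_conj_symm, hS.inner_left_eq_inner_right]
      re_inner_nonneg := hS.2
      add_left x y z := by rw [map_add, inner_add_left]
      smul_left x y r := by rw [map_smul, inner_smul_left] }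
  have hcs : ‖⟪S x, S x⟫_𝕜‖ * ‖⟪S (S x), x⟫_𝕜‖ ≤
      S.reApplyInnerSelf x * RCLike.re ⟪S (S x), S x⟫_𝕜 :=
    @InnerProductSpace.Core.inner_mul_inner_self_le 𝕜 E _ _ _ core x (S x)
  rw [hS.inner_left_eq_inner_right (S x) x, inner_self_eq_norm_sq_to_K, norm_pow,
    RCLike.norm_ofReal, abs_norm] at hcs
  have hSS : RCLike.re ⟪S (S x), S x⟫_𝕜 ≤ ‖S‖ * ‖S x‖ ^ 2 := by
    grw [RCLike.re_le_norm, norm_inner_le_norm, S.le_opNorm, sq, mul_assoc]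
  rcases eq_or_ne (S x) 0 with h0 | h0
  · rw [h0, norm_zero, zero_pow two_ne_zero]
    exact mul_nonneg (norm_nonneg _) (hS.2 x)
  · refine le_of_mul_le_mul_right ?_ (pow_pos (norm_pos_iff.mpr h0) 2)
    calc ‖S x‖ ^ 2 * ‖S x‖ ^ 2 ≤ S.reApplyInnerSelf x * (‖S‖ * ‖S x‖ ^ 2) :=
          hcs.trans (mul_le_mul_of_nonneg_left hSS (hS.2 x))
      _ = ‖S‖ * S.reApplyInnerSelf x * ‖S x‖ ^ 2 := by ring

theorem reApplyInnerSelf_le_iSup_rayleighQuotient (T : E →L[𝕜] E) (x : E) :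
    T.reApplyInnerSelf x ≤ (⨆ y : {y : E // y ≠ 0}, T.rayleighQuotient y) * ‖x‖ ^ 2 := by
  rcases eq_or_ne x 0 with rfl | hx
  · simp [ContinuousLinearMap.reApplyInnerSelf_apply]
  · rw [← div_le_iff₀ (pow_pos (norm_pos_iff.mpr hx) 2)]
    refine le_ciSup (f := fun y : {y : E // y ≠ 0} => T.rayleighQuotient y) ?_ ⟨x, hx⟩
    exact ⟨‖T‖, by
      rintro _ ⟨y, rfl⟩
      exact (le_abs_self _).trans (T.rayleighQuotient_le_norm _)⟩

theorem reApplyInnerSelf_smul_id_sub (T : E →L[𝕜] E) (l : ℝ) (x : E) :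
    ((l : 𝕜) • ContinuousLinearMap.id 𝕜 E - T).reApplyInnerSelf x =
      l * ‖x‖ ^ 2 - T.reApplyInnerSelf x := by
  simp only [ContinuousLinearMap.reApplyInnerSelf_apply, sub_apply, smul_apply,
    ContinuousLinearMap.id_apply, inner_sub_left, inner_smul_left, map_sub, RCLike.conj_ofReal,
    RCLike.re_ofReal_mul, inner_self_eq_norm_sq]

theorem isPositive_iSup_rayleighQuotient_sub (hT : T.IsSymmetric) :
    (((⨆ y : {y : E // y ≠ 0}, T.rayleighQuotient y : ℝ) : 𝕜) • ContinuousLinearMap.id 𝕜 E -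
      T).IsPositive := by
  refine ⟨fun x y => ?_, fun x => ?_⟩
  · have hxy : ⟪T x, y⟫_𝕜 = ⟪x, T y⟫_𝕜 := hT x y
    simp [inner_sub_left, inner_sub_right, inner_smul_left, inner_smul_right, hxy]
  · rw [reApplyInnerSelf_smul_id_sub]
    exact sub_nonneg.mpr (reApplyInnerSelf_le_iSup_rayleighQuotient T x)

theorem exists_approx_eigenvectors_iSup_rayleighQuotient [Nontrivial E] (hT : T.IsSymmetric) :
    ∃ x : ℕ → E, (∀ n, ‖x n‖ = 1) ∧ Tendsto (fun n => T (x n) -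
      ((⨆ y : {y : E // y ≠ 0}, T.rayleighQuotient y : ℝ) : 𝕜) • x n) atTop (𝓝 0) := by
  have hpos := isPositive_iSup_rayleighQuotient_sub hT
  set l : ℝ := ⨆ y : {y : E // y ≠ 0}, T.rayleighQuotient y
  set S : E →L[𝕜] E := (l : 𝕜) • ContinuousLinearMap.id 𝕜 E - T with hS
  obtain ⟨z, hz⟩ := exists_ne (0 : E)
  have hne : (Set.range fun y : {y : E // y ≠ 0} => T.rayleighQuotient y).Nonempty :=
    ⟨_, ⟨z, hz⟩, rfl⟩
  obtain ⟨r, -, hr, hrange⟩ := exists_seq_tendsto_sSup hne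
    ⟨‖T‖, by rintro _ ⟨y, rfl⟩; exact (le_abs_self _).trans (T.rayleighQuotient_le_norm _)⟩
  choose y hy using hrange
  have hy0 (n : ℕ) : ‖(y n : E)‖ ≠ 0 := norm_ne_zero_iff.mpr (y n).2
  set x : ℕ → E := fun n => ((‖(y n : E)‖⁻¹ : ℝ) : 𝕜) • (y n : E)
  have hx (n : ℕ) : ‖x n‖ = 1 := by
    rw [norm_smul, RCLike.norm_ofReal, abs_inv, abs_norm, inv_mul_cancel₀ (hy0 n)]
  have hTx (n : ℕ) : T.reApplyInnerSelf (x n) = r n := by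
    have h := T.rayleigh_smul (y n) (c := ((‖(y n : E)‖⁻¹ : ℝ) : 𝕜))
      (RCLike.ofReal_ne_zero.mpr (inv_ne_zero (hy0 n)))
    rwa [ContinuousLinearMap.rayleighQuotient, hx, one_pow, div_one, show
      T.rayleighQuotient (y n : E) = r n from hy n] at h
  have hSx : Tendsto (fun n => S.reApplyInnerSelf (x n)) atTop (𝓝 0) := by
    simp only [hS, reApplyInnerSelf_smul_id_sub, hx, hTx, one_pow, mul_one]
    simpa only [sub_self] using (show Tendsto r atTop (𝓝 l) from hr).const_sub l
  refine ⟨x, hx, squeeze_zero_norm (a := fun n => √(‖S‖ * S.reApplyInnerSelf (x n)))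
    (fun n => ?_) (by simpa using (hSx.const_mul ‖S‖).sqrt)⟩
  rw [norm_sub_rev]
  exact Real.le_sqrt_of_sq_le (norm_sq_apply_le_of_isPositive hpos (x n))

/-- `μ` bounds the numerical range of `T` from above up to compact perturbations. For a
self-adjoint `T` this says that the essential spectrum of `T` lies in `(-∞, μ]`. -/
def IsEssUpperBound (F : Type*) [NormedAddCommGroup F] [NormedSpace 𝕜 F] (T : E →L[𝕜] E)
    (μ : ℝ) : Prop :=
  ∀ ε > 0, ∃ P : E →L[𝕜] F, IsCompactOperator P ∧
    ∀ x, T.reApplyInnerSelf x ≤ (μ + ε) * ‖x‖ ^ 2 + ‖x‖ * ‖P x‖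

theorem mul_norm_le_of_reApplyInnerSelf_le {x : E} {d p : ℝ}
    (h : T.reApplyInnerSelf x ≤ (l - d) * ‖x‖ ^ 2 + ‖x‖ * p) (hp : 0 ≤ p) :
    d * ‖x‖ ≤ p + ‖T x - (l : 𝕜) • x‖ := by
  rcases (norm_nonneg x).eq_or_lt' with h0 | h0
  · rw [h0, mul_zero]
    positivity
  have hre := reApplyInnerSelf_smul_id_sub T l x
  have hle : l * ‖x‖ ^ 2 - T.reApplyInnerSelf x ≤ ‖T x - (l : 𝕜) • x‖ * ‖x‖ := by
    rw [← hre, norm_sub_rev]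
    exact (RCLike.re_le_norm _).trans (norm_inner_le_norm _ _)
  refine le_of_mul_le_mul_right ?_ h0
  linarith

/-- The completeness half of Weyl's criterion: approximate eigenvectors above an essential upper
bound do not escape weakly. -/
theorem IsEssUpperBound.exists_tendsto_subseq [CompleteSpace E] (hT : IsEssUpperBound F T μ)
    (hl : μ < l) {x : ℕ → E} {C : ℝ} (hx : ∀ n, ‖x n‖ ≤ C)
    (h : Tendsto (fun n => T (x n) - (l : 𝕜) • x n) atTop (𝓝 0)) :
    ∃ (y : E) (φ : ℕ → ℕ), StrictMono φ ∧ Tendsto (x ∘ φ) atTop (𝓝 y) := by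
  set d : ℝ := (l - μ) / 2 with hd
  have hd0 : 0 < d := by rw [hd]; linarith
  obtain ⟨P, hP, hbd⟩ := hT d hd0
  obtain ⟨K, hK, hKs⟩ := hP.image_closedBall_subset_compact C
  obtain ⟨z, -, φ, hφ, hz⟩ := hK.tendsto_subseq (x := fun n => P (x n))
    fun n => hKs ⟨x n, mem_closedBall_zero_iff.mpr (hx n), rfl⟩
  have hsub (w : E) : d * ‖w‖ ≤ ‖P w‖ + ‖T w - (l : 𝕜) • w‖ := by
    refine mul_norm_le_of_reApplyInnerSelf_le ?_ (norm_nonneg _)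
    rw [show l - d = μ + d by rw [hd]; ring]
    exact hbd w
  have hc : CauchySeq (x ∘ φ) := by
    have hPc : CauchySeq fun n => P (x (φ n)) := hz.cauchySeq
    have hRc : CauchySeq fun n => T (x (φ n)) - (l : 𝕜) • x (φ n) :=
      (h.comp hφ.tendsto_atTop).cauchySeq
    rw [Metric.cauchySeq_iff] at hPc hRc ⊢
    intro ε hε
    obtain ⟨N₁, h₁⟩ := hPc (d * ε / 2) (by positivity)
    obtain ⟨N₂, h₂⟩ := hRc (d * ε / 2) (by positivity)
    refine ⟨max N₁ N₂, fun m hm n hn => ?_⟩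
    have hPmn := h₁ m ((le_max_left _ _).trans hm) n ((le_max_left _ _).trans hn)
    have hRmn := h₂ m ((le_max_right _ _).trans hm) n ((le_max_right _ _).trans hn)
    rw [dist_eq_norm, ← map_sub] at hPmn
    rw [dist_eq_norm, sub_sub_sub_comm, ← map_sub, ← smul_sub] at hRmn
    have hmn := hsub (x (φ m) - x (φ n))
    rw [dist_eq_norm]
    exact lt_of_mul_lt_mul_left (hmn.trans_lt (by linarith)) hd0.le
  obtain ⟨y, hy⟩ := cauchySeq_tendsto_of_complete hc
  exact ⟨y, φ, hφ, hy⟩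

theorem IsEssUpperBound.finiteDimensional_eigenspace [CompleteSpace E]
    (hT : IsEssUpperBound F T μ) (hl : μ < l) :
    FiniteDimensional 𝕜 (Module.End.eigenspace (T : E →ₗ[𝕜] E) (l : 𝕜)) := by
  set M := Module.End.eigenspace (T : E →ₗ[𝕜] E) (l : 𝕜)
  have hM (x : E) : x ∈ M ↔ T x = (l : 𝕜) • x := Module.End.mem_eigenspace_iff
  have hcl : IsClosed (M : Set E) := by
    simp only [← SetLike.setOfPred_mem_eq, hM]
    exact isClosed_eq T.continuous (continuous_const_smul _)
  refine FiniteDimensional.of_isCompact_closedBall₀ 𝕜 (r := 1) one_pos ?_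
  refine IsSeqCompact.isCompact fun x hx => ?_
  obtain ⟨y, φ, hφ, hy⟩ := hT.exists_tendsto_subseq hl (x := fun n => (x n : E)) (C := 1)
    (fun n => mem_closedBall_zero_iff.mp (hx n))
    (tendsto_const_nhds.congr fun n => (sub_eq_zero.mpr ((hM _).mp (x n).2)).symm)
  have hyM : y ∈ M := hcl.mem_of_tendsto hy (Eventually.of_forall fun n => (x (φ n)).2)
  have hty : Tendsto (x ∘ φ) atTop (𝓝 ⟨y, hyM⟩) := tendsto_subtype_rng.mpr hy
  exact ⟨⟨y, hyM⟩, Metric.isClosed_closedBall.mem_of_tendsto hty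
    (Eventually.of_forall fun n => hx _), φ, hφ, hty⟩

theorem IsEssUpperBound.exists_hasEigenvector [CompleteSpace E] (hT : IsEssUpperBound F T μ)
    (hsym : T.IsSymmetric) {x₀ : E} (hx₀ : μ * ‖x₀‖ ^ 2 < T.reApplyInnerSelf x₀) :
    ∃ l : ℝ, μ < l ∧ ∃ x, Module.End.HasEigenvector (T : E →ₗ[𝕜] E) (l : 𝕜) x := by
  have hne : x₀ ≠ 0 := by
    rintro rfl
    simp [ContinuousLinearMap.reApplyInnerSelf_apply] at hx₀
  have : Nontrivial E := ⟨x₀, 0, hne⟩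
  have hl : μ < ⨆ y : {y : E // y ≠ 0}, T.rayleighQuotient y :=
    lt_of_mul_lt_mul_right (hx₀.trans_le (reApplyInnerSelf_le_iSup_rayleighQuotient T x₀))
      (by positivity)
  obtain ⟨x, hx, hTx⟩ := exists_approx_eigenvectors_iSup_rayleighQuotient hsym
  obtain ⟨y, φ, hφ, hy⟩ := hT.exists_tendsto_subseq hl (fun n => (hx n).le) hTx
  refine ⟨_, hl, y, Module.End.hasEigenvector_iff.mpr
    ⟨Module.End.mem_eigenspace_iff.mpr ?_, ?_⟩⟩
  · exact sub_eq_zero.mp (tendsto_nhds_unique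
      (((T.continuous.tendsto y).comp hy).sub (hy.const_smul _)) (hTx.comp hφ.tendsto_atTop))
  · have hnorm : ‖y‖ = 1 := tendsto_nhds_unique hy.norm
      (tendsto_const_nhds.congr fun n => (hx (φ n)).symm)
    exact norm_ne_zero_iff.mp (hnorm ▸ one_ne_zero)

/-- The restriction to `Mᗮ` of a symmetric operator that preserves `M`, and hence `Mᗮ`. -/
def compress (T : E →L[𝕜] E) (hsym : T.IsSymmetric) (M : Submodule 𝕜 E)
    (hM : ∀ x ∈ M, T x ∈ M) : Mᗮ →L[𝕜] Mᗮ :=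
  (T.comp Mᗮ.subtypeL).codRestrict Mᗮ fun x u hu =>
    (hsym u x).symm.trans (x.2 _ (hM u hu))

theorem IsEssUpperBound.le_rank_iSup_eigenspace [CompleteSpace E] (hT : IsEssUpperBound F T μ)
    (hsym : T.IsSymmetric) {N : ℕ} (f : (Fin N → 𝕜) →ₗ[𝕜] E)
    (hf : ∀ c, c ≠ 0 → μ * ‖f c‖ ^ 2 < T.reApplyInnerSelf (f c)) :
    (N : Cardinal) ≤ Module.rank 𝕜
      (⨆ l ∈ Set.Ioi μ, Module.End.eigenspace (T : E →ₗ[𝕜] E) ((l : ℝ) : 𝕜) : Submodule 𝕜 E) := by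
  set M : Submodule 𝕜 E :=
    ⨆ l ∈ Set.Ioi μ, Module.End.eigenspace (T : E →ₗ[𝕜] E) ((l : ℝ) : 𝕜) with hM
  by_contra! hlt
  have : FiniteDimensional 𝕜 M :=
    Module.rank_lt_aleph0_iff.mp (hlt.trans Cardinal.natCast_lt_aleph0)
  have hfinrank : Module.finrank 𝕜 M < N := by
    rw [← Module.finrank_eq_rank] at hlt
    exact_mod_cast hlt
  have hMT : M ≤ M.comap (T : E →ₗ[𝕜] E) := by
    rw [hM]
    refine iSup₂_le fun l hl x hx => Submodule.mem_comap.mpr ?_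
    rw [Module.End.mem_eigenspace_iff.mp hx]
    exact Submodule.smul_mem _ _ (Submodule.mem_iSup_of_mem l (Submodule.mem_iSup_of_mem hl hx))
  set T' := compress T hsym M hMT
  have hT' : IsEssUpperBound F T' μ := fun ε hε =>
    let ⟨P, hP, hb⟩ := hT ε hε
    ⟨P.comp Mᗮ.subtypeL, hP.comp_clm _, fun x => hb x⟩
  obtain ⟨c, hc, hc0⟩ := Submodule.exists_mem_ne_zero_of_ne_bot
    (LinearMap.ker_ne_bot_of_finrank_lt
      (f := (M.orthogonalProjectionOnto : E →ₗ[𝕜] M).comp f) (by simpa using hfinrank))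
  have hfc : f c ∈ Mᗮ := Submodule.orthogonalProjectionOnto_eq_zero_iff.mp hc
  obtain ⟨l, hl, y, hy⟩ := hT'.exists_hasEigenvector (fun x y => hsym x y)
    (x₀ := ⟨f c, hfc⟩) (hf c hc0)
  have hyM : (y : E) ∈ M := Submodule.mem_iSup_of_mem l <| Submodule.mem_iSup_of_mem hl <|
    Module.End.mem_eigenspace_iff.mpr (congrArg Subtype.val hy.apply_eq_smul)
  exact hy.2 (Subtype.ext (inner_self_eq_zero.mp (y.2 _ hyM)))

end Rayleigh

section LpSpace

variable {α : Type*} [MeasurableSpace α] {μ : Measure α}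

theorem exists_subseq_tendsto_ae {E : Type*} [NormedAddCommGroup E] {p : ℝ≥0∞} [Fact (1 ≤ p)]
    {f : ℕ → Lp E p μ} {g : Lp E p μ} (h : Tendsto f atTop (𝓝 g)) :
    ∃ n : ℕ → ℕ, StrictMono n ∧
      ∀ᵐ x ∂μ, Tendsto (fun k => f (n k) x) atTop (𝓝 (g x)) :=
  (tendstoInMeasure_of_tendsto_Lp h).exists_seq_tendsto_ae

theorem isClosed_setOf_ae_eq_mul (s : α → ℂ) {p : ℝ≥0∞} [Fact (1 ≤ p)] :
    IsClosed {u : Lp ℂ p μ × Lp ℂ p μ | ∀ᵐ x ∂μ, u.2 x = s x * u.1 x} := by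
  refine IsSeqClosed.isClosed fun u v hu huv => ?_
  obtain ⟨n, hn, h1⟩ := exists_subseq_tendsto_ae huv.fst_nhds
  obtain ⟨k, hk, h2⟩ := exists_subseq_tendsto_ae (huv.snd_nhds.comp hn.tendsto_atTop)
  filter_upwards [h1, h2, ae_all_iff.mpr hu] with x hx1 hx2 hx
  refine tendsto_nhds_unique hx2 (((hx1.comp hk.tendsto_atTop).const_mul (s x)).congr fun i => ?_)
  exact (hx (n (k i))).symm

theorem integral_mem_of_isClosed {E : Type*} [NormedAddCommGroup E] [NormedSpace ℂ E]
    [CompleteSpace E] {S : Submodule ℂ E} (hS : IsClosed (S : Set E)) {f : α → E}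
    (hf : Integrable f μ) (h : ∀ x, f x ∈ S) : ∫ x, f x ∂μ ∈ S := by
  refine (Submodule.Quotient.mk_eq_zero S).mp ?_
  refine (S.mkQL.integral_comp_comm hf).symm.trans ?_
  refine integral_eq_zero_of_ae (Eventually.of_forall fun x => ?_)
  exact (Submodule.Quotient.mk_eq_zero S).mpr (h x)

variable {E F G : Type*} [NormedAddCommGroup E] [NormedAddCommGroup F] [NormedAddCommGroup G]

theorem isCompactOperator_of_norm_sq_le {𝕜 : Type*} [RCLike 𝕜] [NormedSpace 𝕜 E]
    [NormedSpace 𝕜 F] [NormedSpace 𝕜 G] [CompleteSpace F] {A : E →L[𝕜] F} {P : E →L[𝕜] G}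
    (hP : IsCompactOperator P) (h : ∀ x, ‖A x‖ ^ 2 ≤ ‖x‖ * ‖P x‖) : IsCompactOperator A := by
  obtain ⟨K, hK, hPK⟩ := hP.image_ball_subset_compact (f := (P : E →ₗ[𝕜] G)) 1
  rw [← ContinuousLinearMap.coe_coe,
    isCompactOperator_iff_isCompact_closure_image_ball _ one_pos]
  refine TotallyBounded.isCompact_of_isClosed
    (Metric.totallyBounded_iff.mpr fun ε hε => ?_).closure isClosed_closure
  obtain ⟨_, ht, htfin, hcover⟩ := Metric.finite_approx_of_totallyBounded
    (hK.totallyBounded.subset hPK) (ε ^ 2 / 2) (by positivity)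
  obtain ⟨s, hs, hsfin, rfl⟩ := Set.exists_subset_image_finite_and.mp ⟨_, ht, htfin, rfl⟩
  refine ⟨_, hsfin.image A, ?_⟩
  rintro _ ⟨x, hx, rfl⟩
  obtain ⟨_, ⟨y, hy, rfl⟩, hxy⟩ := Set.mem_iUnion₂.mp (hcover (Set.mem_image_of_mem _ hx))
  refine Set.mem_biUnion (Set.mem_image_of_mem A hy) ?_
  have hnorm : ‖x - y‖ ≤ 2 := by
    have h1 := mem_ball_zero_iff.mp hx
    have h2 := mem_ball_zero_iff.mp (hs hy)
    linarith [norm_sub_le x y]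
  have hP' : ‖P (x - y)‖ < ε ^ 2 / 2 := by
    rw [map_sub, ← dist_eq_norm]
    exact hxy
  have hA : ‖A (x - y)‖ ^ 2 < ε ^ 2 := by
    nlinarith [h (x - y), norm_nonneg (P (x - y))]
  rw [Metric.mem_ball, dist_eq_norm, ContinuousLinearMap.coe_coe, ← map_sub]
  exact lt_of_pow_lt_pow_left₀ 2 hε.le hA

theorem integral_norm_mul_norm_le (f : Lp E 2 μ) (g : Lp F 2 μ) :
    ∫ x, ‖f x‖ * ‖g x‖ ∂μ ≤ ‖f‖ * ‖g‖ := by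
  have hf := (Lp.memLp f).norm
  have hg := (Lp.memLp g).norm
  calc ∫ x, ‖f x‖ * ‖g x‖ ∂μ = ⟪hf.toLp, hg.toLp⟫_ℝ := by
        refine integral_congr_ae ?_
        filter_upwards [hf.coeFn_toLp, hg.coeFn_toLp] with x hfx hgx
        rw [hfx, hgx, RCLike.inner_apply', conj_trivial]
    _ ≤ ‖hf.toLp‖ * ‖hg.toLp‖ := real_inner_le_norm _ _
    _ = ‖f‖ * ‖g‖ := by rw [Lp.norm_toLp, Lp.norm_toLp, eLpNorm_norm, eLpNorm_norm]; rfl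

variable {H : Type*} [NormedAddCommGroup H] [InnerProductSpace ℂ H]

theorem isCompactOperator_rankOne (x y : H) :
    IsCompactOperator (InnerProductSpace.rankOne ℂ x y) := by
  rw [InnerProductSpace.rankOne_def', ContinuousLinearMap.coe_comp]
  exact (isCompactOperator_of_locallyCompactSpace_rng
    (ContinuousLinearMap.toSpanSingleton ℂ x)).comp_clm (innerSL ℂ y)

theorem isCompactOperator_of_ae_eq_inner [CompleteSpace H] {k : α → H} (hk : MemLp k 2 μ)
    {A : H →L[ℂ] Lp ℂ 2 μ} (hA : ∀ g, A g =ᵐ[μ] fun x => ⟪k x, g⟫_ℂ) :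
    IsCompactOperator A := by
  -- `A† A = ∫ |k x⟩⟨k x| dμ(x)` is a norm limit of finite rank operators.
  let R : α → H →L[ℂ] H := fun x => InnerProductSpace.rankOne ℂ (k x) (k x)
  have hR : Integrable R μ := by
    have hcont : Continuous fun y : H => InnerProductSpace.rankOne ℂ y y :=
      (ContinuousLinearMap.smulRightL ℂ H H).continuous₂.comp
        ((innerSL ℂ).continuous.prodMk continuous_id)
    refine ((memLp_two_iff_integrable_sq_norm hk.1).mp hk).mono'
      (hcont.comp_aestronglyMeasurable hk.1) (Eventually.of_forall fun x => ?_)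
    rw [InnerProductSpace.norm_rankOne, sq]
  have hcomp : IsCompactOperator (∫ x, R x ∂μ : H →L[ℂ] H) :=
    integral_mem_of_isClosed (S := compactOperator (RingHom.id ℂ) H H)
      isClosed_setOfPred_isCompactOperator hR fun x => isCompactOperator_rankOne _ _
  refine isCompactOperator_of_norm_sq_le hcomp fun g => ?_
  have hinner : ⟪g, (∫ x, R x ∂μ) g⟫_ℂ = ((‖A g‖ ^ 2 : ℝ) : ℂ) := by
    rw [ContinuousLinearMap.integral_apply hR,
      ← integral_inner (hR.apply_continuousLinearMap g), Complex.ofReal_pow,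
      ← Complex.coe_algebraMap, ← inner_self_eq_norm_sq_to_K (𝕜 := ℂ), L2.inner_def]
    refine integral_congr_ae ((hA g).mono fun x hx => ?_)
    simp only [R, InnerProductSpace.rankOne_apply, inner_smul_right, hx, RCLike.inner_apply,
      inner_conj_symm]
  calc ‖A g‖ ^ 2 = ‖⟪g, (∫ x, R x ∂μ) g⟫_ℂ‖ := by
        rw [hinner, Complex.norm_real, Real.norm_of_nonneg (by positivity)]
    _ ≤ ‖g‖ * ‖(∫ x, R x ∂μ) g‖ := norm_inner_le_norm _ _

end LpSpace

section Sobolev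

/-- The Fourier symbol `2πi ξᵢ` of the partial derivative `∂ᵢ`. -/
def derivSymbol (i : Fin 2) (ξ : Plane) : ℂ := 2 * Real.pi * ξ i * Complex.I

theorem hasTemperateGrowth_derivSymbol (i : Fin 2) : (derivSymbol i).HasTemperateGrowth := by
  have hproj : (fun ξ : Plane => ξ i).HasTemperateGrowth :=
    (EuclideanSpace.proj i : Plane →L[ℝ] ℝ).hasTemperateGrowth
  unfold derivSymbol
  fun_prop

theorem isClosed_H1 : IsClosed (H1 : Set (WithLp 2 (L2 × PiLp 2 (fun _ : Fin 2 => L2)))) := by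
  have hF : Continuous (𝓕 : L2 → L2) := (Lp.fourierTransformₗᵢ Plane ℂ).continuous
  have hH1 : (H1 : Set (WithLp 2 (L2 × PiLp 2 (fun _ : Fin 2 => L2)))) =
      ⋂ i : Fin 2, (fun u => ((𝓕 u.fst : L2), (𝓕 (u.snd i) : L2))) ⁻¹'
        {u | ∀ᵐ ξ, u.2 ξ = derivSymbol i ξ * u.1 ξ} := by
    ext u
    rw [Set.mem_iInter]
    rfl
  rw [hH1]
  refine isClosed_iInter fun i => (isClosed_setOf_ae_eq_mul _).preimage ?_
  exact (hF.comp (by fun_prop)).prodMk (hF.comp (by fun_prop))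

instance : CompleteSpace H1 := isClosed_H1.completeSpace_coe

theorem H1.norm_toL2_le (u : H1) : ‖H1.toL2 u‖ ≤ ‖u‖ := by
  rw [← sq_le_sq₀ (norm_nonneg _) (norm_nonneg _), H1.norm_sq, ← Lp.norm_fourier_eq, L2_norm_sq]
  refine integral_mono (L2_integrable_sq _) (H1.integrable_weight u) fun ξ => ?_
  refine le_mul_of_one_le_left (by positivity) ?_
  exact_mod_cast (le_self_add : (1 : NNReal) ≤ weight ξ)

/-- The inclusion `H¹(ℝ²) → L²(ℝ²)` as a continuous linear map. -/
def H1.toL2L : H1 →L[ℂ] L2 :=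
  H1.toL2.mkContinuous 1 fun u => (H1.norm_toL2_le u).trans_eq (one_mul _).symm

theorem H1.ext_fourier {u v : H1}
    (h : (𝓕 (H1.toL2 u) : L2) =ᵐ[volume] (𝓕 (H1.toL2 v) : L2)) : u = v := by
  have h0 : (𝓕 (H1.toL2 (u - v)) : L2) = 0 := by
    rw [map_sub, ← FourierTransform.fourierCLM_apply (R := ℂ), map_sub, sub_eq_zero]
    exact Lp.ext h
  rw [← sub_eq_zero, ← norm_eq_zero, ← sq_eq_zero_iff, H1.norm_sq, h0]
  refine integral_eq_zero_of_ae ?_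
  filter_upwards [Lp.coeFn_zero ℂ 2 (volume : Measure Plane)] with ξ hξ
  rw [hξ, Pi.zero_apply, norm_zero, zero_pow two_ne_zero, mul_zero, Pi.zero_apply]

/-- Multiplication by a Schwartz function, on `L²(ℝ²)`. -/
def mulSchwartz (χ : 𝓢(Plane, ℂ)) : L2 →L[ℂ] L2 :=
  (ContinuousLinearMap.mul ℂ ℂ).holderL volume ∞ 2 2 (χ.toLp ∞)

theorem coeFn_mulSchwartz (χ : 𝓢(Plane, ℂ)) (g : L2) :
    mulSchwartz χ g =ᵐ[volume] fun ξ => χ ξ * g ξ := by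
  filter_upwards [(ContinuousLinearMap.mul ℂ ℂ).coeFn_holder (r := 2) (χ.toLp ∞ volume) g,
    χ.coeFn_toLp ∞ volume] with ξ h1 h2
  exact h1.trans (by rw [h2, ContinuousLinearMap.mul_apply'])

/-- The map `g ↦ 𝓕⁻ (χ g)` on `L²(ℝ²)`. -/
def fourierInvMul (χ : 𝓢(Plane, ℂ)) : L2 →L[ℂ] L2 :=
  (FourierTransform.fourierInvCLM ℂ L2).comp (mulSchwartz χ)

theorem fourier_fourierInvMul (χ : 𝓢(Plane, ℂ)) (g : L2) :
    (𝓕 (fourierInvMul χ g) : L2) =ᵐ[volume] fun ξ => χ ξ * g ξ := by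
  rw [fourierInvMul, ContinuousLinearMap.comp_apply, FourierTransform.fourierInvCLM_apply,
    FourierTransform.fourier_fourierInv_eq]
  exact coeFn_mulSchwartz χ g

/-- The map `g ↦ 𝓕⁻ (χ g)` from `L²(ℝ²)` to `H¹(ℝ²)`. -/
def smoothing (χ : 𝓢(Plane, ℂ)) : L2 →L[ℂ] H1 :=
  (((WithLp.prodContinuousLinearEquiv 2 ℂ L2 (PiLp 2 (fun _ : Fin 2 => L2))).symm :
      (L2 × PiLp 2 (fun _ : Fin 2 => L2)) →L[ℂ] _).comp
    ((fourierInvMul χ).prod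
      (((PiLp.continuousLinearEquiv 2 ℂ (fun _ : Fin 2 => L2)).symm : (Fin 2 → L2) →L[ℂ] _).comp
        (ContinuousLinearMap.pi fun i =>
          fourierInvMul (SchwartzMap.smulLeftCLM ℂ (derivSymbol i) χ)))))
    |>.codRestrict H1 fun g i => by
      change ∀ᵐ ξ, (𝓕 (fourierInvMul _ g) : L2) ξ = _ * (𝓕 (fourierInvMul χ g) : L2) ξ
      filter_upwards [fourier_fourierInvMul χ g,
        fourier_fourierInvMul (SchwartzMap.smulLeftCLM ℂ (derivSymbol i) χ) g] with ξ h1 h2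
      rw [h1, h2, SchwartzMap.smulLeftCLM_apply_apply (hasTemperateGrowth_derivSymbol i),
        smul_eq_mul, mul_assoc]
      rfl

theorem fourier_smoothing (χ : 𝓢(Plane, ℂ)) (g : L2) :
    (𝓕 (H1.toL2 (smoothing χ g)) : L2) =ᵐ[volume] fun ξ => χ ξ * g ξ :=
  fourier_fourierInvMul χ g

/-- The plane wave `ξ ↦ exp (2πi ⟨ξ, x⟩)`. -/
def planeWave (x ξ : Plane) : ℂ := 𝐞 (inner ℝ ξ x)

theorem norm_planeWave (x ξ : Plane) : ‖planeWave x ξ‖ = 1 := Circle.norm_coe _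

theorem continuous_planeWave : Continuous fun z : Plane × Plane => planeWave z.1 z.2 := by
  unfold planeWave
  fun_prop

theorem star_planeWave_mul_planeWave (x y ξ : Plane) :
    star (planeWave x ξ) * planeWave y ξ = planeWave (y - x) ξ := by
  simp only [planeWave, inner_sub_right, AddChar.map_sub_eq_div, Circle.coe_div]
  rw [Complex.star_def, ← Circle.coe_inv_eq_conj, Circle.coe_inv, mul_comm, div_eq_mul_inv]

theorem memLp_wavePacket (χ : 𝓢(Plane, ℂ)) (x : Plane) :
    MemLp (fun ξ => star (planeWave x ξ * χ ξ)) 2 volume := by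
  refine (χ.memLp 2 volume).of_le ?_ (Eventually.of_forall fun ξ => ?_)
  · exact (((continuous_planeWave.comp (Continuous.prodMk_right x)).mul
      χ.continuous).star).aestronglyMeasurable
  · rw [norm_star, norm_mul, norm_planeWave, one_mul]

/-- The function `ξ ↦ exp (-2πi ⟨ξ, x⟩) conj (χ ξ)` in `L²(ℝ²)`, which represents the functional
`g ↦ 𝓕⁻ (χ g) (x)`. -/
def wavePacket (χ : 𝓢(Plane, ℂ)) (x : Plane) : L2 := (memLp_wavePacket χ x).toLp _

theorem inner_wavePacket (χ : 𝓢(Plane, ℂ)) (x : Plane) (g : L2) :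
    ⟪wavePacket χ x, g⟫_ℂ = ∫ ξ, planeWave x ξ * (χ ξ * g ξ) := by
  rw [L2.inner_def]
  refine integral_congr_ae ?_
  filter_upwards [(memLp_wavePacket χ x).coeFn_toLp] with ξ h
  rw [wavePacket, h, RCLike.inner_apply', ← Complex.star_def, star_star, mul_assoc]

theorem inner_wavePacket_wavePacket (χ : 𝓢(Plane, ℂ)) (x y : Plane) :
    ⟪wavePacket χ x, wavePacket χ y⟫_ℂ = ∫ ξ, planeWave (x - y) ξ * (‖χ ξ‖ ^ 2 : ℝ) := by
  rw [inner_wavePacket]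
  refine integral_congr_ae ?_
  filter_upwards [(memLp_wavePacket χ y).coeFn_toLp] with ξ h
  rw [wavePacket, h, star_mul, ← star_planeWave_mul_planeWave, Complex.ofReal_pow,
    ← Complex.mul_conj', ← Complex.star_def]
  ring

theorem norm_wavePacket (χ : 𝓢(Plane, ℂ)) (x : Plane) : ‖wavePacket χ x‖ = ‖χ.toLp 2 volume‖ := by
  rw [← sq_eq_sq₀ (norm_nonneg _) (norm_nonneg _), L2_norm_sq, L2_norm_sq]
  refine integral_congr_ae ?_
  filter_upwards [(memLp_wavePacket χ x).coeFn_toLp, χ.coeFn_toLp 2 volume] with ξ h1 h2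
  rw [wavePacket, h1, h2, norm_star, norm_mul, norm_planeWave, one_mul]

theorem continuous_wavePacket (χ : 𝓢(Plane, ℂ)) : Continuous (wavePacket χ) := by
  have hχ : Integrable (fun ξ => ‖χ ξ‖ ^ 2) volume :=
    (memLp_two_iff_integrable_sq_norm χ.continuous.aestronglyMeasurable).mp (χ.memLp 2 volume)
  have hF : Continuous fun x : Plane => ∫ ξ, planeWave x ξ * (‖χ ξ‖ ^ 2 : ℝ) := by
    refine continuous_of_dominated (fun x => ?_) (fun x => Eventually.of_forall fun ξ => ?_) hχ
      (Eventually.of_forall fun ξ => ?_)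
    · exact ((continuous_planeWave.comp (Continuous.prodMk_right x)).mul (by fun_prop))
        |>.aestronglyMeasurable
    · rw [norm_mul, norm_planeWave, one_mul, Complex.norm_of_nonneg (by positivity)]
    · exact (continuous_planeWave.comp (Continuous.prodMk_left ξ)).mul continuous_const
  refine continuous_iff_continuousAt.mpr fun x => tendsto_iff_norm_sub_tendsto_zero.mpr ?_
  have hsq : ∀ y, ‖wavePacket χ y - wavePacket χ x‖ ^ 2 = 2 * ‖χ.toLp 2 volume‖ ^ 2 -
      2 * (∫ ξ, planeWave (y - x) ξ * (‖χ ξ‖ ^ 2 : ℝ)).re := fun y => by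
    rw [norm_sub_sq (𝕜 := ℂ), norm_wavePacket, norm_wavePacket, inner_wavePacket_wavePacket,
      RCLike.re_to_complex]
    ring
  have hlim : Tendsto (fun y => ‖wavePacket χ y - wavePacket χ x‖ ^ 2) (𝓝 x) (𝓝 0) := by
    have hc : Continuous fun y => ‖wavePacket χ y - wavePacket χ x‖ ^ 2 := by
      simp only [hsq]
      exact continuous_const.sub
        ((Complex.continuous_re.comp (hF.comp (continuous_sub_right x))).const_mul 2)
    simpa using hc.tendsto x
  simpa [Real.sqrt_sq] using hlim.sqrt

theorem smoothing_toLp (χ φ : 𝓢(Plane, ℂ)) : smoothing χ (φ.toLp 2 volume) =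
    schwartzToH1 (𝓕⁻ (SchwartzMap.smulLeftCLM ℂ χ φ)) := by
  refine H1.ext_fourier ?_
  have h : (𝓕 (H1.toL2 (schwartzToH1 (𝓕⁻ (SchwartzMap.smulLeftCLM ℂ χ φ)))) : L2) =
      (SchwartzMap.smulLeftCLM ℂ χ φ).toLp 2 volume := by
    change (𝓕 ((𝓕⁻ (SchwartzMap.smulLeftCLM ℂ χ φ) : 𝓢(Plane, ℂ)).toLp 2 : L2) : L2) = _
    rw [SchwartzMap.toLp_fourier_eq, FourierTransform.fourier_fourierInv_eq]
  rw [h]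
  filter_upwards [fourier_smoothing χ (φ.toLp 2 volume), φ.coeFn_toLp 2 volume,
    (SchwartzMap.smulLeftCLM ℂ χ φ).coeFn_toLp 2 volume] with ξ h1 h2 h3
  rw [h1, h2, h3, SchwartzMap.smulLeftCLM_apply_apply χ.hasTemperateGrowth, smul_eq_mul]

/-- Functions in the range of `smoothing χ` are given pointwise, also with respect to singular
measures, by Fourier inversion. -/
theorem Perturbation.J_smoothing (V : Perturbation) (χ : 𝓢(Plane, ℂ)) (g : L2) :
    J V.m (smoothing χ g) =ᵐ[V.m] fun x => ⟪wavePacket χ x, g⟫_ℂ := by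
  refine (SchwartzMap.denseRange_toLpCLM (E := Plane) (F := ℂ) (p := 2) (μ := volume)
    ENNReal.ofNat_ne_top).induction_on (p := fun g : L2 => J V.m (smoothing χ g) =ᵐ[V.m]
      fun x => ⟪wavePacket χ x, g⟫_ℂ) g ?_ fun φ => ?_
  · refine IsSeqClosed.isClosed fun u v hu huv => ?_
    obtain ⟨n, hn, h⟩ := exists_subseq_tendsto_ae
      ((((J V.m).comp (smoothing χ)).continuous.tendsto v).comp huv)
    filter_upwards [h, ae_all_iff.mpr hu] with x hx h1
    refine tendsto_nhds_unique hx ?_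
    refine (tendsto_const_nhds.inner (huv.comp hn.tendsto_atTop)).congr fun k => ?_
    exact (h1 (n k)).symm
  · rw [SchwartzMap.toLpCLM_apply, smoothing_toLp, V.J_schwartz]
    refine (SchwartzMap.coeFn_toLp _ 2 V.m).trans (Eventually.of_forall fun x => ?_)
    dsimp only
    rw [inner_wavePacket, SchwartzMap.fourierInv_coe, Real.fourierInv_eq]
    refine integral_congr_ae ((φ.coeFn_toLp 2 volume).mono fun ξ h => ?_)
    dsimp only
    rw [h, SchwartzMap.smulLeftCLM_apply_apply χ.hasTemperateGrowth, smul_eq_mul, planeWave]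
    rfl

theorem Perturbation.isCompactOperator_J_smoothing (V : Perturbation) (χ : 𝓢(Plane, ℂ)) :
    IsCompactOperator ((J V.m).comp (smoothing χ)) := by
  refine isCompactOperator_of_ae_eq_inner ?_ fun g => V.J_smoothing χ g
  exact MemLp.of_bound (continuous_wavePacket χ).aestronglyMeasurable _
    (Eventually.of_forall fun x => (norm_wavePacket χ x).le)

end Sobolev

section FormResolvent

variable {𝕜 Q K : Type*} [RCLike 𝕜] [NormedAddCommGroup Q] [InnerProductSpace 𝕜 Q]
  [NormedAddCommGroup K] [InnerProductSpace 𝕜 K] {ι : Q →L[𝕜] K} {B : Q →L⋆[𝕜] Q →L[𝕜] 𝕜}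
  {T : K →L[𝕜] Q}

/-- `T` is the resolvent of the form `B` with respect to the inclusion `ι : Q → K` of its form
domain: `u = T f` solves `B v u = ⟨ι v, f⟩` for all `v`. The operator in `K` associated with `B` is
the inverse of `ι ∘ T`. -/
def IsFormResolvent (ι : Q →L[𝕜] K) (B : Q →L⋆[𝕜] Q →L[𝕜] 𝕜) (T : K →L[𝕜] Q) : Prop :=
  ∀ f v, B v (T f) = inner 𝕜 (ι v) f

theorem exists_isFormResolvent [CompleteSpace Q] [CompleteSpace K] (ι : Q →L[𝕜] K)
    {B : Q →L⋆[𝕜] Q →L[𝕜] 𝕜} (hsym : ∀ u v, B u v = star (B v u)) {δ : ℝ} (hδ : 0 < δ)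
    (hB : ∀ u, δ * ‖u‖ ^ 2 ≤ RCLike.re (B u u)) : ∃ T, IsFormResolvent ι B T := by
  let G : Q →L[𝕜] Q := InnerProductSpace.continuousLinearMapOfBilin B
  have hG : ∀ u v, inner 𝕜 v (G u) = B v u := fun u v => by
    rw [← inner_conj_symm, InnerProductSpace.continuousLinearMapOfBilin_apply, hsym v u,
      RCLike.star_def]
  obtain ⟨g, hg⟩ : IsUnit G := by
    refine ContinuousLinearMap.isUnit_of_forall_le_norm_inner_map G (c := ⟨δ, hδ.le⟩) hδ fun u => ?_
    rw [InnerProductSpace.continuousLinearMapOfBilin_apply, mul_comm]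
    exact (hB u).trans (RCLike.re_le_norm _)
  refine ⟨g⁻¹.val.comp (ContinuousLinearMap.adjoint ι), fun f v => ?_⟩
  have hGg : ∀ w, G (g⁻¹.val w) = w := fun w => by
    rw [← hg, ← mul_apply_eq_comp, Units.mul_inv, one_apply_eq_self]
  rw [← hG, ContinuousLinearMap.comp_apply, hGg, ContinuousLinearMap.adjoint_inner_right]

theorem IsFormResolvent.eq_apply (hT : IsFormResolvent ι B T) {δ : ℝ} (hδ : 0 < δ)
    (hB : ∀ u, δ * ‖u‖ ^ 2 ≤ RCLike.re (B u u)) {f : K} {u : Q}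
    (h : ∀ v, B v u = inner 𝕜 (ι v) f) : u = T f := by
  have h1 := hB (u - T f)
  rw [map_sub (B (u - T f)), h, hT, sub_self, map_zero] at h1
  rw [← sub_eq_zero, ← norm_eq_zero, ← sq_eq_zero_iff]
  exact le_antisymm (nonpos_of_mul_nonpos_right h1 hδ) (sq_nonneg _)

theorem IsFormResolvent.isSymmetric (hT : IsFormResolvent ι B T)
    (hsym : ∀ u v, B u v = star (B v u)) :
    ((ι.comp T : K →L[𝕜] K) : K →ₗ[𝕜] K).IsSymmetric := by
  intro f g
  change inner 𝕜 (ι (T f)) g = inner 𝕜 f (ι (T g))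
  rw [← hT, hsym, hT, RCLike.star_def, inner_conj_symm]

theorem IsFormResolvent.lt_re_inner (hT : IsFormResolvent ι B T)
    (hsym : ∀ u v, B u v = star (B v u)) (hB : ∀ u, 0 ≤ RCLike.re (B u u)) {s : ℝ} (hs : 0 < s)
    {u : Q} (hu : RCLike.re (B u u) < s * ‖ι u‖ ^ 2) :
    s⁻¹ * ‖ι u‖ ^ 2 < RCLike.re (inner 𝕜 (ι (T (ι u))) (ι u)) := by
  set w := T (ι u)
  -- Positivity of the form at `u - s T u`.
  have hpos := hB (u - (s : 𝕜) • w)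
  have huw : B u w = ((‖ι u‖ ^ 2 : ℝ) : 𝕜) := by
    rw [hT, inner_self_eq_norm_sq_to_K, RCLike.ofReal_pow]
  have hwu : B w u = ((‖ι u‖ ^ 2 : ℝ) : 𝕜) := by
    rw [hsym, huw, RCLike.star_def, RCLike.conj_ofReal]
  have hexpand : B (u - (s : 𝕜) • w) (u - (s : 𝕜) • w) =
      B u u - (s : 𝕜) * B u w - ((s : 𝕜) * B w u - (s : 𝕜) * ((s : 𝕜) * B w w)) := by
    simp only [map_sub, map_smulₛₗ, RingHom.id_apply, RCLike.conj_ofReal, smul_eq_mul,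
      sub_apply, smul_apply]
    ring
  rw [hexpand, huw, hwu, hT] at hpos
  simp only [map_sub, RCLike.re_ofReal_mul, RCLike.ofReal_re] at hpos
  rw [inv_mul_lt_iff₀ hs]
  exact lt_of_mul_lt_mul_left (by linarith) hs.le

end FormResolvent

section Forms

namespace Coupling

variable (σ : Coupling)

theorem exists_norm_A_le_mul_sq_add :
    ∃ θ C : ℝ, 0 ≤ θ ∧ θ < 1 ∧ 0 ≤ C ∧ ∀ p, ‖σ.A p‖ ≤ θ * ‖p‖ ^ 2 + C := by
  obtain ⟨t, ht, ht1⟩ := exists_between σ.limsup_lt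
  have ht_top : t ≠ ⊤ := ht1.ne_top
  have hθ1 : t.toReal < 1 := by
    rw [← ENNReal.toReal_one]
    exact (ENNReal.toReal_lt_toReal ht_top ENNReal.one_ne_top).mpr ht1
  have hev : ∀ᶠ p in cocompact Plane, ‖σ.A p‖ ≤ t.toReal * ‖p‖ ^ 2 := by
    filter_upwards [eventually_lt_of_limsup_lt ht,
      (tendsto_norm_cocompact_atTop (E := Plane)).eventually_gt_atTop 0] with p hp hp0
    have hne : ‖p‖ₑ ^ 2 ≠ 0 := pow_ne_zero 2 (enorm_ne_zero.mpr (norm_pos_iff.mp hp0))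
    have h := ENNReal.toReal_mono (by finiteness)
      ((ENNReal.div_le_iff hne (by finiteness)).mp hp.le)
    rwa [ENNReal.toReal_mul, ENNReal.toReal_pow, toReal_enorm, toReal_enorm] at h
  obtain ⟨K, hK, hKs⟩ := mem_cocompact.mp hev
  obtain ⟨C, hC⟩ := hK.exists_bound_of_continuousOn σ.continuous.continuousOn
  have hθ0 : 0 ≤ t.toReal := ENNReal.toReal_nonneg
  refine ⟨t.toReal, max C 0, hθ0, hθ1, le_max_right _ _, fun p => ?_⟩
  by_cases hp : p ∈ K
  · exact (hC p hp).trans ((le_max_left _ _).trans (le_add_of_nonneg_left (by positivity)))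
  · exact (hKs hp).trans (le_add_of_nonneg_right (le_max_right _ _))

theorem bddBelow_range_lambdaMinus : BddBelow (Set.range σ.lambdaMinus) := by
  obtain ⟨C, -, hC⟩ := σ.norm_A_le
  refine ⟨-C, Set.forall_mem_range.mpr fun p => ?_⟩
  rw [lambdaMinus]
  linarith [hC p]

theorem kappa_le_lambdaMinus (p : Plane) : σ.kappa ≤ σ.lambdaMinus p :=
  ciInf_le σ.bddBelow_range_lambdaMinus p

/-- The sesquilinear form of the matrix `Ĥ₀(p)`. -/
def quad (p : Plane) (z w : Fin 2 → ℂ) : ℂ := star z ⬝ᵥ (σ.symbol p).mulVec w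

theorem quad_eq (p : Plane) (z w : Fin 2 → ℂ) : σ.quad p z w =
    star (z 0) * (((‖p‖ ^ 2 : ℝ) : ℂ) * w 0 + σ.A p * w 1) +
      star (z 1) * (star (σ.A p) * w 0 + ((‖p‖ ^ 2 : ℝ) : ℂ) * w 1) := by
  simp [quad, symbol, dotProduct, Matrix.mulVec, Fin.sum_univ_two]

theorem quad_symm (p : Plane) (z w : Fin 2 → ℂ) : σ.quad p z w = star (σ.quad p w z) := by
  rw [quad_eq, quad_eq]
  simp only [star_add, star_mul', Complex.star_def, Complex.conj_ofReal, Complex.conj_conj]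
  ring

theorem lambdaMinus_mul_le_re_quad (p : Plane) (z : Fin 2 → ℂ) :
    σ.lambdaMinus p * ∑ i, ‖z i‖ ^ 2 ≤ (σ.quad p z z).re := by
  have hquad : (σ.quad p z z).re =
      ‖p‖ ^ 2 * ∑ i, ‖z i‖ ^ 2 + 2 * (star (z 0) * (σ.A p * z 1)).re := by
    rw [quad_eq, Fin.sum_univ_two]
    simp only [Complex.star_def, ← Complex.normSq_eq_norm_sq, Complex.normSq_apply,
      Complex.add_re, Complex.mul_re, Complex.mul_im, Complex.conj_re, Complex.conj_im,
      Complex.ofReal_re, Complex.ofReal_im, Complex.add_im]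
    ring
  have hoff : -(‖z 0‖ * (‖σ.A p‖ * ‖z 1‖)) ≤ (star (z 0) * (σ.A p * z 1)).re := by
    refine neg_le_of_abs_le ((Complex.abs_re_le_norm _).trans_eq ?_)
    rw [norm_mul, norm_mul, norm_star]
  rw [hquad, lambdaMinus, Fin.sum_univ_two]
  nlinarith [mul_nonneg (norm_nonneg (σ.A p)) (sq_nonneg (‖z 0‖ - ‖z 1‖))]

theorem norm_quad_le {C : ℝ} {p : Plane} (hC : ∀ i j, ‖σ.symbol p i j‖ ≤ C) (z w : Fin 2 → ℂ) :
    ‖σ.quad p z w‖ ≤ C * ∑ i, (‖z i‖ ^ 2 + ‖w i‖ ^ 2) := by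
  have hC0 : 0 ≤ C := (norm_nonneg _).trans (hC 0 0)
  calc ‖σ.quad p z w‖ ≤ ∑ i, ∑ j, ‖z i‖ * (C * ‖w j‖) := by
        simp only [quad, dotProduct, Matrix.mulVec, Pi.star_apply, Finset.mul_sum]
        refine norm_sum_le_of_le _ fun i _ => norm_sum_le_of_le _ fun j _ => ?_
        rw [norm_mul, norm_mul, norm_star]
        gcongr
        exact hC i j
    _ ≤ C * ∑ i, (‖z i‖ ^ 2 + ‖w i‖ ^ 2) := by
        simp only [Fin.sum_univ_two]
        nlinarith [mul_nonneg hC0 (sq_nonneg (‖z 0‖ - ‖w 0‖)),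
          mul_nonneg hC0 (sq_nonneg (‖z 0‖ - ‖w 1‖)), mul_nonneg hC0 (sq_nonneg (‖z 1‖ - ‖w 0‖)),
          mul_nonneg hC0 (sq_nonneg (‖z 1‖ - ‖w 1‖))]

end Coupling

theorem weight_eq (ξ : Plane) : (weight ξ : ℝ) = 1 + ‖(2 * Real.pi) • ξ‖ ^ 2 := by
  rw [norm_smul, Real.norm_of_nonneg Real.two_pi_pos.le]
  rfl

/-- The Fourier transform of a spinor in `H¹(ℝ²) ⊗ ℂ²`. -/
def hat (u : Fin 2 → H1) (ξ : Plane) : Fin 2 → ℂ := fun i => (𝓕 (H1.toL2 (u i)) : L2) ξ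

theorem hat_sub (u v : Fin 2 → H1) : ∀ᵐ ξ : Plane, hat (u - v) ξ = hat u ξ - hat v ξ := by
  have h : ∀ᵐ ξ : Plane, ∀ i, hat (u - v) ξ i = hat u ξ i - hat v ξ i := by
    refine ae_all_iff.mpr fun i => ?_
    have hsub : (𝓕 (H1.toL2 ((u - v) i)) : L2) = 𝓕 (H1.toL2 (u i)) - 𝓕 (H1.toL2 (v i)) := by
      rw [Pi.sub_apply, map_sub]
      exact map_sub (FourierTransform.fourierCLM ℂ L2) _ _
    simp only [hat, hsub]
    exact Lp.coeFn_sub _ _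
  exact h.mono fun ξ hξ => funext hξ

theorem integrable_norm_hat_sq (u : Fin 2 → H1) : Integrable fun ξ => ∑ i, ‖hat u ξ i‖ ^ 2 :=
  integrable_finsetSum _ fun _ _ => L2_integrable_sq _

theorem integrable_weight_mul_norm_hat_sq (u : Fin 2 → H1) :
    Integrable fun ξ => (weight ξ : ℝ) * ∑ i, ‖hat u ξ i‖ ^ 2 := by
  simp only [Finset.mul_sum]
  exact integrable_finsetSum _ fun i _ => H1.integrable_weight (u i)

theorem sum_norm_sq_eq_integral (u : Fin 2 → H1) :
    ∑ i, ‖u i‖ ^ 2 = ∫ ξ, (weight ξ : ℝ) * ∑ i, ‖hat u ξ i‖ ^ 2 := by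
  simp only [Finset.mul_sum, H1.norm_sq]
  exact (integral_finsetSum _ fun i _ => H1.integrable_weight (u i)).symm

theorem integrable_star_hat_mul_hat (u v : Fin 2 → H1) (i : Fin 2) :
    Integrable fun ξ => star (hat u ξ i) * hat v ξ i :=
  (Lp.memLp (𝓕 (H1.toL2 (u i)) : L2)).star.integrable_mul (Lp.memLp (𝓕 (H1.toL2 (v i)) : L2))

theorem integrable_star_hat_dotProduct_hat (u v : Fin 2 → H1) :
    Integrable fun ξ => star (hat u ξ) ⬝ᵥ hat v ξ :=
  integrable_finsetSum _ fun i _ => integrable_star_hat_mul_hat u v i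

theorem inner_spinorIncl (u v : Fin 2 → H1) :
    inner ℂ (spinorIncl u) (spinorIncl v) = ∫ ξ, star (hat u ξ) ⬝ᵥ hat v ξ := by
  simp only [dotProduct, Pi.star_apply]
  rw [PiLp.inner_apply, integral_finsetSum _ fun i _ => integrable_star_hat_mul_hat u v i]
  refine Finset.sum_congr rfl fun i _ => ?_
  change inner ℂ (H1.toL2 (u i)) (H1.toL2 (v i)) = _
  rw [← Lp.inner_fourier_eq, L2.inner_def]
  refine integral_congr_ae (Eventually.of_forall fun ξ => ?_)
  exact RCLike.inner_apply' (hat u ξ i) (hat v ξ i)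

theorem norm_spinorIncl_sq (u : Fin 2 → H1) : ‖spinorIncl u‖ ^ 2 = ∑ i, ‖H1.toL2 (u i)‖ ^ 2 :=
  PiLp.norm_sq_eq_of_L2 _ _

theorem norm_spinorIncl_sq_eq_integral (u : Fin 2 → H1) :
    ‖spinorIncl u‖ ^ 2 = ∫ ξ, ∑ i, ‖hat u ξ i‖ ^ 2 := by
  have hint : ∀ i, Integrable fun ξ => ‖hat u ξ i‖ ^ 2 := fun _ => L2_integrable_sq _
  rw [norm_spinorIncl_sq, integral_finsetSum _ fun i _ => hint i]
  refine Finset.sum_congr rfl fun i _ => ?_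
  rw [← Lp.norm_fourier_eq, L2_norm_sq]
  rfl

namespace Coupling

variable (σ : Coupling)

theorem form₀_eq_integral_quad (u v : Fin 2 → H1) :
    σ.form₀ u v = ∫ ξ, σ.quad ((2 * Real.pi) • ξ) (hat u ξ) (hat v ξ) := rfl

theorem integrable_quad (u v : Fin 2 → H1) :
    Integrable fun ξ => σ.quad ((2 * Real.pi) • ξ) (hat u ξ) (hat v ξ) := σ.integrable_form₀ u v

theorem re_form₀ (u v : Fin 2 → H1) :
    (σ.form₀ u v).re = ∫ ξ, (σ.quad ((2 * Real.pi) • ξ) (hat u ξ) (hat v ξ)).re :=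
  (integral_re (σ.integrable_quad u v)).symm

theorem form₀_symm (u v : Fin 2 → H1) : σ.form₀ u v = star (σ.form₀ v u) := by
  rw [form₀_eq_integral_quad, form₀_eq_integral_quad, Complex.star_def, ← integral_conj]
  exact integral_congr_ae (Eventually.of_forall fun ξ => σ.quad_symm _ _ _)

theorem exists_norm_form₀_le : ∃ C, ∀ u v : Fin 2 → H1,
    ‖σ.form₀ u v‖ ≤ C * (∑ i, ‖u i‖ ^ 2 + ∑ i, ‖v i‖ ^ 2) := by
  obtain ⟨C, hC0, hC⟩ := σ.norm_symbol_le
  refine ⟨C + 1, fun u v => ?_⟩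
  have hsymbol : ∀ ξ i j, ‖σ.symbol ((2 * Real.pi) • ξ) i j‖ ≤ (C + 1) * (weight ξ : ℝ) := by
    intro ξ i j
    refine (hC _ i j).trans ?_
    rw [weight_eq]
    nlinarith [sq_nonneg ‖(2 * Real.pi) • ξ‖, mul_nonneg hC0 (sq_nonneg ‖(2 * Real.pi) • ξ‖)]
  have hu := integrable_weight_mul_norm_hat_sq u
  have hv := integrable_weight_mul_norm_hat_sq v
  rw [sum_norm_sq_eq_integral, sum_norm_sq_eq_integral, ← integral_add hu hv, ← integral_const_mul]
  refine norm_integral_le_of_norm_le ((hu.add hv).const_mul _) (Eventually.of_forall fun ξ => ?_)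
  refine (σ.norm_quad_le (hsymbol ξ) _ _).trans_eq ?_
  rw [Finset.sum_add_distrib, mul_assoc, mul_add]
  rfl

theorem mul_sum_norm_sq_le_re_form₀_add {θ C : ℝ} (hC : ∀ p, ‖σ.A p‖ ≤ θ * ‖p‖ ^ 2 + C)
    (hθ : 0 ≤ θ) (u : Fin 2 → H1) :
    (1 - θ) * ∑ i, ‖u i‖ ^ 2 ≤ (σ.form₀ u u).re + (C + 1) * ‖spinorIncl u‖ ^ 2 := by
  have hq : Integrable fun ξ => (σ.quad ((2 * Real.pi) • ξ) (hat u ξ) (hat u ξ)).re :=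
    (σ.integrable_quad u u).re
  have hn := (integrable_norm_hat_sq u).const_mul (C + 1)
  rw [sum_norm_sq_eq_integral, re_form₀, norm_spinorIncl_sq_eq_integral, ← integral_const_mul,
    ← integral_const_mul, ← integral_add hq hn]
  refine integral_mono ((integrable_weight_mul_norm_hat_sq u).const_mul _) (hq.add hn) fun ξ => ?_
  have hquad := σ.lambdaMinus_mul_le_re_quad ((2 * Real.pi) • ξ) (hat u ξ)
  have hsum : 0 ≤ ∑ i, ‖hat u ξ i‖ ^ 2 := Finset.sum_nonneg fun i _ => by positivity
  rw [lambdaMinus] at hquad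
  dsimp only
  rw [weight_eq]
  nlinarith [mul_le_mul_of_nonneg_right (hC ((2 * Real.pi) • ξ)) hsum]

theorem exists_coercive_form₀ : ∃ δ C : ℝ, 0 < δ ∧ ∀ u : Fin 2 → H1,
    δ * ∑ i, ‖u i‖ ^ 2 ≤ (σ.form₀ u u).re + C * ‖spinorIncl u‖ ^ 2 := by
  obtain ⟨θ, C, hθ0, hθ1, -, hC⟩ := σ.exists_norm_A_le_mul_sq_add
  exact ⟨1 - θ, C + 1, sub_pos.mpr hθ1, σ.mul_sum_norm_sq_le_re_form₀_add hC hθ0⟩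

end Coupling

namespace Perturbation

variable (V : Perturbation)

theorem form_symm (u v : Fin 2 → H1) : V.form u v = star (V.form v u) := by
  rw [form, form, Complex.star_def, ← integral_conj]
  refine integral_congr_ae (Eventually.of_forall fun x => ?_)
  simp only [dotProduct, Pi.star_apply, Complex.star_def, map_mul, map_sum, Complex.conj_ofReal,
    Complex.conj_conj]
  exact congrArg _ (Finset.sum_congr rfl fun i _ => mul_comm _ _)

theorem exists_norm_form_le : ∃ C, 0 ≤ C ∧ ∀ u v : Fin 2 → H1,
    ‖V.form u v‖ ≤ C * ∑ i, ‖J V.m (u i)‖ * ‖J V.m (v i)‖ := by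
  obtain ⟨C, hC⟩ := V.bounded
  have hC0 : 0 ≤ C := (abs_nonneg _).trans (hC 0)
  refine ⟨C, hC0, fun u v => ?_⟩
  have hint : ∀ i, Integrable (fun x => ‖J V.m (u i) x‖ * ‖J V.m (v i) x‖) V.m := fun i =>
    (Lp.memLp (J V.m (u i))).norm.integrable_mul (Lp.memLp (J V.m (v i))).norm
  calc ‖V.form u v‖ ≤ ∫ x, C * ∑ i, ‖J V.m (u i) x‖ * ‖J V.m (v i) x‖ ∂V.m := by
        refine norm_integral_le_of_norm_le ((integrable_finsetSum _ fun i _ => hint i).const_mul C)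
          (Eventually.of_forall fun x => ?_)
        rw [norm_mul, Complex.norm_real]
        refine mul_le_mul (hC x) (norm_sum_le_of_le _ fun i _ => ?_) (norm_nonneg _) hC0
        rw [norm_mul, Pi.star_apply, norm_star]
    _ ≤ C * ∑ i, ‖J V.m (u i)‖ * ‖J V.m (v i)‖ := by
        rw [integral_const_mul, integral_finsetSum _ fun i _ => hint i]
        gcongr with i
        exact integral_norm_mul_norm_le _ _

end Perturbation

end Forms

section BoundedForms

variable {𝕜 Q : Type*} [RCLike 𝕜] [NormedAddCommGroup Q] [NormedSpace 𝕜 Q]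

theorem exists_norm_le_one_smul_eq (𝕜 : Type*) [RCLike 𝕜] [NormedSpace 𝕜 Q] (u : Q) :
    ∃ w : Q, ‖w‖ ≤ 1 ∧ (‖u‖ : 𝕜) • w = u := by
  rcases eq_or_ne u 0 with rfl | hu
  · exact ⟨0, by simp, by simp⟩
  · refine ⟨(‖u‖⁻¹ : 𝕜) • u, (norm_smul_inv_norm hu).le, ?_⟩
    rw [smul_smul, mul_inv_cancel₀ (by simpa using hu), one_smul]

theorem norm_le_mul_of_norm_le_add_sq {B : Q →ₗ⋆[𝕜] Q →ₗ[𝕜] 𝕜} {C : ℝ} (hC : 0 ≤ C)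
    (hB : ∀ u v, ‖B u v‖ ≤ C * (‖u‖ ^ 2 + ‖v‖ ^ 2)) (u v : Q) :
    ‖B u v‖ ≤ 2 * C * ‖u‖ * ‖v‖ := by
  obtain ⟨u', hu', hu⟩ := exists_norm_le_one_smul_eq 𝕜 u
  obtain ⟨v', hv', hv⟩ := exists_norm_le_one_smul_eq 𝕜 v
  have hunit : ‖B u' v'‖ ≤ C * 2 := by
    refine (hB u' v').trans (mul_le_mul_of_nonneg_left ?_ hC)
    linarith [pow_le_one₀ (n := 2) (norm_nonneg _) hu', pow_le_one₀ (n := 2) (norm_nonneg _) hv']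
  calc ‖B u v‖ = ‖B ((‖u‖ : 𝕜) • u') ((‖v‖ : 𝕜) • v')‖ := by rw [hu, hv]
    _ = ‖u‖ * ‖v‖ * ‖B u' v'‖ := by
        rw [LinearMap.map_smulₛₗ₂, map_smul, norm_smul, norm_smul, RCLike.norm_conj,
          RCLike.norm_ofReal, RCLike.norm_ofReal, abs_norm, abs_norm, mul_assoc]
    _ ≤ ‖u‖ * ‖v‖ * (C * 2) := by gcongr
    _ = 2 * C * ‖u‖ * ‖v‖ := by ring

end BoundedForms

section FormDomain

/-- The form domain `H¹(ℝ²) ⊗ ℂ²` with its Hilbert space structure; a definition rather than an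
abbreviation so that instance search does not unfold `H1`. -/
def FormDomain : Type := PiLp 2 (fun _ : Fin 2 => H1)

namespace FormDomain

instance : NormedAddCommGroup FormDomain :=
  inferInstanceAs (NormedAddCommGroup (PiLp 2 (fun _ : Fin 2 => H1)))

instance : InnerProductSpace ℂ FormDomain :=
  inferInstanceAs (InnerProductSpace ℂ (PiLp 2 (fun _ : Fin 2 => H1)))

instance : CompleteSpace FormDomain :=
  inferInstanceAs (CompleteSpace (PiLp 2 (fun _ : Fin 2 => H1)))

/-- The form domain as a space of pairs. -/
def equiv : FormDomain ≃ₗ[ℂ] (Fin 2 → H1) := WithLp.linearEquiv 2 ℂ (Fin 2 → H1)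

instance : CoeFun FormDomain fun _ => Fin 2 → H1 := ⟨equiv⟩

instance : Coe FormDomain (Fin 2 → H1) := ⟨equiv⟩

theorem norm_sq_eq (u : FormDomain) : ‖u‖ ^ 2 = ∑ i, ‖u i‖ ^ 2 :=
  PiLp.norm_sq_eq_of_L2 (fun _ : Fin 2 => H1) u

theorem norm_apply_le (u : FormDomain) (i : Fin 2) : ‖u i‖ ≤ ‖u‖ :=
  PiLp.norm_apply_le (β := fun _ : Fin 2 => H1) u i

end FormDomain

theorem norm_spinorIncl_le (u : FormDomain) : ‖spinorIncl u‖ ≤ ‖u‖ := by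
  rw [← sq_le_sq₀ (norm_nonneg _) (norm_nonneg _), norm_spinorIncl_sq, FormDomain.norm_sq_eq]
  gcongr with i
  exact H1.norm_toL2_le _

/-- The inclusion of the form domain into `L²(ℝ²) ⊗ ℂ²` as a continuous linear map. -/
def formIncl : FormDomain →L[ℂ] Spinor :=
  (spinorIncl ∘ₗ FormDomain.equiv.toLinearMap).mkContinuous 1 fun u =>
    (norm_spinorIncl_le u).trans_eq (one_mul _).symm

theorem formIncl_apply (u : FormDomain) : formIncl u = spinorIncl u := rfl

variable (σ : Coupling) (V : Perturbation)

/-- The form `q + c`, which is coercive for large `c`. -/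
def shiftedForm (c : ℝ) (u v : Fin 2 → H1) : ℂ :=
  form σ V u v + c * inner ℂ (spinorIncl u) (spinorIncl v)

theorem shiftedForm_symm (c : ℝ) (u v : Fin 2 → H1) :
    shiftedForm σ V c u v = star (shiftedForm σ V c v u) := by
  rw [shiftedForm, shiftedForm, form, form, σ.form₀_symm, V.form_symm, ← inner_conj_symm]
  simp only [star_add, star_mul', Complex.star_def, Complex.conj_ofReal]

theorem shiftedForm_add_right (c : ℝ) (u v w : Fin 2 → H1) :
    shiftedForm σ V c u (v + w) = shiftedForm σ V c u v + shiftedForm σ V c u w := by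
  simp only [shiftedForm, form, σ.form₀_add, V.form_add, map_add, inner_add_right]
  ring

theorem shiftedForm_smul_right (c : ℝ) (a : ℂ) (u v : Fin 2 → H1) :
    shiftedForm σ V c u (a • v) = a * shiftedForm σ V c u v := by
  simp only [shiftedForm, form, σ.form₀_smul, V.form_smul, map_smul, inner_smul_right]
  ring

theorem shiftedForm_add_left (c : ℝ) (u v w : Fin 2 → H1) :
    shiftedForm σ V c (u + v) w = shiftedForm σ V c u w + shiftedForm σ V c v w := by
  rw [shiftedForm_symm, shiftedForm_add_right, star_add, ← shiftedForm_symm, ← shiftedForm_symm]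

theorem shiftedForm_smul_left (c : ℝ) (a : ℂ) (u v : Fin 2 → H1) :
    shiftedForm σ V c (a • u) v = star a * shiftedForm σ V c u v := by
  rw [shiftedForm_symm, shiftedForm_smul_right, star_mul', ← shiftedForm_symm]

theorem re_shiftedForm_self (c : ℝ) (u : Fin 2 → H1) :
    (shiftedForm σ V c u u).re =
      (σ.form₀ u u).re + (V.form u u).re + c * ‖spinorIncl u‖ ^ 2 := by
  rw [shiftedForm, form, Complex.add_re, Complex.add_re, Complex.re_ofReal_mul,
    ← inner_self_eq_norm_sq (𝕜 := ℂ) (spinorIncl u)]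
  rfl

theorem sum_norm_J_le (u v : FormDomain) :
    ∑ i, ‖J V.m (u i)‖ * ‖J V.m (v i)‖ ≤ ‖J V.m‖ ^ 2 * (‖u‖ ^ 2 + ‖v‖ ^ 2) := by
  simp only [FormDomain.norm_sq_eq, ← Finset.sum_add_distrib, Finset.mul_sum]
  refine Finset.sum_le_sum fun i _ => ?_
  have hu := (J V.m).le_opNorm (u i)
  have hv := (J V.m).le_opNorm (v i)
  calc ‖J V.m (u i)‖ * ‖J V.m (v i)‖ ≤ ‖J V.m‖ * ‖u i‖ * (‖J V.m‖ * ‖v i‖) := by gcongr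
    _ = ‖J V.m‖ ^ 2 * (‖u i‖ * ‖v i‖) := by ring
    _ ≤ ‖J V.m‖ ^ 2 * (‖u i‖ ^ 2 + ‖v i‖ ^ 2) := by
        gcongr
        nlinarith [sq_nonneg (‖u i‖ - ‖v i‖), sq_nonneg ‖u i‖, sq_nonneg ‖v i‖]

theorem norm_inner_spinorIncl_le (u v : FormDomain) :
    ‖inner ℂ (spinorIncl u) (spinorIncl v)‖ ≤ ‖u‖ ^ 2 + ‖v‖ ^ 2 :=
  calc ‖inner ℂ (spinorIncl u) (spinorIncl v)‖ ≤ ‖u‖ * ‖v‖ :=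
        (norm_inner_le_norm _ _).trans (by gcongr <;> exact norm_spinorIncl_le _)
    _ ≤ ‖u‖ ^ 2 + ‖v‖ ^ 2 := by
        nlinarith [sq_nonneg (‖u‖ - ‖v‖), sq_nonneg ‖u‖, sq_nonneg ‖v‖]

theorem exists_norm_shiftedForm_le (c : ℝ) :
    ∃ C, 0 ≤ C ∧ ∀ u v : FormDomain, ‖shiftedForm σ V c u v‖ ≤ C * (‖u‖ ^ 2 + ‖v‖ ^ 2) := by
  obtain ⟨C₁, hC₁⟩ := σ.exists_norm_form₀_le
  obtain ⟨C₂, hC₂0, hC₂⟩ := V.exists_norm_form_le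
  refine ⟨max C₁ 0 + C₂ * ‖J V.m‖ ^ 2 + |c|, by positivity, fun u v => ?_⟩
  have hform₀ : ‖σ.form₀ u v‖ ≤ max C₁ 0 * (‖u‖ ^ 2 + ‖v‖ ^ 2) := by
    rw [FormDomain.norm_sq_eq, FormDomain.norm_sq_eq]
    refine (hC₁ u v).trans ?_
    gcongr
    exact le_max_left _ _
  have hform : ‖V.form u v‖ ≤ C₂ * (‖J V.m‖ ^ 2 * (‖u‖ ^ 2 + ‖v‖ ^ 2)) :=
    (hC₂ _ _).trans (mul_le_mul_of_nonneg_left (sum_norm_J_le V u v) hC₂0)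
  have hinner : ‖(c : ℂ) * inner ℂ (spinorIncl u) (spinorIncl v)‖ ≤ |c| * (‖u‖ ^ 2 + ‖v‖ ^ 2) := by
    rw [norm_mul, Complex.norm_real, Real.norm_eq_abs]
    exact mul_le_mul_of_nonneg_left (norm_inner_spinorIncl_le u v) (abs_nonneg _)
  calc ‖shiftedForm σ V c u v‖ ≤ _ := norm_add₃_le
    _ ≤ _ := add_le_add (add_le_add hform₀ hform) hinner
    _ = _ := by ring

/-- The form `q + c` as a bounded sesquilinear form on the form domain. -/
def shiftedFormL (c : ℝ) : FormDomain →L⋆[ℂ] FormDomain →L[ℂ] ℂ :=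
  (LinearMap.mk₂'ₛₗ (starRingEnd ℂ) (RingHom.id ℂ)
    (fun u v : FormDomain => shiftedForm σ V c u v)
    (fun u v w => shiftedForm_add_left σ V c u v w) (fun a u v => shiftedForm_smul_left σ V c a u v)
    (fun u v w => shiftedForm_add_right σ V c u v w)
    (fun a u v => shiftedForm_smul_right σ V c a u v)).mkContinuousOfExistsBound₂ <| by
  obtain ⟨C, hC0, hC⟩ := exists_norm_shiftedForm_le σ V c
  exact ⟨2 * C, fun u v => norm_le_mul_of_norm_le_add_sq (Q := FormDomain) hC0 hC u v⟩

theorem shiftedFormL_apply (c : ℝ) (u v : FormDomain) :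
    shiftedFormL σ V c u v = shiftedForm σ V c u v := rfl

variable {σ V}

theorem IsRelativelyBounded.exists_coercive (h : IsRelativelyBounded σ V) :
    ∃ δ c : ℝ, 0 < δ ∧ 0 < σ.kappa + c ∧
      ∀ u : FormDomain, δ * ‖u‖ ^ 2 ≤ (shiftedFormL σ V c u u).re := by
  obtain ⟨a, b, ha, hab⟩ := h
  obtain ⟨δ, C, hδ, hC⟩ := σ.exists_coercive_form₀
  have ha' : 0 < 1 - a := sub_pos.mpr ha
  set c := max ((1 - a) * C + b) (1 - σ.kappa)
  have hc : (1 - a) * C + b ≤ c := le_max_left _ _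
  refine ⟨(1 - a) * δ, c, mul_pos ha' hδ,
    by linarith [le_max_right ((1 - a) * C + b) (1 - σ.kappa)], fun u => ?_⟩
  have hform₀ := hC u
  have hform : -(a * (σ.form₀ u u).re + b * ‖spinorIncl u‖ ^ 2) ≤ (V.form u u).re :=
    (neg_le_neg (hab u)).trans (neg_le_of_abs_le (Complex.abs_re_le_norm _))
  rw [← FormDomain.norm_sq_eq] at hform₀
  rw [shiftedFormL_apply, re_shiftedForm_self]
  nlinarith [mul_le_mul_of_nonneg_left hform₀ ha'.le,
    mul_le_mul_of_nonneg_right hc (sq_nonneg ‖spinorIncl u‖)]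

end FormDomain

section Bandlimit

theorem re_star_dotProduct_self {ι : Type*} [Fintype ι] (z : ι → ℂ) :
    (star z ⬝ᵥ z).re = ∑ i, ‖z i‖ ^ 2 := by
  simp only [dotProduct, Pi.star_apply, Complex.re_sum]
  refine Finset.sum_congr rfl fun i _ => ?_
  rw [Complex.star_def, Complex.conj_mul', ← Complex.ofReal_pow, Complex.ofReal_re]

theorem re_star_ofReal_smul_dotProduct {ι : Type*} [Fintype ι] (t : ℝ) (z w : ι → ℂ) :
    (star ((t : ℂ) • z) ⬝ᵥ w).re = t * (star z ⬝ᵥ w).re := by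
  rw [star_smul, smul_dotProduct, Complex.star_def, Complex.conj_ofReal, smul_eq_mul,
    Complex.re_ofReal_mul]

/-- A smooth bump function as a Schwartz function. -/
def cutoff (b : ContDiffBump (0 : Plane)) : 𝓢(Plane, ℂ) :=
  (b.hasCompactSupport.comp_left (g := ((↑) : ℝ → ℂ)) Complex.ofReal_zero).toSchwartzMap
    (Complex.ofRealCLM.contDiff.comp b.contDiff)

theorem cutoff_apply (b : ContDiffBump (0 : Plane)) (ξ : Plane) : cutoff b ξ = (b ξ : ℂ) := rfl

variable (b : ContDiffBump (0 : Plane))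

/-- The smooth truncation of a spinor to the frequencies in the support of `b`. -/
def bandlimit (u : Fin 2 → H1) : Fin 2 → H1 := fun i => smoothing (cutoff b) (𝓕 (H1.toL2 (u i)))

theorem hat_bandlimit (u : Fin 2 → H1) :
    ∀ᵐ ξ : Plane, hat (bandlimit b u) ξ = (b ξ : ℂ) • hat u ξ := by
  have h : ∀ᵐ ξ : Plane, ∀ i, hat (bandlimit b u) ξ i = (b ξ : ℂ) * hat u ξ i :=
    ae_all_iff.mpr fun i => fourier_smoothing (cutoff b) _
  exact h.mono fun ξ hξ => funext hξ

theorem norm_sq_bandlimit_le_re_inner (u : Fin 2 → H1) : ‖spinorIncl (bandlimit b u)‖ ^ 2 ≤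
    (inner ℂ (spinorIncl (bandlimit b u)) (spinorIncl u)).re := by
  have hint := integrable_star_hat_dotProduct_hat (bandlimit b u) u
  rw [norm_spinorIncl_sq_eq_integral, inner_spinorIncl]
  refine (integral_mono_ae (integrable_norm_hat_sq _) hint.re ?_).trans_eq (integral_re hint)
  filter_upwards [hat_bandlimit b u] with ξ hξ
  change _ ≤ (_ : ℂ).re
  rw [hξ, re_star_ofReal_smul_dotProduct, re_star_dotProduct_self, Finset.mul_sum]
  gcongr with i
  rw [Pi.smul_apply, norm_smul, Complex.norm_real, Real.norm_of_nonneg b.nonneg, mul_pow]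
  gcongr
  exact pow_le_of_le_one b.nonneg b.le_one two_ne_zero

theorem kappa_mul_re_inner_bandlimit_le (σ : Coupling) (u : Fin 2 → H1) :
    σ.kappa * (inner ℂ (spinorIncl (bandlimit b u)) (spinorIncl u)).re ≤
      (σ.form₀ (bandlimit b u) u).re := by
  have hint := integrable_star_hat_dotProduct_hat (bandlimit b u) u
  have hre : ∫ ξ, (star (hat (bandlimit b u) ξ) ⬝ᵥ hat u ξ).re = _ := integral_re hint
  rw [inner_spinorIncl, σ.re_form₀, ← RCLike.re_to_complex, ← hre, ← integral_const_mul]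
  refine integral_mono_ae (hint.re.const_mul _) (σ.integrable_quad _ _).re ?_
  filter_upwards [hat_bandlimit b u] with ξ hξ
  change _ ≤ (_ : ℂ).re
  rw [hξ, Coupling.quad, re_star_ofReal_smul_dotProduct, re_star_ofReal_smul_dotProduct,
    re_star_dotProduct_self, mul_left_comm]
  refine mul_le_mul_of_nonneg_left ?_ b.nonneg
  refine (mul_le_mul_of_nonneg_right (σ.kappa_le_lambdaMinus _) ?_).trans
    (σ.lambdaMinus_mul_le_re_quad ((2 * Real.pi) • ξ) (hat u ξ))
  positivity

theorem rIn_sq_mul_le_weight (ξ : Plane) : b.rIn ^ 2 * (1 - b ξ) ^ 2 ≤ (weight ξ : ℝ) := by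
  have hr := b.rIn_pos
  rw [weight_eq]
  by_cases hξ : ‖ξ‖ ≤ b.rIn
  · rw [b.one_of_mem_closedBall (mem_closedBall_zero_iff.mpr hξ), sub_self]
    nlinarith [sq_nonneg ‖(2 * Real.pi) • ξ‖]
  · have hrIn : b.rIn ≤ ‖(2 * Real.pi) • ξ‖ := by
      rw [norm_smul, Real.norm_of_nonneg Real.two_pi_pos.le]
      nlinarith [Real.pi_gt_three, norm_nonneg ξ]
    calc b.rIn ^ 2 * (1 - b ξ) ^ 2 ≤ ‖(2 * Real.pi) • ξ‖ ^ 2 * 1 ^ 2 := by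
          have hb0 := b.nonneg (x := ξ)
          have hb1 := b.le_one (x := ξ)
          gcongr
          linarith
      _ ≤ _ := by linarith

theorem rIn_mul_norm_sub_bandlimit_le (u : FormDomain) :
    b.rIn * ‖spinorIncl u - spinorIncl (bandlimit b u)‖ ≤ ‖u‖ := by
  have hr := b.rIn_pos
  rw [← sq_le_sq₀ (by positivity) (norm_nonneg _), mul_pow, ← map_sub,
    norm_spinorIncl_sq_eq_integral, FormDomain.norm_sq_eq, sum_norm_sq_eq_integral,
    ← integral_const_mul]
  refine integral_mono_ae ((integrable_norm_hat_sq _).const_mul _)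
    (integrable_weight_mul_norm_hat_sq u) ?_
  filter_upwards [hat_bandlimit b u, hat_sub u (bandlimit b u)] with ξ hξ hsub
  have hmul : ∀ i, ‖hat (⇑u - bandlimit b u) ξ i‖ ^ 2 = (1 - b ξ) ^ 2 * ‖hat u ξ i‖ ^ 2 := by
    intro i
    have hfactor : hat u ξ i - (b ξ : ℂ) * hat u ξ i = ((1 - b ξ : ℝ) : ℂ) * hat u ξ i := by
      push_cast
      ring
    rw [hsub, hξ, Pi.sub_apply, Pi.smul_apply, smul_eq_mul, hfactor, norm_mul, mul_pow,
      Complex.norm_real, Real.norm_eq_abs, sq_abs]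
  simp only [hmul]
  rw [← Finset.mul_sum, ← mul_assoc]
  exact mul_le_mul_of_nonneg_right (rIn_sq_mul_le_weight b ξ) (by positivity)

end Bandlimit

section Resolvent

theorem isCompactOperator_prod {𝕜 E F G : Type*} [NontriviallyNormedField 𝕜]
    [NormedAddCommGroup E] [NormedSpace 𝕜 E] [NormedAddCommGroup F] [NormedSpace 𝕜 F]
    [NormedAddCommGroup G] [NormedSpace 𝕜 G] {P : E →L[𝕜] F} {R : E →L[𝕜] G}
    (hP : IsCompactOperator P) (hR : IsCompactOperator R) : IsCompactOperator (P.prod R) := by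
  have h : P.prod R = (ContinuousLinearMap.inl 𝕜 F G).comp P +
      (ContinuousLinearMap.inr 𝕜 F G).comp R := by
    ext x <;> simp
  rw [h]
  exact (hP.clm_comp (ContinuousLinearMap.inl 𝕜 F G)).add
    (hR.clm_comp (ContinuousLinearMap.inr 𝕜 F G))

variable {σ : Coupling} {V : Perturbation} {c : ℝ} {T : Spinor →L[ℂ] FormDomain}

theorem re_inner_bandlimit_le (hT : IsFormResolvent formIncl (shiftedFormL σ V c) T)
    (hc : 0 < σ.kappa + c) : ∃ C, 0 ≤ C ∧ ∀ (b : ContDiffBump (0 : Plane)) f,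
      (inner ℂ (spinorIncl (bandlimit b (T f))) f).re ≤
        (σ.kappa + c)⁻¹ * ‖f‖ ^ 2 + ‖f‖ * (C * ∑ i, ‖J V.m (bandlimit b (T f) i)‖) := by
  obtain ⟨C, hC0, hC⟩ := V.exists_norm_form_le
  refine ⟨C * (‖J V.m‖ * ‖T‖), by positivity, fun b f => ?_⟩
  set u := T f
  set w := bandlimit b u
  have hform : -(‖f‖ * (C * (‖J V.m‖ * ‖T‖) * ∑ i, ‖J V.m (w i)‖)) ≤ (V.form w u).re := by
    refine le_trans (neg_le_neg ?_) (neg_le_of_abs_le (Complex.abs_re_le_norm _))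
    have hJ : ∀ i, ‖J V.m (u i)‖ ≤ ‖J V.m‖ * (‖T‖ * ‖f‖) := fun i =>
      (J V.m).le_opNorm_of_le ((FormDomain.norm_apply_le u i).trans (T.le_opNorm f))
    calc ‖V.form w u‖ ≤ C * ∑ i, ‖J V.m (w i)‖ * (‖J V.m‖ * (‖T‖ * ‖f‖)) := by
          refine (hC w u).trans ?_
          gcongr with i
          exact hJ i
      _ = _ := by
          rw [← Finset.sum_mul]
          ring
  have hresolvent : (σ.form₀ w u).re + (V.form w u).re +
      c * (inner ℂ (spinorIncl w) (spinorIncl u)).re = (inner ℂ (spinorIncl w) f).re := by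
    have h := congrArg Complex.re (hT f (FormDomain.equiv.symm w))
    rwa [shiftedFormL_apply, shiftedForm, form, Complex.add_re, Complex.add_re,
      Complex.re_ofReal_mul] at h
  have hkappa := kappa_mul_re_inner_bandlimit_le b σ u
  have hw := mul_le_mul_of_nonneg_left (norm_sq_bandlimit_le_re_inner b u) hc.le
  have hamgm : 2 * (inner ℂ (spinorIncl w) f).re ≤
      (σ.kappa + c) * ‖spinorIncl w‖ ^ 2 + (σ.kappa + c)⁻¹ * ‖f‖ ^ 2 := by
    have hcs := (Complex.re_le_norm _).trans (norm_inner_le_norm (𝕜 := ℂ) (spinorIncl w) f)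
    have hsq := mul_nonneg (inv_nonneg.mpr hc.le)
      (sq_nonneg ((σ.kappa + c) * ‖spinorIncl w‖ - ‖f‖))
    have hexpand : (σ.kappa + c)⁻¹ * ((σ.kappa + c) * ‖spinorIncl w‖ - ‖f‖) ^ 2 =
        (σ.kappa + c) * ‖spinorIncl w‖ ^ 2 + (σ.kappa + c)⁻¹ * ‖f‖ ^ 2 -
          2 * (‖spinorIncl w‖ * ‖f‖) := by
      field_simp
      ring
    linarith
  linarith

theorem exists_bandlimit_norm_sub_le (T : Spinor →L[ℂ] FormDomain) {ε : ℝ} (hε : 0 < ε) :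
    ∃ b : ContDiffBump (0 : Plane), ∀ f,
      ‖spinorIncl (T f) - spinorIncl (bandlimit b (T f))‖ ≤ ε * ‖f‖ := by
  have hr : 0 < (‖T‖ + 1) / ε := by positivity
  refine ⟨⟨(‖T‖ + 1) / ε, (‖T‖ + 1) / ε + 1, hr, lt_add_one _⟩, fun f => ?_⟩
  refine le_of_mul_le_mul_left ((rIn_mul_norm_sub_bandlimit_le _ (T f)).trans ?_) hr
  calc ‖T f‖ ≤ (‖T‖ + 1) * ‖f‖ := T.le_of_opNorm_le (le_add_of_nonneg_right zero_le_one) f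
    _ = (‖T‖ + 1) / ε * (ε * ‖f‖) := by field_simp

theorem exists_isCompactOperator_eq_J_bandlimit (V : Perturbation) (b : ContDiffBump (0 : Plane))
    (T : Spinor →L[ℂ] FormDomain) (i : Fin 2) : ∃ K : Spinor →L[ℂ] Lp (α := Plane) ℂ 2 V.m,
      IsCompactOperator K ∧ ∀ f, K f = J V.m (bandlimit b (T f) i) :=
  ⟨((J V.m).comp (smoothing (cutoff b))).comp ((FourierTransform.fourierCLM ℂ L2).comp
      ((PiLp.proj 2 (fun _ : Fin 2 => L2) i).comp (formIncl.comp T))),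
    (V.isCompactOperator_J_smoothing (cutoff b)).comp_clm _, fun _ => rfl⟩

-- Below `κ` only the low frequencies of `T f` count, and on these the perturbation is compact.
theorem isEssUpperBound_resolvent (hT : IsFormResolvent formIncl (shiftedFormL σ V c) T)
    (hc : 0 < σ.kappa + c) :
    IsEssUpperBound (Lp (α := Plane) ℂ 2 V.m × Lp (α := Plane) ℂ 2 V.m) (formIncl.comp T)
      (σ.kappa + c)⁻¹ := by
  intro ε hε
  obtain ⟨C, hC0, hC⟩ := re_inner_bandlimit_le hT hc
  obtain ⟨b, hb⟩ := exists_bandlimit_norm_sub_le T hε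
  choose K hK hKf using exists_isCompactOperator_eq_J_bandlimit V b T
  refine ⟨((2 * C : ℝ) : ℂ) • (K 0).prod (K 1),
    (isCompactOperator_prod (hK 0) (hK 1)).smul ((2 * C : ℝ) : ℂ), fun f => ?_⟩
  have hsplit : (inner ℂ (spinorIncl (T f)) f).re =
      (inner ℂ (spinorIncl (bandlimit b (T f))) f).re +
      (inner ℂ (spinorIncl (T f) - spinorIncl (bandlimit b (T f))) f).re := by
    rw [inner_sub_left, Complex.sub_re, add_sub_cancel]
  have hhigh : (inner ℂ (spinorIncl (T f) - spinorIncl (bandlimit b (T f))) f).re ≤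
      ε * ‖f‖ * ‖f‖ :=
    (Complex.re_le_norm _).trans ((norm_inner_le_norm _ _).trans (by gcongr; exact hb f))
  have hlow : C * ∑ i, ‖J V.m (bandlimit b (T f) i)‖ ≤ 2 * C * ‖(K 0 f, K 1 f)‖ := by
    rw [Fin.sum_univ_two, ← hKf, ← hKf]
    nlinarith [norm_fst_le (K 0 f, K 1 f), norm_snd_le (K 0 f, K 1 f)]
  calc (inner ℂ (spinorIncl (T f)) f).re
    _ ≤ ((σ.kappa + c)⁻¹ * ‖f‖ ^ 2 + ‖f‖ * (2 * C * ‖(K 0 f, K 1 f)‖)) + ε * ‖f‖ * ‖f‖ := by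
        rw [hsplit]
        exact add_le_add ((hC b f).trans (by gcongr)) hhigh
    _ = ((σ.kappa + c)⁻¹ + ε) * ‖f‖ ^ 2 + ‖f‖ * ‖((2 * C : ℝ) : ℂ) • (K 0 f, K 1 f)‖ := by
        rw [norm_smul, Complex.norm_real, Real.norm_of_nonneg (by positivity)]
        ring

theorem mem_eigenspace_hamiltonian_iff {E : ℝ} {f : Spinor} :
    f ∈ eigenspace (hamiltonian σ V) E ↔ ∃ u : FormDomain, formIncl u = f ∧
      ∀ v : FormDomain, form σ V v u = E * inner ℂ (formIncl v) f := by
  change (f, (E : ℂ) • f) ∈ (hamiltonian σ V).graph ↔ _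
  rw [mem_graph_hamiltonian_iff]
  simp only [inner_smul_right]
  exact ⟨fun ⟨u, hu, h⟩ => ⟨FormDomain.equiv.symm u, hu, fun v => h v⟩,
    fun ⟨u, hu, h⟩ => ⟨u, hu, fun v => h (FormDomain.equiv.symm v)⟩⟩

theorem eigenspace_resolvent_le (hT : IsFormResolvent formIncl (shiftedFormL σ V c) T) {l : ℝ}
    (hl : l ≠ 0) :
    Module.End.eigenspace ((formIncl.comp T : Spinor →L[ℂ] Spinor) : Spinor →ₗ[ℂ] Spinor) l ≤
      eigenspace (hamiltonian σ V) (l⁻¹ - c) := by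
  intro f hf
  have hf' : formIncl (T f) = (l : ℂ) • f := Module.End.mem_eigenspace_iff.mp hf
  have hl' : (l : ℂ) ≠ 0 := Complex.ofReal_ne_zero.mpr hl
  refine mem_eigenspace_hamiltonian_iff.mpr ⟨(l : ℂ)⁻¹ • T f, ?_, fun v => ?_⟩
  · rw [map_smul, hf', smul_smul, inv_mul_cancel₀ hl', one_smul]
  · have hTv := hT f v
    rw [shiftedFormL_apply, shiftedForm, ← formIncl_apply, ← formIncl_apply, hf',
      inner_smul_right] at hTv
    have hsmul : form σ V v ((l : ℂ)⁻¹ • (T f : Fin 2 → H1)) = (l : ℂ)⁻¹ * form σ V v (T f) := by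
      rw [form, σ.form₀_smul, V.form_smul, form, mul_add]
    rw [map_smul, hsmul, eq_sub_of_add_eq hTv]
    push_cast
    field_simp

theorem shiftedFormL_eq_of_eigen {E : ℝ} {u v : FormDomain}
    (h : form σ V v u = E * inner ℂ (formIncl v) (formIncl u)) :
    shiftedFormL σ V c v u = (E + c : ℝ) * inner ℂ (formIncl v) (formIncl u) := by
  rw [shiftedFormL_apply, shiftedForm, h, ← formIncl_apply, ← formIncl_apply]
  push_cast
  ring

theorem add_pos_of_eigenspace_hamiltonian_ne_bot {δ E : ℝ} (hδ : 0 < δ)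
    (hB : ∀ u, δ * ‖u‖ ^ 2 ≤ (shiftedFormL σ V c u u).re)
    (hE : eigenspace (hamiltonian σ V) E ≠ ⊥) : 0 < E + c := by
  obtain ⟨f, hf, hf0⟩ := Submodule.exists_mem_ne_zero_of_ne_bot hE
  obtain ⟨u, rfl, hu⟩ := mem_eigenspace_hamiltonian_iff.mp hf
  have hu0 : 0 < ‖u‖ := norm_pos_iff.mpr (ne_zero_of_map hf0)
  have hre : (inner ℂ (formIncl u) (formIncl u)).re = ‖formIncl u‖ ^ 2 :=
    inner_self_eq_norm_sq (𝕜 := ℂ) (formIncl u)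
  have hpos : 0 < (shiftedFormL σ V c u u).re := lt_of_lt_of_le (by positivity) (hB u)
  rw [shiftedFormL_eq_of_eigen (hu u), Complex.re_ofReal_mul, hre] at hpos
  exact pos_of_mul_pos_left hpos (sq_nonneg _)

theorem eigenspace_hamiltonian_le (hT : IsFormResolvent formIncl (shiftedFormL σ V c) T)
    {δ E : ℝ} (hδ : 0 < δ) (hB : ∀ u, δ * ‖u‖ ^ 2 ≤ (shiftedFormL σ V c u u).re)
    (hE : E + c ≠ 0) : eigenspace (hamiltonian σ V) E ≤ Module.End.eigenspace
      ((formIncl.comp T : Spinor →L[ℂ] Spinor) : Spinor →ₗ[ℂ] Spinor) ((E + c)⁻¹ : ℝ) := by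
  intro f hf
  obtain ⟨u, rfl, hu⟩ := mem_eigenspace_hamiltonian_iff.mp hf
  have hE' : ((E + c : ℝ) : ℂ) ≠ 0 := Complex.ofReal_ne_zero.mpr hE
  have huT : u = T (((E + c : ℝ) : ℂ) • formIncl u) := hT.eq_apply hδ hB fun v => by
    rw [shiftedFormL_eq_of_eigen (hu v), inner_smul_right]
  rw [map_smul] at huT
  rw [Module.End.mem_eigenspace_iff, Complex.ofReal_inv, eq_inv_smul_iff₀ hE']
  exact (map_smul formIncl _ _).symm.trans (congrArg formIncl huT.symm)

theorem exists_resolvent (h : IsRelativelyBounded σ V) : ∃ (δ c : ℝ) (T : Spinor →L[ℂ] FormDomain),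
    0 < δ ∧ 0 < σ.kappa + c ∧ (∀ u, δ * ‖u‖ ^ 2 ≤ (shiftedFormL σ V c u u).re) ∧
      IsFormResolvent formIncl (shiftedFormL σ V c) T := by
  obtain ⟨δ, c, hδ, hc, hB⟩ := h.exists_coercive
  obtain ⟨T, hT⟩ := exists_isFormResolvent formIncl (B := shiftedFormL σ V c)
    (fun u v => shiftedForm_symm σ V c u v) hδ hB
  exact ⟨δ, c, T, hδ, hc, hB, hT⟩

theorem finiteDimensional_eigenspace_hamiltonian (h : IsRelativelyBounded σ V) {E : ℝ}
    (hE : E < σ.kappa) : FiniteDimensional ℂ (eigenspace (hamiltonian σ V) E) := by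
  by_cases hbot : eigenspace (hamiltonian σ V) E = ⊥
  · rw [hbot]
    infer_instance
  obtain ⟨δ, c, T, hδ, hc, hB, hT⟩ := exists_resolvent h
  have hpos := add_pos_of_eigenspace_hamiltonian_ne_bot hδ hB hbot
  have := (isEssUpperBound_resolvent hT hc).finiteDimensional_eigenspace (l := (E + c)⁻¹)
    (inv_strictAnti₀ hpos (by linarith))
  exact Submodule.finiteDimensional_of_le (eigenspace_hamiltonian_le hT hδ hB hpos.ne')

theorem le_rank_iSup_eigenspace_hamiltonian (h : IsRelativelyBounded σ V) {N : ℕ}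
    (U : (Fin N → ℂ) →ₗ[ℂ] FormDomain)
    (hU : ∀ a, a ≠ 0 → (form σ V (U a) (U a)).re < σ.kappa * ‖formIncl (U a)‖ ^ 2) :
    (N : Cardinal) ≤ Module.rank ℂ
      (⨆ E ∈ Set.Iio σ.kappa, eigenspace (hamiltonian σ V) E : Submodule ℂ Spinor) := by
  obtain ⟨δ, c, T, hδ, hc, hB, hT⟩ := exists_resolvent h
  have hsym : ∀ u v, shiftedFormL σ V c u v = star (shiftedFormL σ V c v u) := fun u v =>
    shiftedForm_symm σ V c u v
  refine ((isEssUpperBound_resolvent hT hc).le_rank_iSup_eigenspace (hT.isSymmetric hsym)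
    ((formIncl : FormDomain →ₗ[ℂ] Spinor).comp U) fun a ha => ?_).trans ?_
  · refine hT.lt_re_inner hsym (fun u => le_trans (by positivity) (hB u)) hc (u := U a) ?_
    rw [RCLike.re_to_complex, shiftedFormL_apply, re_shiftedForm_self, ← Complex.add_re,
      ← formIncl_apply, add_mul]
    exact add_lt_add_left (hU a ha) _
  · refine Submodule.rank_mono (iSup₂_le fun l hl => ?_)
    have hl0 : 0 < l := (inv_pos.mpr hc).trans hl
    refine (eigenspace_resolvent_le hT hl0.ne').trans
      (le_iSup₂_of_le (f := fun E _ => eigenspace (hamiltonian σ V) E) (l⁻¹ - c) ?_ le_rfl)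
    exact sub_lt_iff_lt_add.mpr (inv_lt_of_inv_lt₀ hc hl)

end Resolvent

section TrigonometricPolynomials

theorem linearIndependent_fourierChar_mul {ι : Type*} {s : ι → ℝ} (hs : Function.Injective s) :
    LinearIndependent ℂ fun (k : ι) (t : ℝ) => (𝐞 (s k * t) : ℂ) := by
  let χ : ℝ → Multiplicative ℝ →* ℂ := fun r =>
    Circle.coeHom.comp (𝐞.compAddMonoidHom (AddMonoidHom.mulLeft r)).toMonoidHom
  have hχ : Function.Injective χ := fun r r' h => by
    by_contra hne
    have hr : r - r' ≠ 0 := sub_ne_zero.mpr hne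
    have hval : 𝐞 (r * (2 * (r - r'))⁻¹) = 𝐞 (r' * (2 * (r - r'))⁻¹) :=
      Circle.ext (DFunLike.congr_fun h (Multiplicative.ofAdd (2 * (r - r'))⁻¹))
    have hhalf : 𝐞 (1 / 2) = 1 := by
      rw [← div_eq_one.mpr hval, ← AddChar.map_sub_eq_div]
      congr 1
      field_simp
    have hexp := congrArg ((↑) : Circle → ℂ) hhalf
    rw [Real.fourierChar_apply, mul_one_div, mul_div_cancel_left₀ _ two_ne_zero,
      Complex.exp_pi_mul_I] at hexp
    norm_num at hexp
  exact (linearIndependent_monoidHom (Multiplicative ℝ) ℂ).comp (χ ∘ s) (hχ.comp hs)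

theorem ae_sum_mul_fourierChar_mul_ne_zero {ι : Type*} [Fintype ι] {s : ι → ℝ}
    (hs : Function.Injective s) {b : ι → ℂ} (hb : b ≠ 0) :
    ∀ᵐ t : ℝ, ∑ k, b k * (𝐞 (s k * t) : ℂ) ≠ 0 := by
  obtain ⟨t₀, ht₀⟩ : ∃ t, ∑ k, b k * (𝐞 (s k * t) : ℂ) ≠ 0 := by
    by_contra! hzero
    have hli := linearIndependent_fourierChar_mul hs
    refine hb (funext (Fintype.linearIndependent_iff.mp hli b ?_))
    ext t
    exact (Finset.sum_apply t _ _).trans (hzero t)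
  have hanalytic : AnalyticOnNhd ℝ (fun t => ∑ k, b k * (𝐞 (s k * t) : ℂ)) Set.univ := by
    intro t _
    simp only [Real.fourierChar_apply]
    refine Finset.analyticAt_fun_sum _ fun k _ => analyticAt_const.mul ?_
    exact analyticAt_cexp.restrictScalars.comp (((Complex.ofRealCLM.analyticAt _).comp
      (analyticAt_const.mul (analyticAt_const.mul analyticAt_id))).mul analyticAt_const)
  have hae := ae_restrict_le_codiscreteWithin (μ := (volume : Measure ℝ)) MeasurableSet.univ
    (hanalytic.preimage_zero_mem_codiscrete ht₀)
  rwa [Measure.restrict_univ] at hae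

-- For almost every line in a direction that separates the frequencies, the restriction is a
-- nontrivial trigonometric polynomial in one variable.
theorem ae_sum_mul_planeWave_ne_zero {ι : Type*} [Fintype ι] {p : ι → Plane}
    (hp : Function.Injective p) {a : ι → ℂ} (ha : a ≠ 0) :
    ∀ᵐ x, ∑ k, a k * planeWave x (p k) ≠ 0 := by
  obtain ⟨d, hd⟩ := Module.Dual.exists_forall_ne_zero_of_forall_exists
    (fun i : {i : ι × ι // i.1 ≠ i.2} => innerₗ Plane (p i.1.1 - p i.1.2)) (by
      rintro ⟨⟨j, k⟩, hjk⟩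
      exact ⟨p j - p k, inner_self_ne_zero.mpr (sub_ne_zero.mpr (hp.ne hjk))⟩)
  have hsep : Function.Injective fun k => inner ℝ (p k) d := by
    intro j k hjk
    by_contra hne
    have h : inner ℝ (p j - p k) d ≠ 0 := hd ⟨(j, k), hne⟩
    rw [inner_sub_left] at h
    exact h (sub_eq_zero.mpr hjk)
  have hmeas : MeasurableSet {x | ∑ k, a k * planeWave x (p k) ≠ 0} :=
    (isOpen_ne_fun (continuous_finsetSum _ fun k _ => continuous_const.mul
      (continuous_planeWave.comp (Continuous.prodMk_left (p k)))) continuous_const).measurableSet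
  refine ae_mem_of_ae_add_linearMap_mem (LinearMap.toSpanSingleton ℝ Plane d) volume volume hmeas
    fun y => ?_
  have hy : (fun k => a k * planeWave y (p k)) ≠ 0 := by
    obtain ⟨k, hk⟩ := Function.ne_iff.mp ha
    exact Function.ne_iff.mpr ⟨k, mul_ne_zero hk (norm_pos_iff.mp (by simp [norm_planeWave]))⟩
  filter_upwards [ae_sum_mul_fourierChar_mul_ne_zero hsep hy] with t ht
  convert ht using 3 with k
  rw [LinearMap.toSpanSingleton_apply, planeWave, planeWave, inner_add_right, inner_smul_right,
    AddChar.map_add_eq_mul, Circle.coe_mul, mul_comm t, mul_assoc]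

end TrigonometricPolynomials

namespace Perturbation

variable {V : Perturbation}

theorem integrable_h (V : Perturbation) : Integrable V.h V.m := by
  obtain ⟨C, hC⟩ := V.bounded
  exact Integrable.of_bound V.measurable.aestronglyMeasurable C (Eventually.of_forall hC)

theorem ae_h_nonpos (hneg : V.nu ≤ 0) : ∀ᵐ x ∂V.m, V.h x ≤ 0 := by
  have h : 0 ≤ᵐ[V.m] fun x => -V.h x := by
    refine ae_nonneg_of_forall_setIntegral_nonneg V.integrable_h.neg fun s hs _ => ?_
    have hle : V.nu s ≤ 0 := hneg s hs
    rw [nu, withDensityᵥ_apply V.integrable_h hs] at hle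
    rwa [integral_neg, neg_nonneg]
  exact h.mono fun x => neg_nonneg.mp

theorem not_ae_eq_zero_of_notMem (hsupp : 0 < volume V.supp) {Z : Set Plane} (hZ : IsClosed Z)
    (hZ0 : volume Z = 0) : ¬ ∀ᵐ x ∂V.m, x ∉ Z → V.h x = 0 := by
  intro hzero
  have hnu : V.nu = (V.m.restrict Z).withDensityᵥ V.h := by
    ext s hs
    rw [nu, withDensityᵥ_apply V.integrable_h hs, withDensityᵥ_apply V.integrable_h.restrict hs,
      Measure.restrict_restrict hs]
    refine setIntegral_eq_of_subset_of_ae_sdiff_eq_zero hs.nullMeasurableSet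
      Set.inter_subset_left ?_
    filter_upwards [hzero] with x hx hxs
    exact hx fun hxZ => hxs.2 ⟨hxs.1, hxZ⟩
  have hac : V.nu.totalVariation ≪ V.m.restrict Z := by
    have h := Measure.withDensityᵥ_absolutelyContinuous (V.m.restrict Z) V.h
    rwa [← hnu, SignedMeasure.absolutelyContinuous_ennreal_iff,
      VectorMeasure.ennrealToMeasure_toENNRealVectorMeasure] at h
  have hcompl : V.nu.totalVariation Zᶜ = 0 := hac <| by
    rw [Measure.restrict_apply hZ.measurableSet.compl, Set.compl_inter_self, measure_empty]
  exact hsupp.ne' (measure_mono_null (Measure.support_subset_of_isClosed hZ hcompl) hZ0)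

end Perturbation

section LogBump

/-- The weight `‖ξ‖⁻²` restricted to the annulus `r ≤ ‖ξ‖ < ε`. -/
def annulusWeight (r ε : ℝ) (ξ : Plane) : ℝ := (Set.Ico r ε).indicator (fun y => (y ^ 2)⁻¹) ‖ξ‖

theorem measurable_annulusWeight (r ε : ℝ) : Measurable (annulusWeight r ε) := by
  have h : Measurable ((Set.Ico r ε).indicator fun y : ℝ => (y ^ 2)⁻¹) :=
    Measurable.indicator (by fun_prop) measurableSet_Ico
  exact h.comp measurable_norm

theorem annulusWeight_nonneg (r ε : ℝ) (ξ : Plane) : 0 ≤ annulusWeight r ε ξ :=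
  Set.indicator_nonneg (fun _ _ => by positivity) _

theorem annulusWeight_le {r : ℝ} (hr : 0 < r) (ε : ℝ) (ξ : Plane) :
    annulusWeight r ε ξ ≤ (r ^ 2)⁻¹ :=
  Set.indicator_apply_le' (fun hξ => inv_anti₀ (by positivity) (pow_le_pow_left₀ hr.le hξ.1 2))
    fun _ => by positivity

theorem annulusWeight_eq_zero (r : ℝ) {ε : ℝ} {ξ : Plane} (hξ : ε ≤ ‖ξ‖) :
    annulusWeight r ε ξ = 0 :=
  Set.indicator_of_notMem (fun h => h.2.not_ge hξ) _

theorem norm_sq_mul_annulusWeight_sq {r : ℝ} (hr : 0 < r) (ε : ℝ) (ξ : Plane) :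
    ‖ξ‖ ^ 2 * annulusWeight r ε ξ ^ 2 = annulusWeight r ε ξ := by
  by_cases hξ : ‖ξ‖ ∈ Set.Ico r ε
  · have hne : ‖ξ‖ ≠ 0 := (hr.trans_le hξ.1).ne'
    rw [annulusWeight, Set.indicator_of_mem hξ]
    field_simp
  · rw [annulusWeight, Set.indicator_of_notMem hξ]
    ring

theorem integral_annulusWeight {r ε : ℝ} (hr : 0 < r) (hrε : r ≤ ε) :
    ∫ ξ, annulusWeight r ε ξ =
      2 * volume.real (Metric.ball (0 : Plane) 1) * Real.log (ε / r) := by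
  have hradial : ∫ y in Set.Ioi (0 : ℝ), y ^ (2 - 1) • (Set.Ico r ε).indicator
      (fun y => (y ^ 2)⁻¹) y = Real.log (ε / r) := by
    have hinv : (fun y : ℝ => y ^ (2 - 1) • (Set.Ico r ε).indicator (fun y => (y ^ 2)⁻¹) y) =
        (Set.Ico r ε).indicator fun y => y⁻¹ := by
      funext y
      by_cases hy : y ∈ Set.Ico r ε
      · have hne : y ≠ 0 := (hr.trans_le hy.1).ne'
        rw [Set.indicator_of_mem hy, Set.indicator_of_mem hy, smul_eq_mul, pow_one]
        field_simp
      · rw [Set.indicator_of_notMem hy, Set.indicator_of_notMem hy, smul_zero]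
    have hsub : Set.Ioi (0 : ℝ) ∩ Set.Ico r ε = Set.Ico r ε :=
      Set.inter_eq_right.mpr fun y hy => hr.trans_le hy.1
    rw [hinv, setIntegral_indicator measurableSet_Ico, hsub, integral_Ico_eq_integral_Ioc,
      ← intervalIntegral.integral_of_le hrε, integral_inv_of_pos hr (hr.trans_le hrε)]
  simp only [annulusWeight]
  rw [integral_fun_norm_addHaar, finrank_euclideanSpace_fin, hradial, nsmul_eq_mul, smul_eq_mul,
    ← mul_assoc]
  rfl

/-- An approximate identity at scale `ε` whose square has small second moment. In two dimensions
such functions exist because `∫ ‖ξ‖⁻² dξ` diverges logarithmically at the origin. -/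
structure IsLogBump (ε : ℝ) (φ : Plane → ℝ) : Prop where
  measurable : Measurable φ
  nonneg : ∀ ξ, 0 ≤ φ ξ
  bounded : ∃ C, ∀ ξ, φ ξ ≤ C
  eq_zero : ∀ ξ, ε ≤ ‖ξ‖ → φ ξ = 0
  integral_eq : ∫ ξ, φ ξ = 1
  integral_sq_le : ∫ ξ, ‖ξ‖ ^ 2 * φ ξ ^ 2 ≤ ε

theorem exists_integral_annulusWeight_eq {ε : ℝ} (hε : 0 < ε) :
    ∃ r, 0 < r ∧ ∫ ξ, annulusWeight r ε ξ = ε⁻¹ := by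
  set b : ℝ := volume.real (Metric.ball (0 : Plane) 1) with hb
  have hb0 : 0 < b := by
    rw [hb, measureReal_def]
    exact ENNReal.toReal_pos (Metric.measure_ball_pos _ _ one_pos).ne' measure_ball_lt_top.ne
  have hexp : Real.exp (-(2 * b * ε)⁻¹) ≤ 1 :=
    Real.exp_le_one_iff.mpr (neg_nonpos.mpr (by positivity))
  refine ⟨ε * Real.exp (-(2 * b * ε)⁻¹), by positivity, ?_⟩
  rw [integral_annulusWeight (by positivity) (mul_le_of_le_one_right hε.le hexp), ← hb,
    div_mul_cancel_left₀ hε.ne', ← Real.exp_neg, neg_neg, Real.log_exp]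
  field_simp

theorem exists_isLogBump {ε : ℝ} (hε : 0 < ε) : ∃ φ, IsLogBump ε φ := by
  obtain ⟨r, hr, hint⟩ := exists_integral_annulusWeight_eq hε
  refine ⟨fun ξ => ε * annulusWeight r ε ξ, (measurable_annulusWeight r ε).const_mul ε,
    fun ξ => mul_nonneg hε.le (annulusWeight_nonneg r ε ξ),
    ⟨ε * (r ^ 2)⁻¹, fun ξ => mul_le_mul_of_nonneg_left (annulusWeight_le hr ε ξ) hε.le⟩,
    fun ξ hξ => by rw [annulusWeight_eq_zero r hξ, mul_zero], ?_, le_of_eq ?_⟩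
  · rw [integral_const_mul, hint, mul_inv_cancel₀ hε.ne']
  · simp only [mul_pow, mul_left_comm _ (ε ^ 2), norm_sq_mul_annulusWeight_sq hr]
    rw [integral_const_mul, hint, sq, mul_assoc, mul_inv_cancel₀ hε.ne', mul_one]

namespace IsLogBump

variable {ε : ℝ} {φ : Plane → ℝ}

theorem integrable (h : IsLogBump ε φ) : Integrable φ :=
  not_imp_comm.mp integral_undef (h.integral_eq.trans_ne one_ne_zero)

theorem integrable_norm_sq_mul_sq (h : IsLogBump ε φ) :
    Integrable fun ξ => ‖ξ‖ ^ 2 * φ ξ ^ 2 := by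
  obtain ⟨C, hC⟩ := h.bounded
  refine (h.integrable.const_mul (ε ^ 2 * C)).mono'
    ((measurable_norm.pow_const 2).mul (h.measurable.pow_const 2)).aestronglyMeasurable
    (Eventually.of_forall fun ξ => ?_)
  have hφ := h.nonneg ξ
  rw [Real.norm_of_nonneg (by positivity)]
  by_cases hξ : ε ≤ ‖ξ‖
  · rw [h.eq_zero ξ hξ]
    simp
  · calc ‖ξ‖ ^ 2 * φ ξ ^ 2 = ‖ξ‖ ^ 2 * (φ ξ * φ ξ) := by rw [sq (φ ξ)]
      _ ≤ ε ^ 2 * (C * φ ξ) := by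
          gcongr
          · exact (not_le.mp hξ).le
          · exact hC ξ
      _ = ε ^ 2 * C * φ ξ := (mul_assoc _ _ _).symm

theorem norm_integral_le (h : IsLogBump ε φ) (p : Plane) {G : Plane → ℂ} {C : ℝ}
    (hG : ∀ ξ, ‖ξ - p‖ < ε → ‖G ξ‖ ≤ C) : ‖∫ ξ, (φ (ξ - p) : ℂ) * G ξ‖ ≤ C := by
  have hint : Integrable fun ξ => φ (ξ - p) * C := (h.integrable.comp_sub_right p).mul_const C
  calc ‖∫ ξ, (φ (ξ - p) : ℂ) * G ξ‖ ≤ ∫ ξ, φ (ξ - p) * C := by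
        refine norm_integral_le_of_norm_le hint (Eventually.of_forall fun ξ => ?_)
        rw [norm_mul, Complex.norm_real, Real.norm_of_nonneg (h.nonneg _)]
        by_cases hξ : ‖ξ - p‖ < ε
        · exact mul_le_mul_of_nonneg_left (hG ξ hξ) (h.nonneg _)
        · rw [h.eq_zero _ (not_lt.mp hξ), zero_mul, zero_mul]
    _ = C := by
        rw [integral_mul_const, integral_sub_right_eq_self φ p, h.integral_eq, one_mul]

theorem tendsto_integral {φ : ℕ → Plane → ℝ} {ε : ℕ → ℝ} (h : ∀ n, IsLogBump (ε n) (φ n))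
    (hε : Tendsto ε atTop (𝓝 0)) {p : Plane} {G : Plane → ℂ} (hGm : Measurable G) {C : ℝ}
    (hGb : ∀ ξ, ‖G ξ‖ ≤ C) (hG : ContinuousAt G p) :
    Tendsto (fun n => ∫ ξ, (φ n (ξ - p) : ℂ) * G ξ) atTop (𝓝 (G p)) := by
  have hφ : ∀ n, Integrable fun ξ => (φ n (ξ - p) : ℂ) := fun n =>
    ((h n).integrable.comp_sub_right p).ofReal
  have hmean : ∀ n, ∫ ξ, (φ n (ξ - p) : ℂ) * G p = G p := fun n => by
    rw [integral_mul_const, integral_complex_ofReal, integral_sub_right_eq_self (φ n) p,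
      (h n).integral_eq, Complex.ofReal_one, one_mul]
  have hsub : ∀ n, (∫ ξ, (φ n (ξ - p) : ℂ) * G ξ) - G p =
      ∫ ξ, (φ n (ξ - p) : ℂ) * (G ξ - G p) := fun n => by
    simp only [mul_sub]
    rw [integral_sub ((hφ n).mul_bdd hGm.aestronglyMeasurable (Eventually.of_forall hGb))
      ((hφ n).mul_const _), hmean]
  refine Metric.tendsto_nhds.mpr fun η hη => ?_
  obtain ⟨δ, hδ, hGδ⟩ := Metric.continuousAt_iff.mp hG (η / 2) (half_pos hη)
  filter_upwards [hε.eventually (gt_mem_nhds hδ)] with n hn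
  rw [dist_eq_norm, hsub]
  refine ((h n).norm_integral_le p fun ξ hξ => ?_).trans_lt (half_lt_self hη)
  rw [← dist_eq_norm] at hξ ⊢
  exact (hGδ (hξ.trans hn)).le

end IsLogBump

end LogBump

section LocalEigenvector

theorem isBigO_sub_norm_sub_sq_of_fderiv_eq_zero {E F : Type*} [NormedAddCommGroup E]
    [NormedSpace ℝ E] [NormedAddCommGroup F] [NormedSpace ℝ F] {f : E → F} {p : E}
    (hf : ContDiffAt ℝ 2 f p) (hp : fderiv ℝ f p = 0) :
    (fun q => f q - f p) =O[𝓝 p] fun q => ‖q - p‖ ^ 2 := by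
  have hderiv : ContDiffAt ℝ 1 (fderiv ℝ f) p := hf.fderiv_right (by norm_num)
  obtain ⟨C, hC0, hC⟩ := (hderiv.differentiableAt one_ne_zero).isBigO_sub.exists_nonneg
  have hdiff : ∀ᶠ q in 𝓝 p, DifferentiableAt ℝ f q :=
    (hf.eventually (by simp)).mono fun q hq => hq.differentiableAt two_ne_zero
  obtain ⟨δ, hδ, hball⟩ := Metric.eventually_nhds_iff_ball.mp (hC.bound.and hdiff)
  refine Asymptotics.IsBigO.of_bound C ?_
  filter_upwards [Metric.ball_mem_nhds p hδ] with q hq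
  have hsub : Metric.closedBall p ‖q - p‖ ⊆ Metric.ball p δ :=
    Metric.closedBall_subset_ball (mem_ball_iff_norm.mp hq)
  have hmean := (convex_closedBall p ‖q - p‖).norm_image_sub_le_of_norm_fderiv_le (𝕜 := ℝ)
    (C := C * ‖q - p‖) (fun x hx => (hball x (hsub hx)).2) (fun x hx => by
      have h := (hball x (hsub hx)).1
      rw [hp, sub_zero] at h
      exact h.trans (mul_le_mul_of_nonneg_left (mem_closedBall_iff_norm.mp hx) hC0))
    (Metric.mem_closedBall_self (norm_nonneg _)) (mem_closedBall_iff_norm.mpr le_rfl)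
  rwa [norm_pow, norm_norm, sq, ← mul_assoc]

namespace Coupling

variable (σ : Coupling)

/-- The sesquilinear form of the matrix `Ĥ₀(p) - κ`. -/
def quadSub (p : Plane) (z w : Fin 2 → ℂ) : ℂ := σ.quad p z w - σ.kappa * (star z ⬝ᵥ w)

theorem quadSub_zero_left (p : Plane) (w : Fin 2 → ℂ) : σ.quadSub p 0 w = 0 := by
  simp [quadSub, quad]

theorem quadSub_zero_right (p : Plane) (z : Fin 2 → ℂ) : σ.quadSub p z 0 = 0 := by
  simp [quadSub, quad]

theorem quadSub_ofReal_smul (t : ℝ) (p : Plane) (z : Fin 2 → ℂ) :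
    σ.quadSub p ((t : ℂ) • z) ((t : ℂ) • z) = ((t ^ 2 : ℝ) : ℂ) * σ.quadSub p z z := by
  simp only [quadSub, quad, star_smul, Matrix.mulVec_smul, smul_dotProduct, dotProduct_smul,
    Complex.star_def, Complex.conj_ofReal, smul_eq_mul]
  push_cast
  ring

/-- A bounded measurable field of vectors which near `p` is an eigenvector field of `Ĥ₀` for the
eigenvalue `κ`, up to an energy error of second order. -/
structure IsLocalEigenvector (p : Plane) (v : Plane → Fin 2 → ℂ) : Prop where
  measurable : Measurable v
  norm_le_one : ∀ q, ‖v q‖ ≤ 1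
  continuousAt : ContinuousAt v p
  apply_ne_zero : v p ≠ 0
  isBigO : (fun q => σ.quadSub q (v q) (v q)) =O[𝓝 p] fun q => ‖q - p‖ ^ 2

/-- The eigenvector field `(1, -Ā/|A|)` of `Ĥ₀` for the lower eigenvalue; where `A` vanishes it is
`(1, 0)`. -/
def lowerEigenvector (q : Plane) : Fin 2 → ℂ := ![1, -(star (σ.A q) / (‖σ.A q‖ : ℂ))]

theorem measurable_lowerEigenvector : Measurable σ.lowerEigenvector := by
  have hA : Measurable σ.A := σ.continuous.measurable
  refine measurable_pi_iff.mpr (Fin.forall_fin_two.mpr ⟨measurable_const, ?_⟩)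
  exact ((continuous_star.measurable.comp hA).div (Complex.measurable_ofReal.comp hA.norm)).neg

theorem norm_lowerEigenvector_le_one (q : Plane) : ‖σ.lowerEigenvector q‖ ≤ 1 := by
  refine (pi_norm_le_iff_of_nonneg zero_le_one).mpr (Fin.forall_fin_two.mpr ⟨norm_one.le, ?_⟩)
  change ‖-(star (σ.A q) / (‖σ.A q‖ : ℂ))‖ ≤ 1
  rw [norm_neg, norm_div, norm_star, Complex.norm_real, norm_norm]
  exact div_self_le_one _

theorem continuousAt_lowerEigenvector {p : Plane} (hp : σ.A p ≠ 0) :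
    ContinuousAt σ.lowerEigenvector p := by
  refine continuousAt_pi.mpr (Fin.forall_fin_two.mpr ⟨continuousAt_const, ?_⟩)
  exact ((continuous_star.comp σ.continuous).continuousAt.div
    (Complex.continuous_ofReal.comp σ.continuous.norm).continuousAt
    (Complex.ofReal_ne_zero.mpr (norm_ne_zero_iff.mpr hp))).neg

theorem quadSub_lowerEigenvector {q : Plane} (hq : σ.A q ≠ 0) :
    σ.quadSub q (σ.lowerEigenvector q) (σ.lowerEigenvector q) =
      ((2 * (σ.lambdaMinus q - σ.kappa) : ℝ) : ℂ) := by
  have hne : ((‖σ.A q‖ : ℝ) : ℂ) ≠ 0 := Complex.ofReal_ne_zero.mpr (norm_ne_zero_iff.mpr hq)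
  have hmul : σ.A q * (starRingEnd ℂ) (σ.A q) = ((‖σ.A q‖ : ℝ) : ℂ) ^ 2 := Complex.mul_conj' _
  have hstar : star (σ.lowerEigenvector q 1) = -(σ.A q / (‖σ.A q‖ : ℂ)) := by
    change star (-(star (σ.A q) / (‖σ.A q‖ : ℂ))) = _
    rw [star_neg, star_div₀, star_star, Complex.star_def, Complex.conj_ofReal]
  have hone : σ.lowerEigenvector q 1 = -((starRingEnd ℂ) (σ.A q) / (‖σ.A q‖ : ℂ)) := rfl
  have hzero : σ.lowerEigenvector q 0 = 1 := rfl
  rw [quadSub, quad_eq, lambdaMinus, dotProduct, Fin.sum_univ_two, Pi.star_apply, Pi.star_apply,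
    hstar, hone, hzero, star_one, Complex.star_def]
  push_cast
  field_simp
  linear_combination (-2 * ((‖σ.A q‖ : ℝ) : ℂ) + ((‖q‖ : ℝ) : ℂ) ^ 2 - σ.kappa) * hmul

variable {σ}

theorem isLocalEigenvector_lowerEigenvector {p : Plane} (hp : p ∈ σ.S) (hA : σ.A p ≠ 0)
    (hc : ContDiffAt ℝ 2 (fun q => ‖σ.A q‖) p) :
    σ.IsLocalEigenvector p σ.lowerEigenvector where
  measurable := σ.measurable_lowerEigenvector
  norm_le_one := σ.norm_lowerEigenvector_le_one
  continuousAt := σ.continuousAt_lowerEigenvector hA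
  apply_ne_zero := fun h => one_ne_zero (congrFun h 0)
  isBigO := by
    have hp : σ.lambdaMinus p = σ.kappa := hp
    have hmin : IsLocalMin σ.lambdaMinus p :=
      Eventually.of_forall fun q => hp.trans_le (σ.kappa_le_lambdaMinus q)
    have hO : (fun q => σ.lambdaMinus q - σ.lambdaMinus p) =O[𝓝 p] fun q => ‖q - p‖ ^ 2 :=
      isBigO_sub_norm_sub_sq_of_fderiv_eq_zero ((contDiff_norm_sq ℝ).contDiffAt.sub hc)
        hmin.fderiv_eq_zero
    rw [hp] at hO
    have hquad : ∀ᶠ q in 𝓝 p, σ.quadSub q (σ.lowerEigenvector q) (σ.lowerEigenvector q) =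
        ((2 * (σ.lambdaMinus q - σ.kappa) : ℝ) : ℂ) :=
      (σ.continuous.continuousAt.eventually_ne hA).mono fun q hq => σ.quadSub_lowerEigenvector hq
    refine Asymptotics.IsBigO.congr' (Asymptotics.isBigO_norm_left.mp ?_)
      (hquad.mono fun q hq => hq.symm) EventuallyEq.rfl
    simp only [Complex.norm_real]
    exact (hO.const_mul_left 2).norm_left

theorem eq_zero_of_mem_S_of_A_eq_zero {p : Plane} (hp : p ∈ σ.S) (hA : σ.A p = 0) : p = 0 := by
  have hzero : σ.lambdaMinus p ≤ σ.lambdaMinus 0 :=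
    (show σ.lambdaMinus p = σ.kappa from hp).trans_le (σ.kappa_le_lambdaMinus 0)
  rw [lambdaMinus, lambdaMinus, hA, norm_zero, norm_zero] at hzero
  exact norm_eq_zero.mp (by nlinarith [norm_nonneg (σ.A 0), norm_nonneg p])

theorem isLocalEigenvector_const {p : Plane} (hp : p ∈ σ.S) (hA : σ.A p = 0) :
    σ.IsLocalEigenvector p fun _ => ![1, 0] where
  measurable := measurable_const
  norm_le_one _ := (pi_norm_le_iff_of_nonneg zero_le_one).mpr
    (Fin.forall_fin_two.mpr ⟨norm_one.le, norm_zero.trans_le zero_le_one⟩)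
  continuousAt := continuousAt_const
  apply_ne_zero := fun h => one_ne_zero (congrFun h 0)
  isBigO := by
    obtain rfl := eq_zero_of_mem_S_of_A_eq_zero hp hA
    have hκ : σ.kappa = 0 := by
      rw [← show σ.lambdaMinus 0 = σ.kappa from hp, lambdaMinus, hA]
      simp
    refine Asymptotics.IsBigO.of_bound 1 (Eventually.of_forall fun q => ?_)
    rw [quadSub, quad_eq, hκ]
    simp

theorem exists_isLocalEigenvector {p : Plane} (hp : p ∈ σ.S)
    (hc : ContDiffAt ℝ 2 (fun q => ‖σ.A q‖) p) : ∃ v, σ.IsLocalEigenvector p v := by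
  by_cases hA : σ.A p = 0
  · exact ⟨_, isLocalEigenvector_const hp hA⟩
  · exact ⟨_, isLocalEigenvector_lowerEigenvector hp hA hc⟩

end Coupling

end LocalEigenvector

section TrialSequence

theorem memLp_of_norm_le_of_eq_zero {f : Plane → ℂ} (hf : Measurable f) {C R : ℝ}
    (hC : ∀ ξ, ‖f ξ‖ ≤ C) (hR : ∀ ξ, R ≤ ‖ξ‖ → f ξ = 0) : MemLp f 2 volume := by
  have hsupp : (Metric.ball (0 : Plane) R).indicator f = f :=
    Set.indicator_eq_self.mpr fun ξ hξ => mem_ball_zero_iff.mpr (lt_of_not_ge fun h => hξ (hR ξ h))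
  rw [← hsupp, memLp_indicator_iff_restrict Metric.isOpen_ball.measurableSet]
  have : IsFiniteMeasure (volume.restrict (Metric.ball (0 : Plane) R)) :=
    ⟨by rw [Measure.restrict_apply_univ]; exact measure_ball_lt_top⟩
  exact MemLp.of_bound hf.aestronglyMeasurable C (Eventually.of_forall hC)

theorem exists_formDomain_hat_eq {g : Plane → Fin 2 → ℂ} (hg : Measurable g) {C R : ℝ}
    (hC : ∀ ξ, ‖g ξ‖ ≤ C) (hR : ∀ ξ, R ≤ ‖ξ‖ → g ξ = 0) :
    ∃ u : FormDomain, (∀ᵐ ξ, hat u ξ = g ξ) ∧ ∀ (V : Perturbation) (i : Fin 2),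
      J V.m (u i) =ᵐ[V.m] fun x => ∫ ξ, planeWave x ξ * g ξ i := by
  let b : ContDiffBump (0 : Plane) := ⟨max R 1, max R 1 + 1, by positivity, lt_add_one _⟩
  have hb : ∀ ξ i, cutoff b ξ * g ξ i = g ξ i := by
    intro ξ i
    by_cases hξ : R ≤ ‖ξ‖
    · rw [hR ξ hξ, Pi.zero_apply, mul_zero]
    · have hmem : ξ ∈ Metric.closedBall (0 : Plane) b.rIn :=
        mem_closedBall_zero_iff.mpr ((not_le.mp hξ).le.trans (le_max_left _ _))
      rw [cutoff_apply, b.one_of_mem_closedBall hmem, Complex.ofReal_one, one_mul]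
  have hLp : ∀ i, MemLp (fun ξ => g ξ i) 2 volume := fun i =>
    memLp_of_norm_le_of_eq_zero (measurable_pi_iff.mp hg i)
      (fun ξ => (norm_le_pi_norm _ i).trans (hC ξ)) fun ξ hξ => congrFun (hR ξ hξ) i
  refine ⟨FormDomain.equiv.symm fun i => smoothing (cutoff b) ((hLp i).toLp _), ?_, fun V i => ?_⟩
  · have h : ∀ᵐ ξ, ∀ i, (𝓕 (H1.toL2 (smoothing (cutoff b) ((hLp i).toLp _))) : L2) ξ = g ξ i := by
      refine ae_all_iff.mpr fun i => ?_
      filter_upwards [fourier_smoothing (cutoff b) ((hLp i).toLp _), (hLp i).coeFn_toLp]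
        with ξ hξ hgξ
      rw [hξ, hgξ, hb]
    exact h.mono fun ξ hξ => funext hξ
  · refine (V.J_smoothing (cutoff b) ((hLp i).toLp _)).trans (Eventually.of_forall fun x => ?_)
    simp only [inner_wavePacket]
    refine integral_congr_ae ?_
    filter_upwards [(hLp i).coeFn_toLp] with ξ hξ
    rw [hξ, hb]

/-- The Fourier transform of a trial spinor: the vector field `v` weighted with the profile `φ`,
centred at the frequency `p / 2π` of the momentum `p`. -/
def trialProfile (φ : Plane → ℝ) (v : Plane → Fin 2 → ℂ) (p ξ : Plane) : Fin 2 → ℂ :=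
  (φ (ξ - (2 * Real.pi)⁻¹ • p) : ℂ) • v ((2 * Real.pi) • ξ)

theorem norm_two_pi_smul_sub (ξ p : Plane) :
    ‖(2 * Real.pi) • ξ - p‖ = 2 * Real.pi * ‖ξ - (2 * Real.pi)⁻¹ • p‖ := by
  rw [← Real.norm_of_nonneg Real.two_pi_pos.le, ← norm_smul, Real.norm_of_nonneg
    Real.two_pi_pos.le, smul_sub, smul_inv_smul₀ Real.two_pi_pos.ne']

theorem planeWave_mul_trialProfile (φ : Plane → ℝ) (v : Plane → Fin 2 → ℂ) (p x ξ : Plane)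
    (i : Fin 2) : planeWave x ξ * trialProfile φ v p ξ i =
      (φ (ξ - (2 * Real.pi)⁻¹ • p) : ℂ) * (planeWave x ξ * v ((2 * Real.pi) • ξ) i) :=
  mul_left_comm _ _ _

namespace Coupling

variable {σ : Coupling} {p : Plane} {v : Plane → Fin 2 → ℂ}

theorem norm_integral_quadSub_trialProfile_le {C δ ε : ℝ} (hC : 0 ≤ C)
    (hv : ∀ q ∈ Metric.ball p δ, ‖σ.quadSub q (v q) (v q)‖ ≤ C * ‖q - p‖ ^ 2)
    (hε : 2 * Real.pi * ε ≤ δ) {φ : Plane → ℝ} (hφ : IsLogBump ε φ) :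
    ‖∫ ξ, σ.quadSub ((2 * Real.pi) • ξ) (trialProfile φ v p ξ) (trialProfile φ v p ξ)‖ ≤
      C * (2 * Real.pi) ^ 2 * ε := by
  set ξ₀ := (2 * Real.pi)⁻¹ • p
  calc _ ≤ ∫ ξ, C * (2 * Real.pi) ^ 2 * (‖ξ - ξ₀‖ ^ 2 * φ (ξ - ξ₀) ^ 2) := by
        refine norm_integral_le_of_norm_le ((hφ.integrable_norm_sq_mul_sq.comp_sub_right
          ξ₀).const_mul _) (Eventually.of_forall fun ξ => ?_)
        rw [trialProfile, quadSub_ofReal_smul, norm_mul, Complex.norm_real,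
          Real.norm_of_nonneg (sq_nonneg _)]
        by_cases hξ : ε ≤ ‖ξ - ξ₀‖
        · rw [hφ.eq_zero _ hξ]
          simp
        · have hq : (2 * Real.pi) • ξ ∈ Metric.ball p δ := by
            rw [mem_ball_iff_norm, norm_two_pi_smul_sub]
            exact (mul_lt_mul_of_pos_left (not_le.mp hξ) Real.two_pi_pos).trans_le hε
          have hquad := hv _ hq
          rw [norm_two_pi_smul_sub] at hquad
          calc _ ≤ φ (ξ - ξ₀) ^ 2 * (C * (2 * Real.pi * ‖ξ - ξ₀‖) ^ 2) :=
                mul_le_mul_of_nonneg_left hquad (sq_nonneg _)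
            _ = _ := by ring
    _ ≤ _ := by
        rw [integral_const_mul, integral_sub_right_eq_self (fun ξ => ‖ξ‖ ^ 2 * φ ξ ^ 2) ξ₀]
        exact mul_le_mul_of_nonneg_left hφ.integral_sq_le (by positivity)

namespace IsLocalEigenvector

theorem exists_hat_eq_trialProfile (hv : σ.IsLocalEigenvector p v) {ε : ℝ} {φ : Plane → ℝ}
    (hφ : IsLogBump ε φ) :
    ∃ u : FormDomain, (∀ᵐ ξ, hat u ξ = trialProfile φ v p ξ) ∧ ∀ (V : Perturbation) (i : Fin 2),
      J V.m (u i) =ᵐ[V.m] fun x => ∫ ξ, planeWave x ξ * trialProfile φ v p ξ i := by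
  obtain ⟨B, hB⟩ := hφ.bounded
  have hφm : Measurable fun ξ => (φ (ξ - (2 * Real.pi)⁻¹ • p) : ℂ) :=
    Complex.measurable_ofReal.comp (hφ.measurable.comp (measurable_id.sub_const _))
  refine exists_formDomain_hat_eq (C := B) (R := ‖(2 * Real.pi)⁻¹ • p‖ + ε)
    (hφm.smul (hv.measurable.comp (measurable_const_smul _))) (fun ξ => ?_) fun ξ hξ => ?_
  · rw [trialProfile, norm_smul, Complex.norm_real, Real.norm_of_nonneg (hφ.nonneg _)]
    exact (mul_le_of_le_one_right (hφ.nonneg _) (hv.norm_le_one _)).trans (hB _)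
  · rw [trialProfile, hφ.eq_zero _ (by linarith [norm_sub_norm_le ξ ((2 * Real.pi)⁻¹ • p)]),
      Complex.ofReal_zero, zero_smul]

theorem norm_planeWave_mul_le_one (hv : σ.IsLocalEigenvector p v) (x ξ q : Plane) (i : Fin 2) :
    ‖planeWave x ξ * v q i‖ ≤ 1 := by
  rw [norm_mul, norm_planeWave, one_mul]
  exact (norm_le_pi_norm _ i).trans (hv.norm_le_one q)

theorem norm_integral_planeWave_le_one (hv : σ.IsLocalEigenvector p v) {ε : ℝ} {φ : Plane → ℝ}
    (hφ : IsLogBump ε φ) (x : Plane) (i : Fin 2) :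
    ‖∫ ξ, planeWave x ξ * trialProfile φ v p ξ i‖ ≤ 1 := by
  simp only [planeWave_mul_trialProfile]
  exact hφ.norm_integral_le _ fun ξ _ => hv.norm_planeWave_mul_le_one x ξ _ i

variable {ε : ℕ → ℝ} {φ : ℕ → Plane → ℝ}

theorem tendsto_integral_quadSub (hv : σ.IsLocalEigenvector p v)
    (hφ : ∀ n, IsLogBump (ε n) (φ n)) (hε : Tendsto ε atTop (𝓝 0)) :
    Tendsto (fun n => ∫ ξ, σ.quadSub ((2 * Real.pi) • ξ) (trialProfile (φ n) v p ξ)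
      (trialProfile (φ n) v p ξ)) atTop (𝓝 0) := by
  obtain ⟨C, hC0, hC⟩ := hv.isBigO.exists_nonneg
  obtain ⟨δ, hδ, hball⟩ := Metric.eventually_nhds_iff_ball.mp hC.bound
  simp only [norm_pow, norm_norm] at hball
  have hsmall : Tendsto (fun n => 2 * Real.pi * ε n) atTop (𝓝 0) := by
    simpa only [mul_zero] using hε.const_mul (2 * Real.pi)
  refine squeeze_zero_norm' (a := fun n => C * (2 * Real.pi) ^ 2 * ε n) ?_ ?_
  · filter_upwards [hsmall.eventually (gt_mem_nhds hδ)] with n hn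
    exact norm_integral_quadSub_trialProfile_le hC0 hball hn.le (hφ n)
  · simpa only [mul_zero] using hε.const_mul (C * (2 * Real.pi) ^ 2)

theorem tendsto_integral_planeWave (hv : σ.IsLocalEigenvector p v)
    (hφ : ∀ n, IsLogBump (ε n) (φ n)) (hε : Tendsto ε atTop (𝓝 0)) (x : Plane) (i : Fin 2) :
    Tendsto (fun n => ∫ ξ, planeWave x ξ * trialProfile (φ n) v p ξ i) atTop
      (𝓝 (planeWave x ((2 * Real.pi)⁻¹ • p) * v p i)) := by
  have hwave : Continuous fun ξ => planeWave x ξ :=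
    continuous_planeWave.comp (Continuous.prodMk_right x)
  have hscale : Continuous fun ξ : Plane => (2 * Real.pi) • ξ := continuous_const_smul _
  have hp : (2 * Real.pi) • (2 * Real.pi)⁻¹ • p = p := smul_inv_smul₀ Real.two_pi_pos.ne' p
  have hcont : ContinuousAt (fun ξ : Plane => v ((2 * Real.pi) • ξ) i) ((2 * Real.pi)⁻¹ • p) :=
    ContinuousAt.comp_of_eq (continuousAt_pi.mp hv.continuousAt i) hscale.continuousAt hp
  have hmeas : Measurable fun ξ : Plane => v ((2 * Real.pi) • ξ) i :=
    (measurable_pi_iff.mp hv.measurable i).comp hscale.measurable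
  have hlim := IsLogBump.tendsto_integral hφ hε
    (G := fun ξ => planeWave x ξ * v ((2 * Real.pi) • ξ) i) (hwave.measurable.mul hmeas)
    (fun ξ => hv.norm_planeWave_mul_le_one x ξ _ i) (hwave.continuousAt.mul hcont)
  simpa only [planeWave_mul_trialProfile, hp] using hlim

end IsLocalEigenvector

variable (σ) in
/-- Trial spinors concentrating at the momentum `p`: their energy with respect to `H₀ - κ` tends to
zero, while in position space they tend boundedly to a plane wave with polarization `a`. -/
structure IsTrialSequence (p : Plane) (a : Fin 2 → ℂ) (u : ℕ → FormDomain) : Prop where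
  eventually_hat_eq_zero : ∀ δ > 0, ∀ᶠ n in atTop, ∀ᵐ ξ,
    δ ≤ ‖ξ - (2 * Real.pi)⁻¹ • p‖ → hat (u n) ξ = 0
  tendsto_energy : Tendsto
    (fun n => ∫ ξ, σ.quadSub ((2 * Real.pi) • ξ) (hat (u n) ξ) (hat (u n) ξ)) atTop (𝓝 0)
  ae_norm_J_le_one : ∀ (V : Perturbation) (i : Fin 2) (n : ℕ), ∀ᵐ x ∂V.m, ‖J V.m (u n i) x‖ ≤ 1
  ae_tendsto_J : ∀ (V : Perturbation) (i : Fin 2), ∀ᵐ x ∂V.m,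
    Tendsto (fun n => J V.m (u n i) x) atTop (𝓝 (planeWave x ((2 * Real.pi)⁻¹ • p) * a i))

theorem exists_isTrialSequence (hp : p ∈ σ.S) (hc : ContDiffAt ℝ 2 (fun q => ‖σ.A q‖) p) :
    ∃ (a : Fin 2 → ℂ) (u : ℕ → FormDomain), a ≠ 0 ∧ σ.IsTrialSequence p a u := by
  obtain ⟨v, hv⟩ := exists_isLocalEigenvector hp hc
  choose φ hφ using fun n : ℕ => exists_isLogBump (Nat.one_div_pos_of_nat (α := ℝ) (n := n))
  have hε : Tendsto (fun n : ℕ => 1 / ((n : ℝ) + 1)) atTop (𝓝 0) :=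
    tendsto_one_div_add_atTop_nhds_zero_nat
  choose u hu hJ using fun n => hv.exists_hat_eq_trialProfile (hφ n)
  refine ⟨v p, u, hv.apply_ne_zero, fun δ hδ => ?_, ?_, fun V i n => ?_, fun V i => ?_⟩
  · filter_upwards [hε.eventually (gt_mem_nhds hδ)] with n hn
    filter_upwards [hu n] with ξ hξ hle
    rw [hξ, trialProfile, (hφ n).eq_zero _ (hn.le.trans hle), Complex.ofReal_zero, zero_smul]
  · refine (hv.tendsto_integral_quadSub hφ hε).congr fun n => integral_congr_ae ?_
    filter_upwards [hu n] with ξ hξ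
    rw [hξ]
  · filter_upwards [hJ n V i] with x hx
    rw [hx]
    exact hv.norm_integral_planeWave_le_one (hφ n) x i
  · filter_upwards [ae_all_iff.mpr fun n => hJ n V i] with x hx
    simp only [hx]
    exact hv.tendsto_integral_planeWave hφ hε x i

end Coupling

end TrialSequence

section GramMatrix

theorem exists_forall_re_star_dotProduct_mulVec_neg {ι : Type*} [Fintype ι]
    {M : ℕ → Matrix ι ι ℂ} {L : Matrix ι ι ℂ}
    (hM : ∀ j k, Tendsto (fun n => M n j k) atTop (𝓝 (L j k)))
    (hL : ∀ c : ι → ℂ, c ≠ 0 → (star c ⬝ᵥ L.mulVec c).re < 0) :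
    ∃ n, ∀ c : ι → ℂ, c ≠ 0 → (star c ⬝ᵥ (M n).mulVec c).re < 0 := by
  have hlim : Tendsto M atTop (𝓝 L) :=
    tendsto_pi_nhds.mpr fun j => tendsto_pi_nhds.mpr fun k => hM j k
  have hcont : Continuous fun z : Matrix ι ι ℂ × (ι → ℂ) => (star z.2 ⬝ᵥ z.1.mulVec z.2).re :=
    Complex.continuous_re.comp
      (continuous_snd.star.dotProduct (continuous_fst.matrix_mulVec continuous_snd))
  have hsphere : ∀ᶠ B in 𝓝 L, ∀ c ∈ Metric.sphere (0 : ι → ℂ) 1,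
      (star c ⬝ᵥ B.mulVec c).re < 0 :=
    (isCompact_sphere _ _).eventually_forall_of_forall_eventually fun c hc =>
      (hcont.tendsto (L, c)).eventually
        (gt_mem_nhds (hL c (ne_zero_of_mem_unit_sphere (⟨c, hc⟩ : Metric.sphere _ _))))
  obtain ⟨n, hn⟩ := (hlim.eventually hsphere).exists
  refine ⟨n, fun c hc => ?_⟩
  have hc0 : 0 < ‖c‖ := norm_pos_iff.mpr hc
  have hunit := hn (((‖c‖⁻¹ : ℝ) : ℂ) • c) (by
    rw [mem_sphere_zero_iff_norm, norm_smul, Complex.norm_real, norm_inv, norm_norm,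
      inv_mul_cancel₀ hc0.ne'])
  rw [Matrix.mulVec_smul, re_star_ofReal_smul_dotProduct, dotProduct_smul, smul_eq_mul,
    Complex.re_ofReal_mul, ← mul_assoc] at hunit
  exact neg_of_mul_neg_right hunit (by positivity)

theorem norm_star_dotProduct_le {ι : Type*} [Fintype ι] (z w : ι → ℂ) :
    ‖star z ⬝ᵥ w‖ ≤ Fintype.card ι * (‖z‖ * ‖w‖) := by
  refine (norm_sum_le _ _).trans ((Finset.sum_le_card_nsmul _ _ (‖z‖ * ‖w‖) fun i _ => ?_).trans_eq
    (nsmul_eq_mul _ _))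
  rw [norm_mul, Pi.star_apply, norm_star]
  exact mul_le_mul (norm_le_pi_norm z i) (norm_le_pi_norm w i) (norm_nonneg _) (norm_nonneg _)

theorem star_dotProduct_gram_mulVec {α ι κ : Type*} [MeasurableSpace α] [Fintype ι] [Fintype κ]
    {μ : Measure α} {h : α → ℂ} {Ψ : ι → α → κ → ℂ}
    (hint : ∀ j k, Integrable (fun x => h x * (star (Ψ j x) ⬝ᵥ Ψ k x)) μ) (c : ι → ℂ) :
    star c ⬝ᵥ (Matrix.of fun j k => ∫ x, h x * (star (Ψ j x) ⬝ᵥ Ψ k x) ∂μ).mulVec c =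
      ∫ x, h x * (star (∑ k, c k • Ψ k x) ⬝ᵥ ∑ k, c k • Ψ k x) ∂μ := by
  have hterm : ∀ j k, Integrable (fun x => star (c j) * (h x * (star (Ψ j x) ⬝ᵥ Ψ k x)) * c k) μ :=
    fun j k => ((hint j k).const_mul _).mul_const _
  have hexpand : ∀ x, h x * (star (∑ k, c k • Ψ k x) ⬝ᵥ ∑ k, c k • Ψ k x) =
      ∑ j, ∑ k, star (c j) * (h x * (star (Ψ j x) ⬝ᵥ Ψ k x)) * c k := by
    intro x
    simp only [star_sum, star_smul, sum_dotProduct, dotProduct_sum, smul_dotProduct,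
      dotProduct_smul, Finset.mul_sum, smul_eq_mul]
    rw [Finset.sum_comm]
    refine Finset.sum_congr rfl fun j _ => Finset.sum_congr rfl fun k _ => ?_
    ring
  simp only [hexpand]
  rw [integral_finsetSum _ fun j _ => integrable_finsetSum _ fun k _ => hterm j k]
  refine Finset.sum_congr rfl fun j _ => ?_
  rw [integral_finsetSum _ fun k _ => hterm j k, Pi.star_apply, Matrix.mulVec, dotProduct,
    Finset.mul_sum]
  refine Finset.sum_congr rfl fun k _ => ?_
  rw [integral_mul_const, integral_const_mul, Matrix.of_apply, mul_assoc]

theorem continuous_sum_planeWave_smul {ι κ : Type*} [Fintype ι] (ξ : ι → Plane) (b : ι → κ → ℂ) :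
    Continuous fun x => ∑ k, planeWave x (ξ k) • b k :=
  continuous_finsetSum _ fun k _ =>
    (continuous_planeWave.comp (Continuous.prodMk_left (ξ k))).smul continuous_const

theorem norm_sum_planeWave_smul_le {ι κ : Type*} [Fintype ι] [Fintype κ] (ξ : ι → Plane)
    (b : ι → κ → ℂ) (x : Plane) : ‖∑ k, planeWave x (ξ k) • b k‖ ≤ ∑ k, ‖b k‖ := by
  refine (norm_sum_le _ _).trans_eq (Finset.sum_congr rfl fun k _ => ?_)
  rw [norm_smul, norm_planeWave, one_mul]

theorem ae_sum_planeWave_smul_ne_zero {ι κ : Type*} [Fintype ι] {ξ : ι → Plane}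
    (hξ : Function.Injective ξ) {b : ι → κ → ℂ} (hb : b ≠ 0) :
    ∀ᵐ x, ∑ k, planeWave x (ξ k) • b k ≠ 0 := by
  obtain ⟨k, hk⟩ := Function.ne_iff.mp hb
  obtain ⟨i, hi⟩ := Function.ne_iff.mp hk
  filter_upwards [ae_sum_mul_planeWave_ne_zero hξ (a := fun k => b k i)
    (Function.ne_iff.mpr ⟨k, hi⟩)] with x hx hzero
  refine hx (Eq.trans ?_ (congrFun hzero i))
  rw [Finset.sum_apply]
  exact Finset.sum_congr rfl fun k _ => mul_comm _ _

namespace Perturbation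

variable (V : Perturbation)

theorem integrable_mul_star_dotProduct {Φ Ψ : Plane → Fin 2 → ℂ} (hΦ : Continuous Φ)
    (hΨ : Continuous Ψ) {C D : ℝ} (hC : ∀ x, ‖Φ x‖ ≤ C) (hD : ∀ x, ‖Ψ x‖ ≤ D) :
    Integrable (fun x => (V.h x : ℂ) * (star (Φ x) ⬝ᵥ Ψ x)) V.m := by
  refine V.integrable_h.ofReal.mul_bdd (c := 2 * (C * D))
    (hΦ.star.dotProduct hΨ).aestronglyMeasurable (Eventually.of_forall fun x => ?_)
  refine (norm_star_dotProduct_le _ _).trans ?_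
  rw [Fintype.card_fin, Nat.cast_ofNat]
  gcongr
  exacts [(norm_nonneg _).trans (hC x), hC x, hD x]

variable {V}

theorem re_integral_mul_star_dotProduct_neg (hneg : V.nu ≤ 0) (hsupp : 0 < volume V.supp)
    {Φ : Plane → Fin 2 → ℂ} (hΦ : Continuous Φ) {C : ℝ} (hC : ∀ x, ‖Φ x‖ ≤ C)
    (hΦ0 : ∀ᵐ x, Φ x ≠ 0) : (∫ x, (V.h x : ℂ) * (star (Φ x) ⬝ᵥ Φ x) ∂V.m).re < 0 := by
  have hint := V.integrable_mul_star_dotProduct hΦ hΦ hC hC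
  have hre : ∀ x, ((V.h x : ℂ) * (star (Φ x) ⬝ᵥ Φ x)).re = V.h x * ∑ i, ‖Φ x i‖ ^ 2 := fun x => by
    rw [Complex.re_ofReal_mul, re_star_dotProduct_self]
  have hcomm : (∫ x, (V.h x : ℂ) * (star (Φ x) ⬝ᵥ Φ x) ∂V.m).re =
      ∫ x, V.h x * ∑ i, ‖Φ x i‖ ^ 2 ∂V.m := by
    simp only [← hre]
    exact (integral_re hint).symm
  have hnonpos : (fun x => V.h x * ∑ i, ‖Φ x i‖ ^ 2) ≤ᵐ[V.m] 0 := by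
    filter_upwards [V.ae_h_nonpos hneg] with x hx
    exact mul_nonpos_of_nonpos_of_nonneg hx (Finset.sum_nonneg fun i _ => sq_nonneg _)
  have hintre : Integrable (fun x => V.h x * ∑ i, ‖Φ x i‖ ^ 2) V.m := by
    simp only [← hre]
    exact hint.re
  have hvol : volume (Φ ⁻¹' {0}) = 0 := by simpa only [not_not] using! ae_iff.mp hΦ0
  rw [hcomm]
  refine lt_of_le_of_ne (integral_nonpos_of_ae hnonpos) fun hzero => ?_
  have hae := (integral_eq_zero_iff_of_nonneg_ae (hnonpos.mono fun x hx => neg_nonneg.mpr hx)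
    hintre.neg).mp (by rw [← neg_zero, ← hzero]; exact integral_neg _)
  refine not_ae_eq_zero_of_notMem hsupp (isClosed_singleton.preimage hΦ : IsClosed (Φ ⁻¹' {0}))
    hvol ?_
  filter_upwards [hae] with x hx hxZ
  refine (mul_eq_zero.mp (neg_eq_zero.mp hx)).resolve_right fun hsum => hxZ (funext fun i => ?_)
  exact norm_eq_zero.mp ((pow_eq_zero_iff two_ne_zero).mp
    ((Finset.sum_eq_zero_iff_of_nonneg fun i _ => sq_nonneg _).mp hsum i (Finset.mem_univ _)))

-- The matrix is the limit of the Gram matrices of the trial spinors with respect to `ν`.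
theorem re_star_dotProduct_gram_planeWave_neg (hneg : V.nu ≤ 0) (hsupp : 0 < volume V.supp)
    {ι : Type*} [Fintype ι] {ξ : ι → Plane} (hξ : Function.Injective ξ) {a : ι → Fin 2 → ℂ}
    (ha : ∀ j, a j ≠ 0) {c : ι → ℂ} (hc : c ≠ 0) :
    (star c ⬝ᵥ (Matrix.of fun j k => ∫ x, (V.h x : ℂ) * (star (planeWave x (ξ j) • a j) ⬝ᵥ
      (planeWave x (ξ k) • a k)) ∂V.m).mulVec c).re < 0 := by
  have hwave : ∀ j, Continuous fun x => planeWave x (ξ j) • a j := fun j =>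
    (continuous_planeWave.comp (Continuous.prodMk_left (ξ j))).smul continuous_const
  have hnorm : ∀ j x, ‖planeWave x (ξ j) • a j‖ ≤ ‖a j‖ := fun j x => by
    rw [norm_smul, norm_planeWave, one_mul]
  have hb : (fun k => c k • a k) ≠ 0 := by
    obtain ⟨k, hk⟩ := Function.ne_iff.mp hc
    exact Function.ne_iff.mpr ⟨k, smul_ne_zero hk (ha k)⟩
  rw [star_dotProduct_gram_mulVec fun j k =>
    V.integrable_mul_star_dotProduct (hwave j) (hwave k) (hnorm j) (hnorm k)]
  simp only [smul_comm (c _) (planeWave _ _)]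
  exact re_integral_mul_star_dotProduct_neg hneg hsupp (continuous_sum_planeWave_smul ξ _)
    (norm_sum_planeWave_smul_le ξ _) (ae_sum_planeWave_smul_ne_zero hξ hb)

end Perturbation

end GramMatrix

section Counting

variable {σ : Coupling} {V : Perturbation}

theorem shiftedForm_neg_kappa (u v : Fin 2 → H1) :
    shiftedForm σ V (-σ.kappa) u v =
      (∫ ξ, σ.quadSub ((2 * Real.pi) • ξ) (hat u ξ) (hat v ξ)) + V.form u v := by
  simp only [Coupling.quadSub]
  rw [shiftedForm, form, inner_spinorIncl, σ.form₀_eq_integral_quad,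
    integral_sub (σ.integrable_quad _ _)
      ((integrable_star_hat_dotProduct_hat _ _).const_mul _), integral_const_mul]
  push_cast
  ring

theorem shiftedForm_sum_smul (t : ℝ) {ι : Type*} [Fintype ι] (u : ι → FormDomain) (c : ι → ℂ) :
    shiftedForm σ V t (∑ j, c j • u j : FormDomain) (∑ k, c k • u k : FormDomain) =
      star c ⬝ᵥ (Matrix.of fun j k => shiftedForm σ V t (u j) (u k)).mulVec c := by
  rw [← shiftedFormL_apply, map_sum (shiftedFormL σ V t), sum_apply]
  refine Finset.sum_congr rfl fun j _ => ?_
  rw [map_sum, Matrix.mulVec, dotProduct, Finset.mul_sum]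
  refine Finset.sum_congr rfl fun k _ => ?_
  rw [shiftedFormL_apply, map_smul, map_smul, shiftedForm_smul_left, shiftedForm_smul_right,
    Matrix.of_apply, Pi.star_apply]
  ring

theorem Perturbation.tendsto_form {u w : ℕ → FormDomain} {Φ Ψ : Plane → Fin 2 → ℂ}
    (hu : ∀ i n, ∀ᵐ x ∂V.m, ‖J V.m (u n i) x‖ ≤ 1) (hw : ∀ i n, ∀ᵐ x ∂V.m, ‖J V.m (w n i) x‖ ≤ 1)
    (hΦ : ∀ i, ∀ᵐ x ∂V.m, Tendsto (fun n => J V.m (u n i) x) atTop (𝓝 (Φ x i)))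
    (hΨ : ∀ i, ∀ᵐ x ∂V.m, Tendsto (fun n => J V.m (w n i) x) atTop (𝓝 (Ψ x i))) :
    Tendsto (fun n => V.form (u n) (w n)) atTop
      (𝓝 (∫ x, (V.h x : ℂ) * (star (Φ x) ⬝ᵥ Ψ x) ∂V.m)) := by
  refine tendsto_integral_of_dominated_convergence (fun x => |V.h x| * 2)
    (fun n => (V.integrable_form _ _).aestronglyMeasurable) (V.integrable_h.abs.mul_const 2)
    (fun n => ?_) ?_
  · filter_upwards [ae_all_iff.mpr fun i => hu i n, ae_all_iff.mpr fun i => hw i n] with x hx hy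
    rw [norm_mul, Complex.norm_real, Real.norm_eq_abs]
    refine mul_le_mul_of_nonneg_left ((norm_star_dotProduct_le _ _).trans ?_) (abs_nonneg _)
    rw [Fintype.card_fin, Nat.cast_ofNat]
    exact mul_le_of_le_one_right zero_le_two (mul_le_one₀
      ((pi_norm_le_iff_of_nonneg zero_le_one).mpr hx) (norm_nonneg _)
      ((pi_norm_le_iff_of_nonneg zero_le_one).mpr hy))
  · filter_upwards [ae_all_iff.mpr hΦ, ae_all_iff.mpr hΨ] with x hx hy
    simp only [dotProduct, Pi.star_apply]
    exact (tendsto_finsetSum _ fun i _ => (hx i).star.mul (hy i)).const_mul _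

namespace Coupling.IsTrialSequence

theorem tendsto_integral_quadSub_of_ne {p q : Plane} {a b : Fin 2 → ℂ} {u w : ℕ → FormDomain}
    (hu : σ.IsTrialSequence p a u) (hw : σ.IsTrialSequence q b w) (hpq : p ≠ q) :
    Tendsto (fun n => ∫ ξ, σ.quadSub ((2 * Real.pi) • ξ) (hat (u n) ξ) (hat (w n) ξ)) atTop
      (𝓝 0) := by
  set d : ℝ := ‖(2 * Real.pi)⁻¹ • p - (2 * Real.pi)⁻¹ • q‖ with hd
  have hd0 : 0 < d := norm_pos_iff.mpr (sub_ne_zero.mpr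
    ((smul_right_injective Plane (inv_ne_zero Real.two_pi_pos.ne')).ne hpq))
  refine tendsto_const_nhds.congr' ?_
  filter_upwards [hu.eventually_hat_eq_zero _ (half_pos hd0),
    hw.eventually_hat_eq_zero _ (half_pos hd0)] with n hun hwn
  refine (integral_eq_zero_of_ae ?_).symm
  filter_upwards [hun, hwn] with ξ hξu hξw
  rcases le_or_gt (d / 2) ‖ξ - (2 * Real.pi)⁻¹ • p‖ with hfar | hnear
  · rw [hξu hfar, σ.quadSub_zero_left, Pi.zero_apply]
  · have htri : d ≤ ‖ξ - (2 * Real.pi)⁻¹ • p‖ + ‖ξ - (2 * Real.pi)⁻¹ • q‖ := by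
      rw [hd, norm_sub_rev ξ]
      exact norm_sub_le_norm_sub_add_norm_sub _ _ _
    rw [hξw (by linarith), σ.quadSub_zero_right, Pi.zero_apply]

theorem tendsto_shiftedForm {ι : Type*} {p : ι → Plane} {a : ι → Fin 2 → ℂ}
    {u : ι → ℕ → FormDomain} (hu : ∀ j, σ.IsTrialSequence (p j) (a j) (u j))
    (hp : Function.Injective p) (j k : ι) :
    Tendsto (fun n => shiftedForm σ V (-σ.kappa) (u j n) (u k n)) atTop
      (𝓝 (∫ x, (V.h x : ℂ) * (star (planeWave x ((2 * Real.pi)⁻¹ • p j) • a j) ⬝ᵥ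
        (planeWave x ((2 * Real.pi)⁻¹ • p k) • a k)) ∂V.m)) := by
  simp only [shiftedForm_neg_kappa]
  rw [← zero_add (∫ x, _ ∂V.m)]
  refine Tendsto.add ?_ (V.tendsto_form ((hu j).ae_norm_J_le_one V) ((hu k).ae_norm_J_le_one V)
    ((hu j).ae_tendsto_J V) ((hu k).ae_tendsto_J V))
  rcases eq_or_ne j k with rfl | hjk
  · exact (hu j).tendsto_energy
  · exact (hu j).tendsto_integral_quadSub_of_ne (hu k) (hp.ne hjk)

end Coupling.IsTrialSequence

theorem le_rank_of_injective_of_mem_S (h : IsRelativelyBounded σ V) (hσ : σ.IsC2NearS)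
    (hneg : V.nu ≤ 0) (hsupp : 0 < volume V.supp) {N : ℕ} {p : Fin N → Plane}
    (hinj : Function.Injective p) (hp : ∀ j, p j ∈ σ.S) :
    (N : Cardinal) ≤ Module.rank ℂ
      (⨆ E ∈ Set.Iio σ.kappa, eigenspace (hamiltonian σ V) E : Submodule ℂ Spinor) := by
  obtain ⟨U, hU, hSU, hC2⟩ := hσ
  choose a u ha hu using fun j => Coupling.exists_isTrialSequence (hp j)
    (hC2.contDiffAt (hU.mem_nhds (hSU (hp j))))
  have hξ : Function.Injective fun j => (2 * Real.pi)⁻¹ • p j :=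
    (smul_right_injective Plane (inv_ne_zero Real.two_pi_pos.ne')).comp hinj
  obtain ⟨n, hn⟩ := exists_forall_re_star_dotProduct_mulVec_neg
    (M := fun n => Matrix.of fun j k => shiftedForm σ V (-σ.kappa) (u j n) (u k n))
    (Coupling.IsTrialSequence.tendsto_shiftedForm hu hinj)
    fun c hc => Perturbation.re_star_dotProduct_gram_planeWave_neg hneg hsupp hξ ha hc
  refine le_rank_iSup_eigenspace_hamiltonian h
    (Fintype.linearCombination ℂ fun j => u j n) fun c hc => ?_
  have hlt := hn c hc
  rw [← shiftedForm_sum_smul, ← Fintype.linearCombination_apply ℂ (fun j => u j n) c,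
    re_shiftedForm_self] at hlt
  rw [formIncl_apply, form, Complex.add_re]
  linarith

theorem encard_S_le_countBelow (h : IsRelativelyBounded σ V) (hσ : σ.IsC2NearS) (hneg : V.nu ≤ 0)
    (hsupp : 0 < volume V.supp) : σ.S.encard ≤ countBelow (hamiltonian σ V) σ.kappa := by
  refine ENat.forall_natCast_le_iff_le.mp fun N hN => ?_
  obtain ⟨t, htS, ht⟩ := Set.exists_subset_encard_eq hN
  have hfin : t.Finite := Set.finite_of_encard_eq_coe ht
  have : Fintype t := hfin.fintype
  have hcard : Fintype.card t = N := ENat.natCast_inj.mp ((Set.coe_fintypeCard t).trans ht)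
  have hrank := le_rank_of_injective_of_mem_S h hσ hneg hsupp
    (Subtype.val_injective.comp (Fintype.equivFinOfCardEq hcard).symm.injective)
    fun j => htS ((Fintype.equivFinOfCardEq hcard).symm j).2
  simpa only [countBelow, Cardinal.toENat_nat] using OrderHomClass.mono Cardinal.toENat hrank

theorem infinite_eigenvaluesBelow (h : IsRelativelyBounded σ V) (hσ : σ.IsC2NearS)
    (hneg : V.nu ≤ 0) (hsupp : 0 < volume V.supp) (hS : σ.S.Infinite) :
    (eigenvaluesBelow (hamiltonian σ V) σ.kappa).Infinite := by
  intro hfin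
  set W : Submodule ℂ Spinor :=
    ⨆ E ∈ eigenvaluesBelow (hamiltonian σ V) σ.kappa, eigenspace (hamiltonian σ V) E with hW
  have hWfin : FiniteDimensional ℂ W := by
    have : Finite (eigenvaluesBelow (hamiltonian σ V) σ.kappa) := hfin
    have : ∀ E : eigenvaluesBelow (hamiltonian σ V) σ.kappa,
        FiniteDimensional ℂ (eigenspace (hamiltonian σ V) E) := fun E =>
      finiteDimensional_eigenspace_hamiltonian h E.2.1
    rw [hW, iSup_subtype']
    infer_instance
  have hle : (⨆ E ∈ Set.Iio σ.kappa, eigenspace (hamiltonian σ V) E) ≤ W := by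
    refine iSup₂_le fun E hE => ?_
    by_cases hbot : eigenspace (hamiltonian σ V) E = ⊥
    · rw [hbot]
      exact bot_le
    · exact le_iSup₂_of_le E ⟨hE, hbot⟩ le_rfl
  have hcount := encard_S_le_countBelow h hσ hneg hsupp
  rw [hS.encard_eq, top_le_iff, countBelow, Cardinal.toENat_eq_top] at hcount
  exact (Module.rank_lt_aleph0 ℂ W).not_ge (hcount.trans (Submodule.rank_mono hle))

end Counting

section LinearCouplings

theorem continuous_integral_mul_norm_sq {α : Type*} [MeasurableSpace α] {μ : Measure α}
    {h : α → ℝ} (hh : Measurable h) {C : ℝ} (hC : ∀ x, |h x| ≤ C) :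
    Continuous fun g : Lp ℂ 2 μ => ∫ x, h x * ‖g x‖ ^ 2 ∂μ := by
  have hmem : MemLp (fun x => (h x : ℂ)) ∞ μ :=
    memLp_top_of_bound (Complex.measurable_ofReal.comp hh).aestronglyMeasurable C
      (Eventually.of_forall fun x => by simpa using hC x)
  let M : Lp ℂ 2 μ →L[ℂ] Lp ℂ 2 μ := (ContinuousLinearMap.mul ℂ ℂ).holderL μ ∞ 2 2 (hmem.toLp _)
  have hM : ∀ g, M g =ᵐ[μ] fun x => (h x : ℂ) * g x := fun g => by
    filter_upwards [(ContinuousLinearMap.mul ℂ ℂ).coeFn_holder (r := 2) (hmem.toLp _) g,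
      hmem.coeFn_toLp] with x h1 h2
    exact h1.trans (by rw [h2, ContinuousLinearMap.mul_apply'])
  have hinner : ∀ g : Lp ℂ 2 μ, ∫ x, h x * ‖g x‖ ^ 2 ∂μ = (⟪g, M g⟫_ℂ).re := fun g => by
    rw [L2.inner_def]
    refine (integral_congr_ae ?_).trans (integral_re (L2.integrable_inner (𝕜 := ℂ) g (M g)))
    filter_upwards [hM g] with x hx
    rw [hx, RCLike.inner_apply, mul_assoc, Complex.mul_conj', RCLike.re_eq_complex_re]
    norm_cast
  simp only [hinner]
  exact Complex.continuous_re.comp (continuous_id.inner M.continuous)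

theorem integrable_norm_schwartz_sq (μ : Measure Plane) [μ.HasTemperateGrowth] (φ : 𝓢(Plane, ℂ)) :
    Integrable (fun x => ‖φ x‖ ^ 2) μ :=
  (memLp_two_iff_integrable_sq_norm φ.continuous.aestronglyMeasurable).mp (φ.memLp 2 μ)

theorem norm_schwartz_toLp_sq (μ : Measure Plane) [μ.HasTemperateGrowth] (φ : 𝓢(Plane, ℂ)) :
    ‖φ.toLp 2 μ‖ ^ 2 = ∫ x, ‖φ x‖ ^ 2 ∂μ := by
  rw [L2_norm_sq]
  exact integral_congr_ae ((φ.coeFn_toLp 2 μ).mono fun x hx => by simp only [hx])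

theorem norm_schwartzToH1_sq (φ : 𝓢(Plane, ℂ)) : ‖schwartzToH1 φ‖ ^ 2 =
    (∫ x, ‖φ x‖ ^ 2) + ∫ x, ∑ i : Fin 2, ‖(∂_{e i} φ : 𝓢(Plane, ℂ)) x‖ ^ 2 := by
  rw [integral_finsetSum _ fun i _ => integrable_norm_schwartz_sq _ _,
    show ‖schwartzToH1 φ‖ = ‖(schwartzToH1 φ).1‖ from rfl,
    WithLp.prod_norm_sq_eq_of_L2, PiLp.norm_sq_eq_of_L2]
  simp only [← norm_schwartz_toLp_sq]
  rfl

namespace Perturbation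

variable (V : Perturbation)

theorem two_mul_abs_integral_schwartz_le (φ : 𝓢(Plane, ℂ)) :
    2 * |∫ x, V.h x * ‖φ x‖ ^ 2 ∂V.m| ≤ ∫ x, (1 + |V.h x| ^ 2) * ‖φ x‖ ^ 2 ∂V.m := by
  obtain ⟨C, hC⟩ := V.bounded
  have hint : Integrable (fun x => (1 + |V.h x| ^ 2) * ‖φ x‖ ^ 2) V.m := by
    refine (integrable_norm_schwartz_sq V.m φ).bdd_mul (c := 1 + C ^ 2) ?_
      (Eventually.of_forall fun x => ?_)
    · exact ((V.measurable.abs.pow_const 2).const_add 1).aestronglyMeasurable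
    · rw [Real.norm_of_nonneg (by positivity)]
      gcongr
      exact hC x
  rw [← abs_two, ← abs_mul, ← integral_const_mul, ← Real.norm_eq_abs]
  refine norm_integral_le_of_norm_le hint (Eventually.of_forall fun x => ?_)
  rw [norm_mul, norm_mul, Real.norm_of_nonneg (sq_nonneg ‖φ x‖), ← mul_assoc, Real.norm_eq_abs,
    Real.norm_eq_abs, abs_two]
  refine mul_le_mul_of_nonneg_right ?_ (sq_nonneg _)
  nlinarith [sq_nonneg (|V.h x| - 1)]

theorem exists_two_mul_abs_integral_le : ∃ a b : ℝ, 0 < a ∧ a < 1 ∧ ∀ f : H1,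
    2 * |∫ x, V.h x * ‖J V.m f x‖ ^ 2 ∂V.m| ≤ a * ‖f‖ ^ 2 + b * ‖H1.toL2 f‖ ^ 2 := by
  obtain ⟨a, b, ha, ha1, -, hab⟩ := V.form_bound
  obtain ⟨C, hC⟩ := V.bounded
  refine ⟨a, b, ha, ha1, fun f => denseRange_schwartzToH1.induction_on
    (p := fun f => 2 * |∫ x, V.h x * ‖J V.m f x‖ ^ 2 ∂V.m| ≤
      a * ‖f‖ ^ 2 + b * ‖H1.toL2 f‖ ^ 2) f ?_ fun φ => ?_⟩
  · have hform : Continuous fun f : H1 => ∫ x, V.h x * ‖J V.m f x‖ ^ 2 ∂V.m :=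
      (continuous_integral_mul_norm_sq V.measurable hC).comp (J V.m).continuous
    have htoL2 : Continuous fun f : H1 => H1.toL2 f := H1.toL2L.continuous
    exact isClosed_le (continuous_const.mul hform.abs) (by fun_prop)
  · have hJ : ∫ x, V.h x * ‖J V.m (schwartzToH1 φ) x‖ ^ 2 ∂V.m = ∫ x, V.h x * ‖φ x‖ ^ 2 ∂V.m := by
      rw [V.J_schwartz]
      exact integral_congr_ae ((φ.coeFn_toLp 2 V.m).mono fun x hx => by simp only [hx])
    have htoL2 : ‖H1.toL2 (schwartzToH1 φ)‖ ^ 2 = ∫ x, ‖φ x‖ ^ 2 := norm_schwartz_toLp_sq volume φ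
    have hφ : 0 ≤ ∫ x, ‖φ x‖ ^ 2 := integral_nonneg fun x => by positivity
    rw [hJ, norm_schwartzToH1_sq, htoL2]
    linarith [V.two_mul_abs_integral_schwartz_le φ, hab φ, mul_nonneg ha.le hφ]

theorem form_self (u : Fin 2 → H1) :
    V.form u u = ((∑ i, ∫ x, V.h x * ‖J V.m (u i) x‖ ^ 2 ∂V.m : ℝ) : ℂ) := by
  obtain ⟨C, hC⟩ := V.bounded
  have hint : ∀ i, Integrable (fun x => V.h x * ‖J V.m (u i) x‖ ^ 2) V.m := fun i =>
    (L2_integrable_sq (J V.m (u i))).bdd_mul (c := C) V.measurable.aestronglyMeasurable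
      (Eventually.of_forall hC)
  rw [← integral_finsetSum _ fun i _ => hint i, ← integral_complex_ofReal]
  refine integral_congr_ae (Eventually.of_forall fun x => ?_)
  simp only [dotProduct, Pi.star_apply, Complex.star_def, Complex.conj_mul']
  push_cast
  rw [Finset.mul_sum]

theorem exists_two_mul_norm_form_self_le : ∃ a b : ℝ, 0 < a ∧ a < 1 ∧ ∀ u : Fin 2 → H1,
    2 * ‖V.form u u‖ ≤ a * ∑ i, ‖u i‖ ^ 2 + b * ‖spinorIncl u‖ ^ 2 := by
  obtain ⟨a, b, ha, ha1, hab⟩ := V.exists_two_mul_abs_integral_le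
  refine ⟨a, b, ha, ha1, fun u => ?_⟩
  rw [V.form_self, Complex.norm_real, Real.norm_eq_abs, norm_spinorIncl_sq, Finset.mul_sum,
    Finset.mul_sum, ← Finset.sum_add_distrib]
  calc 2 * |∑ i, ∫ x, V.h x * ‖J V.m (u i) x‖ ^ 2 ∂V.m|
      ≤ 2 * ∑ i, |∫ x, V.h x * ‖J V.m (u i) x‖ ^ 2 ∂V.m| := by
        gcongr
        exact Finset.abs_sum_le_sum_abs _ _
    _ ≤ ∑ i, (a * ‖u i‖ ^ 2 + b * ‖H1.toL2 (u i)‖ ^ 2) := by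
        rw [Finset.mul_sum]
        exact Finset.sum_le_sum fun i _ => hab (u i)

end Perturbation

namespace Coupling

variable {σ : Coupling} {c : ℝ}

theorem lambdaMinus_eq_of_linear (hA : ∀ p, ‖σ.A p‖ = c * ‖p‖) (p : Plane) :
    σ.lambdaMinus p = (‖p‖ - c / 2) ^ 2 - c ^ 2 / 4 := by
  rw [lambdaMinus, hA]
  ring

theorem kappa_eq_of_linear (hc : 0 ≤ c) (hA : ∀ p, ‖σ.A p‖ = c * ‖p‖) :
    σ.kappa = -(c ^ 2 / 4) := by
  refine le_antisymm ?_ (le_ciInf fun q => ?_)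
  · have h := σ.kappa_le_lambdaMinus ((c / 2) • e 0)
    rw [lambdaMinus_eq_of_linear hA, norm_smul, PiLp.norm_single, norm_one, mul_one,
      Real.norm_of_nonneg (by positivity)] at h
    linarith
  · rw [lambdaMinus_eq_of_linear hA]
    linarith [sq_nonneg (‖q‖ - c / 2)]

theorem mem_S_of_linear (hc : 0 ≤ c) (hA : ∀ p, ‖σ.A p‖ = c * ‖p‖) {p : Plane} :
    p ∈ σ.S ↔ ‖p‖ = c / 2 := by
  change σ.lambdaMinus p = σ.kappa ↔ _
  rw [kappa_eq_of_linear hc hA, lambdaMinus_eq_of_linear hA, sub_eq_add_neg, add_eq_right,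
    sq_eq_zero_iff, sub_eq_zero]

theorem infinite_S_of_linear (hc : 0 < c) (hA : ∀ p, ‖σ.A p‖ = c * ‖p‖) : σ.S.Infinite := by
  refine Set.infinite_of_injOn_mapsTo (s := Set.Icc 0 (c / 2))
    (f := fun t => (!₂[t, √((c / 2) ^ 2 - t ^ 2)] : Plane)) ?_ (fun t ht => ?_)
    (Set.Icc_infinite (by positivity))
  · intro s _ t _ hst
    simpa using congrArg (fun p : Plane => p 0) hst
  · have ht2 : 0 ≤ (c / 2) ^ 2 - t ^ 2 := sub_nonneg.mpr (pow_le_pow_left₀ ht.1 ht.2 2)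
    rw [mem_S_of_linear hc.le hA, EuclideanSpace.norm_eq, Fin.sum_univ_two]
    simp only [Matrix.cons_val_zero, Matrix.cons_val_one, Real.norm_eq_abs, sq_abs,
      Real.sq_sqrt ht2, add_sub_cancel]
    exact Real.sqrt_sq (by positivity)

theorem isC2NearS_of_linear (hc : 0 < c) (hA : ∀ p, ‖σ.A p‖ = c * ‖p‖) : σ.IsC2NearS := by
  refine ⟨{0}ᶜ, isOpen_compl_singleton, fun p hp hp0 => ?_, fun p hp => ?_⟩
  · rw [mem_S_of_linear hc.le hA, Set.mem_singleton_iff.mp hp0, norm_zero] at hp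
    linarith
  · simp only [hA]
    exact (contDiffAt_const.mul (contDiffAt_norm ℝ hp)).contDiffWithinAt

theorem isRelativelyBounded_of_linear (hA : ∀ p, ‖σ.A p‖ = c * ‖p‖) (V : Perturbation) :
    IsRelativelyBounded σ V := by
  obtain ⟨a, b, ha, ha1, hform⟩ := V.exists_two_mul_norm_form_self_le
  have hcoercive := σ.mul_sum_norm_sq_le_re_form₀_add (θ := 1 / 2) (C := c ^ 2 / 2) (fun p => by
    rw [hA]
    linarith [sq_nonneg (‖p‖ - c)]) (by norm_num)
  refine ⟨a, a * (c ^ 2 / 2 + 1) + b / 2, ha1, fun u => ?_⟩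
  linarith [hform u, mul_le_mul_of_nonneg_left (hcoercive u) ha.le]

end Coupling

theorem infinite_eigenvaluesBelow_of_linear {σ : Coupling} {V : Perturbation} {c : ℝ} (hc : 0 < c)
    (hA : ∀ p, ‖σ.A p‖ = c * ‖p‖) (hneg : V.nu ≤ 0) (hsupp : 0 < volume V.supp) :
    (eigenvaluesBelow (hamiltonian σ V) σ.kappa).Infinite :=
  infinite_eigenvaluesBelow (Coupling.isRelativelyBounded_of_linear hA V)
    (Coupling.isC2NearS_of_linear hc hA) hneg hsupp (Coupling.infinite_S_of_linear hc hA)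

theorem norm_rashba (α : ℝ) (p : Plane) : ‖(rashba α).A p‖ = |α| * ‖p‖ := by
  change ‖(α : ℂ) * (p 1 + Complex.I * p 0)‖ = _
  rw [norm_mul, Complex.norm_real, Real.norm_eq_abs, mul_comm Complex.I, Complex.norm_add_mul_I,
    EuclideanSpace.norm_eq, Fin.sum_univ_two, Real.norm_eq_abs, Real.norm_eq_abs, sq_abs, sq_abs,
    add_comm]

theorem norm_dresselhaus (α : ℝ) (p : Plane) : ‖(dresselhaus α).A p‖ = |α| * ‖p‖ := by
  change ‖-(α : ℂ) * (p 0 + Complex.I * p 1)‖ = _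
  rw [norm_mul, norm_neg, Complex.norm_real, Real.norm_eq_abs, mul_comm Complex.I,
    Complex.norm_add_mul_I, EuclideanSpace.norm_eq, Fin.sum_univ_two, Real.norm_eq_abs,
    Real.norm_eq_abs, sq_abs, sq_abs]

end LinearCouplings

end SpinOrbit

end

theorem corollary1 (V : SpinOrbit.Perturbation) (hneg : V.nu ≤ 0)
    (hsupp : 0 < MeasureTheory.volume V.supp) :
    (∀ σ : SpinOrbit.Coupling, σ.IsC2NearS → SpinOrbit.IsRelativelyBounded σ V →
      σ.S.encard ≤ SpinOrbit.countBelow (SpinOrbit.hamiltonian σ V) σ.kappa ∧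
      (σ.S.Infinite →
        (SpinOrbit.eigenvaluesBelow (SpinOrbit.hamiltonian σ V) σ.kappa).Infinite)) ∧
    (∀ α : ℝ, α ≠ 0 →
      (SpinOrbit.eigenvaluesBelow (SpinOrbit.hamiltonian (SpinOrbit.rashba α) V)
        (SpinOrbit.rashba α).kappa).Infinite ∧
      (SpinOrbit.eigenvaluesBelow (SpinOrbit.hamiltonian (SpinOrbit.dresselhaus α) V)
        (SpinOrbit.dresselhaus α).kappa).Infinite) :=
  ⟨fun _ hσ h => ⟨SpinOrbit.encard_S_le_countBelow h hσ hneg hsupp,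
    SpinOrbit.infinite_eigenvaluesBelow h hσ hneg hsupp⟩,
  fun α hα =>
    ⟨SpinOrbit.infinite_eigenvaluesBelow_of_linear (abs_pos.mpr hα) (SpinOrbit.norm_rashba α)
      hneg hsupp,
    SpinOrbit.infinite_eigenvaluesBelow_of_linear (abs_pos.mpr hα) (SpinOrbit.norm_dresselhaus α)
      hneg hsupp⟩⟩
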